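/- Fix $d\ge 1$, $\beta,L,M,c>0$ and $x_0\in[0,1]^d$, and let $\lfloor\beta\rfloor$ be the largest integer strictly smaller than $\beta$. **Model.** For $n\ge1$ one observes $Z^{(n)}=(X_i,Y_i)_{i\le n}$, $Y_i=f(X_i)+\xi_i$, where the $X_i$ are uniform on $[0,1]^d$, $\xi_i$ has density $g_i$, and all the $X_i$ and $\xi_i$ are independent. Each $g_i$ is a symmetric probability density that is monotone on $(0,\infty)$. $\mathbb E_f$ is the expectation under the law of $Z^{(n)}$. **Hölder class.** $\mathbb H_d(\beta,L,M)$ is the set of $f:[0,1]^d\to\mathbb R$ having all partial derivatives $\partial^pf$ of order $|p|\le\lfloor\beta\rfloor$ on $[0,1]^d$, with $|\partial^pf(x)-\partial^pf(y)|\le L\|x-y\|_1^{\beta-\lfloor\beta\rfloor}$ for $|p|=\lfloor\beta\rfloor$ and $x,y\in[0,1]^d$, and $\sum_{|p|\le\lfloor\beta\rfloor}\sup_{x\in[0,1]^d}|\partial^pf(x)|\le M$. **Contrast.** $\rho:\mathbb R\to[0,\infty)$ is even, convex, differentiable, $\rho(0)=0$, and $\rho'$ is bounded and $1$-Lipschitz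 (so $\rho''$ exists almost everywhere). There are $L_\rho,\alpha>0$ with $\int|\rho''(z+u)-\rho''(z+v)|\,g_i(z)\,dz\le L_\rho|u-v|^\alpha$ for all $i$ and all $u,v\in\mathbb R$. The sequence $(g_i)_{i\ge1}$ belongs to $\mathcal G_\rho^{(c)}$, i.e. $\int\rho''g_i\ge c$ for all $i$. **Kernel.** $K:\mathbb R^d\to[0,\infty)$ is bounded and measurable, vanishes outside $[-\frac12,\frac12]^d$, and $\int K=1$. Moreover $K$ has positive integral over the set of $z$ such that $z_j\ge0$ whenever $x_{0,j}=0$ and $z_j\le0$ whenever $x_{0,j}=1$ (automatic if $x_0$ is an interior point of the cube). **Estimator.** Let $\bar h=(L^2n)^{-1/(2\beta+d)}$, $V=\{x\in[0,1]^d: |x_j-x_{0,j}|\le\bar h/2 \text{ for all } j\}$ and $f_t(x)=\sum_{|p|\le\lfloor\beta\rfloor}t_p\big(\tfrac{x-x_0}{\bar h}\big)^p\,\mathbf 1_V(x)$. Let $\hat\theta$ minimise $$\frac1{n\bar h^d}\sum_{i=1}^n\rho\big(Y_i-f_t(X_i)\big)\,K\Big(\frac{X_i-x_0}{\bar h}\Big)$$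 over $t=(t_p)_{|p|\le\lfloor\beta\rfloor}$ with $\|t\|_1\le M$. Let $\hat f_n=\hat\theta_{0,\dots,0}$; the minimiser may be chosen arbitrarily, provided $\hat f_n$ is a measurable function of $Z^{(n)}$. **Claim.** Let $\varphi_n=n^{-\beta/(2\beta+d)}$. For an estimator $\tilde f$, i.e. a measurable function of $Z^{(n)}$, put $R_{n,r}[\tilde f]=\sup_{f\in\mathbb H_d(\beta,L,M)}\mathbb E_f|\tilde f-f(x_0)|^r$. 1. For every $r\ge1$, $\limsup_{n\to\infty}\varphi_n^{-r}R_{n,r}[\hat f_n]<\infty$. 2. Suppose moreover that there are $v_0>0$ and $\kappa$ such that $\int g_i(u)\ln\frac{g_i(u)}{g_i(u+v)}\,du\le\kappa v^2$ for all $i$ and all $|v|\le v_0$. Then for every $r\ge1$ also $\liminf_{n\to\infty}\varphi_n^{-r}\inf_{\tilde f}R_{n,r}[\tilde f]>0$ (infimum over all estimators), and in particular $\liminf_{n\to\infty}\varphi_n^{-r}R_{n,r}[\hat f_n]>0$. Hence $\varphi_n$ is the minimax rate and $\hat f_n$ is asymptotically minimax. -/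

import Mathlib

open MeasureTheory Filter Set
open scoped ENNReal Topology

noncomputable section

namespace RhoLPA

/-- The unit cube `[0,1]^d`. -/
def cube (d : ℕ) : Set (Fin d → ℝ) := Icc 0 1

/-- The largest integer strictly smaller than `β` (for `β > 0`). -/
def strictFloor (β : ℝ) : ℕ := ⌈β⌉₊ - 1

/-- The set `S_b` of multi-indices `p ∈ ℕ^d` with `|p| ≤ b`. -/
def multiIndices (d b : ℕ) : Finset (Fin d → ℕ) :=
  (Fintype.piFinset fun _ => Finset.range (b + 1)).filter fun p => ∑ j, p j ≤ b

theorem mem_multiIndices {d b : ℕ} {p : Fin d → ℕ} :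
    p ∈ multiIndices d b ↔ ∑ j, p j ≤ b := by
  simp only [multiIndices, Finset.mem_filter, Fintype.mem_piFinset, Finset.mem_range,
    and_iff_right_iff_imp]
  intro h j
  have := Finset.single_le_sum (f := p) (fun _ _ => Nat.zero_le _) (Finset.mem_univ j)
  omega

/-- The multi-index `(0, …, 0)`. -/
def zeroIndex (d b : ℕ) : multiIndices d b := ⟨0, by simp [mem_multiIndices]⟩

/-! ### The isotropic Hölder class -/

/-- Partial derivative in the `j`-th coordinate of a function on `[0,1]^d` (one-sided on the
faces of the cube). -/
def partialDeriv {d : ℕ} (j : Fin d) (f : (Fin d → ℝ) → ℝ) (x : Fin d → ℝ) : ℝ :=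
  derivWithin (fun t => f (Function.update x j t)) (Icc 0 1) (x j)

/-- `∂^{|p|} f / ∂x_1^{p_1} ⋯ ∂x_d^{p_d}` on `[0,1]^d`. -/
def iterPartial {d : ℕ} (p : Fin d → ℕ) (f : (Fin d → ℝ) → ℝ) : (Fin d → ℝ) → ℝ :=
  (List.finRange d).foldr (fun j g => (partialDeriv j)^[p j] g) f

/-- The isotropic Hölder class `ℍ_d(β, L, M)`. A function on `[0,1]^d` is represented by a
function on `ℝ^d` whose values outside the cube play no role. -/
structure IsHolder (d : ℕ) (β L M : ℝ) (f : (Fin d → ℝ) → ℝ) : Prop where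
  /-- all partial derivatives up to order `⌊β⌋` exist on the cube -/
  exists_partial : ∀ p : Fin d → ℕ, ∑ j, p j < strictFloor β → ∀ j, ∀ x ∈ cube d,
    DifferentiableWithinAt ℝ (fun t => iterPartial p f (Function.update x j t)) (Icc 0 1) (x j)
  /-- those of order `⌊β⌋` are Hölder continuous for the `ℓ¹` distance -/
  holder : ∀ p : Fin d → ℕ, ∑ j, p j = strictFloor β → ∀ x ∈ cube d, ∀ y ∈ cube d,
    |iterPartial p f x - iterPartial p f y| ≤ L * (∑ j, |x j - y j|) ^ (β - strictFloor β)
  /-- the sum of the sup-norms of all partial derivatives of order at most `⌊β⌋` -/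
  bounded : ∑ p ∈ multiIndices d (strictFloor β),
    ⨆ x ∈ cube d, ENNReal.ofReal |iterPartial p f x| ≤ ENNReal.ofReal M

/-! ### The regression model -/

/-- `g` is a probability density on `ℝ`, symmetric and monotone (hence nonincreasing) on the
positive half-line. -/
structure IsNoiseDensity (g : ℝ → ℝ) : Prop where
  measurable : Measurable g
  nonneg : ∀ z, 0 ≤ g z
  lintegral_eq_one : ∫⁻ z, ENNReal.ofReal (g z) = 1
  symm : ∀ z, g (-z) = g z
  antitone : AntitoneOn g (Ioi 0)

/-- The law on `ℝ` with Lebesgue density `g`. -/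
def noiseLaw (g : ℝ → ℝ) : Measure ℝ := volume.withDensity fun z => ENNReal.ofReal (g z)

/-- Sample space of `Z^{(n)} = (X_i, Y_i)_{i ≤ n}`. -/
abbrev Sample (d n : ℕ) : Type := Fin n → (Fin d → ℝ) × ℝ

/-- The law `ℙ_f` of `Z^{(n)}`: `X_i` uniform on `[0,1]^d`, `Y_i = f(X_i) + ξ_i` with `ξ_i` of
density `g_i`, all the `X_i` and `ξ_i` independent. -/
def sampleLaw (d n : ℕ) (g : ℕ → ℝ → ℝ) (f : (Fin d → ℝ) → ℝ) : Measure (Sample d n) :=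
  Measure.pi fun i : Fin n =>
    Measure.map (fun w : (Fin d → ℝ) × ℝ => (w.1, f w.1 + w.2))
      ((volume.restrict (cube d)).prod (noiseLaw (g i)))

/-! ### Contrast functions and the classes of noise densities -/

/-- `ρ` is a contrast function (relative to the noise densities `g_i`). -/
structure IsContrast (ρ : ℝ → ℝ) (g : ℕ → ℝ → ℝ) : Prop where
  nonneg : ∀ z, 0 ≤ ρ z
  symm : ∀ z, ρ (-z) = ρ z
  convex : ConvexOn ℝ univ ρ
  map_zero : ρ 0 = 0
  differentiable : Differentiable ℝ ρ
  lipschitz_deriv : LipschitzWith 1 (deriv ρ)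
  bounded_deriv : ∃ B, ∀ z, |deriv ρ z| ≤ B
  ae_twice_differentiable : ∀ᵐ z, DifferentiableAt ℝ (deriv ρ) z
  smooth_second : ∃ Lρ : ℝ, 0 < Lρ ∧ ∃ α : ℝ, 0 < α ∧ ∀ i, ∀ u v : ℝ,
    ∫ z, |deriv (deriv ρ) (z + u) - deriv (deriv ρ) (z + v)| * g i z ≤ Lρ * |u - v| ^ α

/-- The set `𝒢_ρ^{(c)}` of sequences of noise densities. -/
def densityClass (ρ : ℝ → ℝ) (c : ℝ) : Set (ℕ → ℝ → ℝ) :=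
  {g | (∀ i, IsNoiseDensity (g i)) ∧ ∀ i, c ≤ ∫ z, deriv (deriv ρ) z * g i z}

/-- Kernel: nonnegative, bounded, supported in `[-1/2,1/2]^d`, with integral one. -/
structure IsKernel {d : ℕ} (K : (Fin d → ℝ) → ℝ) : Prop where
  measurable : Measurable K
  nonneg : ∀ z, 0 ≤ K z
  bounded : ∃ B, ∀ z, K z ≤ B
  support : Function.support K ⊆ Icc (fun _ => -(1 / 2)) (fun _ => 1 / 2)
  integral_eq_one : ∫ z, K z = 1

/-- The directions at `x₀ ∈ [0,1]^d` that point into the cube (all of `ℝ^d` if `x₀` is an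
interior point). -/
def inwardDirections {d : ℕ} (x₀ : Fin d → ℝ) : Set (Fin d → ℝ) :=
  {z | ∀ j, (x₀ j = 0 → 0 ≤ z j) ∧ (x₀ j = 1 → z j ≤ 0)}

/-! ### The `ρ`-LPA estimator -/

/-- The neighbourhood `V_{x₀}(h)`. -/
def nbhd {d : ℕ} (x₀ : Fin d → ℝ) (h : ℝ) : Set (Fin d → ℝ) :=
  Icc (fun j => x₀ j - h / 2) (fun j => x₀ j + h / 2) ∩ cube d

/-- The local polynomial `f_t`. -/
def localPoly {d b : ℕ} (x₀ : Fin d → ℝ) (h : ℝ) (t : multiIndices d b → ℝ) :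
    (Fin d → ℝ) → ℝ :=
  (nbhd x₀ h).indicator fun x => ∑ p, t p * ∏ j, ((x j - x₀ j) / h) ^ (p.1 j)

/-- The `ℓ¹` ball `Θ(M)` of coefficients. -/
def coeffBall (d b : ℕ) (M : ℝ) : Set (multiIndices d b → ℝ) := {t | ∑ p, |t p| ≤ M}

/-- The local `ρ`-criterion. -/
def criterion {d b n : ℕ} (ρ : ℝ → ℝ) (K : (Fin d → ℝ) → ℝ) (x₀ : Fin d → ℝ) (h : ℝ)
    (z : Sample d n) (t : multiIndices d b → ℝ) : ℝ :=
  1 / (n * h ^ d) *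
    ∑ i, ρ ((z i).2 - localPoly x₀ h t (z i).1) * K (fun j => ((z i).1 j - x₀ j) / h)

/-- `fhat` is a `ρ`-LPA estimator of the value at `x₀` (bandwidth `h`, degree `b`): a measurable
function of the sample that is the `(0, …, 0)` coordinate of a minimiser of the local
`ρ`-criterion over `Θ(M)`. -/
def IsLPAEstimator {d n : ℕ} (b : ℕ) (M : ℝ) (ρ : ℝ → ℝ) (K : (Fin d → ℝ) → ℝ)
    (x₀ : Fin d → ℝ) (h : ℝ) (fhat : Sample d n → ℝ) : Prop :=
  Measurable fhat ∧ ∀ z, ∃ θ ∈ coeffBall d b M,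
    (∀ t ∈ coeffBall d b M, criterion ρ K x₀ h z θ ≤ criterion ρ K x₀ h z t) ∧
    fhat z = θ (zeroIndex d b)

/-- The bandwidth `(L² n)^{-1/(2β+d)}`. -/
def bandwidth (d : ℕ) (β L : ℝ) (n : ℕ) : ℝ := (L ^ 2 * n) ^ (-(1 / (2 * β + d)))

/-- The rate `n^{-β/(2β+d)}`. -/
def rate (d : ℕ) (β : ℝ) (n : ℕ) : ℝ := (n : ℝ) ^ (-(β / (2 * β + d)))

/-! ### Risks -/

/-- Maximal risk over `ℍ_d(β, L, M)` of an estimator of `f(x₀)`. -/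
def maxRisk {d n : ℕ} (β L M : ℝ) (g : ℕ → ℝ → ℝ) (x₀ : Fin d → ℝ) (r : ℝ)
    (fhat : Sample d n → ℝ) : ℝ≥0∞ :=
  ⨆ f, ⨆ _ : IsHolder d β L M f,
    ∫⁻ z, ENNReal.ofReal (|fhat z - f x₀| ^ r) ∂(sampleLaw d n g f)

/-- Minimax risk: infimum of the maximal risk over all (measurable) estimators. -/
def minimaxRisk {d : ℕ} (n : ℕ) (β L M : ℝ) (g : ℕ → ℝ → ℝ) (x₀ : Fin d → ℝ) (r : ℝ) : ℝ≥0∞ :=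
  ⨅ fhat : Sample d n → ℝ, ⨅ _ : Measurable fhat, maxRisk β L M g x₀ r fhat

/-- `limsup ψ_n^{-r} R_{n,r}[fhat, ℍ_d(β,L,M)] < ∞`. -/
def UpperBound {d : ℕ} (β L M : ℝ) (g : ℕ → ℝ → ℝ) (x₀ : Fin d → ℝ) (r : ℝ) (ψ : ℕ → ℝ)
    (fhat : ∀ n, Sample d n → ℝ) : Prop :=
  limsup (fun n => ENNReal.ofReal (ψ n ^ (-r)) * maxRisk β L M g x₀ r (fhat n)) atTop < ∞

/-- `ψ` is the minimax rate of convergence and `fhat` is asymptotically minimax: no estimator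
improves on the rate `ψ` in order, and `fhat` attains it. -/
structure IsMinimax {d : ℕ} (β L M : ℝ) (g : ℕ → ℝ → ℝ) (x₀ : Fin d → ℝ) (r : ℝ) (ψ : ℕ → ℝ)
    (fhat : ∀ n, Sample d n → ℝ) : Prop where
  lower_minimax :
    0 < liminf (fun n => ENNReal.ofReal (ψ n ^ (-r)) * minimaxRisk n β L M g x₀ r) atTop
  lower :
    0 < liminf (fun n => ENNReal.ofReal (ψ n ^ (-r)) * maxRisk β L M g x₀ r (fhat n)) atTop
  upper : UpperBound β L M g x₀ r ψ fhat

/-- Kullback condition on the noise: for some `v₀ > 0` and `κ`, every `g_i` satisfies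
`∫ g_i(u) log (g_i(u) / g_i(u + v)) du ≤ κ v²` for `|v| ≤ v₀`. -/
def KullbackCondition (g : ℕ → ℝ → ℝ) : Prop :=
  ∃ v₀ : ℝ, 0 < v₀ ∧ ∃ κ : ℝ, ∀ i, ∀ v : ℝ, |v| ≤ v₀ →
    InformationTheory.klDiv (noiseLaw (g i)) (noiseLaw fun u => g i (u + v))
      ≤ ENNReal.ofReal (κ * v ^ 2)

end RhoLPA

end

/-! Upper bound. Let `θ` be the rescaled Taylor coefficients of `f` at `x₀`. They lie in the
coefficient ball once `h ≤ 1`, and on the support of the kernel the local polynomial misses `f` by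
at most a constant times `h ^ β`. The criterion is convex in the coefficients. So if a minimiser
lies at distance more than `δ` from `θ`, then at distance `δ` on the way to it the criterion cannot
be increasing. Hence, in some unit direction `e`, the growth of the score between `θ` and `θ + δ •
e` is at most the gradient term at `θ` (`exists_direction`). Both sides are sums of independent
terms. By oddness of `ρ'` and symmetry of the noise, the mean score vanishes at `0`, and it is
1-Lipschitz, so the mean gradient is at most bias times `h ^ d` per observation. Near `0` the mean
score has slope at least `c / 2`, so the mean curvature is at least of order `δ * h ^ d`, provided
the kernel-weighted quadratic form of polynomials is nondegenerate on the part of the kernel window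
inside the cube. That follows from compactness of the sphere and the a.e. nonvanishing of nonzero
polynomials (`exists_design_lower_bound`). For `δ` above a multiple of `h ^ β` the two means are
separated. A Chernoff bound then gives deviation probability `C * exp (-a * n * h ^ d * δ ^ 2)`
(`exists_deviation_bound`). A finite net of directions handles the curvature, and the signed unit
vectors handle the gradient, which is linear in `e`. With the chosen bandwidth, `h ^ β` is a
multiple of the rate `φ` and `n * h ^ d * φ ^ 2` is constant. So the error divided by `φ` has
exponential tails uniformly over the class, and all its moments are bounded.

Lower bound. Le Cam's two-point method compares `0` with a bump of height of order `φ` and width of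
order `n ^ (-1 / (2 * β + d))`, which belongs to the class (`exists_isHolder_bump`). The Kullback
condition bounds the Hellinger affinity of one observation below by `1 - O(1 / n)`. Affinities
multiply over independent observations, so the affinity of the samples stays above `1 / 2` and no
test separates the two hypotheses (`sq_affinity_le`, `le_maxRisk_of_affinity`). -/

noncomputable section

namespace RhoLPA

/-! ### Taylor expansion in the Hölder class -/

/-- One-dimensional Taylor expansion with a Hölder remainder. -/
theorem abs_sub_taylor_le {L γ : ℝ} (hL : 0 ≤ L) (hγ : 0 ≤ γ) {s : ℝ} (hs : s ∈ Icc (0 : ℝ) 1) :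
    ∀ (m : ℕ) (φ : ℕ → ℝ → ℝ),
      (∀ k < m, ∀ t ∈ Icc (0 : ℝ) 1, HasDerivWithinAt (φ k) (φ (k + 1) t) (Icc 0 1) t) →
      (∀ t ∈ Icc (0 : ℝ) 1, |φ m t - φ m s| ≤ L * |t - s| ^ γ) →
      ∀ t ∈ Icc (0 : ℝ) 1,
        |φ 0 t - ∑ k ∈ Finset.range (m + 1), φ k s * ((t - s) ^ k / k.factorial)| ≤
          L * |t - s| ^ ((m : ℝ) + γ) := by
  intro m
  induction m with
  | zero =>
    intro φ _ h t ht
    simpa using h t ht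
  | succ m ih =>
    intro φ hd h t ht
    have ih' := ih (fun k => φ (k + 1)) (fun k hk t ht => hd (k + 1) (by omega) t ht) h
    set G : ℝ → ℝ := fun t =>
      φ 0 t - ∑ k ∈ Finset.range (m + 1 + 1), φ k s * ((t - s) ^ k / k.factorial) with hG
    set G' : ℝ → ℝ := fun t =>
      φ 1 t - ∑ k ∈ Finset.range (m + 1), φ (k + 1) s * ((t - s) ^ k / k.factorial) with hG'
    -- The derivative of the remainder of `φ 0` is the remainder of the shifted family, which the
    -- induction hypothesis bounds. The mean value inequality then gains one factor `|t - s|`.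
    have hder : ∀ t ∈ Icc (0 : ℝ) 1, HasDerivWithinAt G (G' t) (Icc 0 1) t := by
      intro t ht
      refine (hd 0 (by omega) t ht).sub ?_
      have : HasDerivAt (fun t : ℝ => ∑ k ∈ Finset.range (m + 1 + 1),
          φ k s * ((t - s) ^ k / k.factorial))
          (∑ k ∈ Finset.range (m + 1 + 1),
            φ k s * ((k : ℝ) * (t - s) ^ (k - 1) * 1 / k.factorial)) t := by
        refine HasDerivAt.fun_sum fun k _ => ?_
        exact ((((hasDerivAt_id t).sub_const s).pow k).div_const _).const_mul _
      rw [Finset.sum_range_succ'] at this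
      convert this.hasDerivWithinAt using 1
      rw [Nat.cast_zero, zero_mul, zero_mul, zero_div, mul_zero, add_zero]
      refine Finset.sum_congr rfl fun k _ => ?_
      rw [Nat.factorial_succ]
      push_cast
      have : (k.factorial : ℝ) ≠ 0 := by positivity
      have : (k : ℝ) + 1 ≠ 0 := by positivity
      field_simp
    have hsub : uIcc s t ⊆ Icc (0 : ℝ) 1 := ordConnected_Icc.uIcc_subset hs ht
    have hbd : ∀ u ∈ uIcc s t, ‖G' u‖ ≤ L * |t - s| ^ ((m : ℝ) + γ) := by
      intro u hu
      refine (ih' u (hsub hu)).trans ?_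
      have : |u - s| ≤ |t - s| := abs_sub_left_of_mem_uIcc hu
      gcongr
    have hmv := Convex.norm_image_sub_le_of_norm_hasDerivWithin_le
      (fun u hu => (hder u (hsub hu)).mono hsub) hbd (convex_uIcc s t) left_mem_uIcc right_mem_uIcc
    have hGs : G s = 0 := by
      simp [hG, Finset.sum_range_succ']
    rw [hGs, sub_zero, Real.norm_eq_abs, Real.norm_eq_abs] at hmv
    refine hmv.trans ?_
    rcases eq_or_ne t s with rfl | hts
    · simp only [sub_self, abs_zero, mul_zero]
      positivity
    · have hpos : 0 < |t - s| := abs_pos.2 (sub_ne_zero.2 hts)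
      rw [mul_assoc, ← Real.rpow_add_one hpos.ne']
      push_cast
      apply le_of_eq
      ring_nf

theorem update_mem_cube {d : ℕ} {x : Fin d → ℝ} (hx : x ∈ cube d) (j : Fin d) {t : ℝ}
    (ht : t ∈ Icc (0 : ℝ) 1) : Function.update x j t ∈ cube d := by
  constructor
  · intro i
    by_cases h : i = j
    · subst h; simpa using ht.1
    · simpa [h] using hx.1 i
  · intro i
    by_cases h : i = j
    · subst h; simpa using ht.2
    · simpa [h] using hx.2 i

/-- In `iterPartial` the smallest coordinate is differentiated last. If `p` vanishes below `j`, one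
more derivative in `j` lands directly on the block of `j`, so mixed partials never have to be
interchanged. The Taylor expansion below is arranged so that only this case occurs. -/
theorem foldr_partialDeriv_succ {d : ℕ} (f : (Fin d → ℝ) → ℝ) (j : Fin d) (p : Fin d → ℕ)
    (hp : ∀ i < j, p i = 0) :
    ∀ l : List (Fin d), l.Pairwise (· < ·) → j ∈ l →
      partialDeriv j (l.foldr (fun j g => (partialDeriv j)^[p j] g) f) =
        l.foldr (fun i g => (partialDeriv i)^[Function.update p j (p j + 1) i] g) f
  | [], _, h => by simp at h
  | a :: l, hl, h => by
    rw [List.pairwise_cons] at hl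
    rcases eq_or_ne a j with rfl | haj
    · have hrest : l.foldr (fun i g => (partialDeriv i)^[Function.update p a (p a + 1) i] g) f =
          l.foldr (fun j g => (partialDeriv j)^[p j] g) f := by
        refine List.foldr_ext _ _ f fun b hb _ => ?_
        rw [Function.update_of_ne (hl.1 b hb).ne']
      simp only [List.foldr_cons, hrest, Function.update_self, Function.iterate_succ_apply']
    · have hj : j ∈ l := by simpa [haj.symm] using h
      have ha : p a = 0 := hp a (hl.1 j hj)
      simp only [List.foldr_cons, Function.update_of_ne haj, ha, Function.iterate_zero, id]
      exact foldr_partialDeriv_succ f j p hp l hl.2 hj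

theorem partialDeriv_iterPartial {d : ℕ} (f : (Fin d → ℝ) → ℝ) (j : Fin d) (p : Fin d → ℕ)
    (hp : ∀ i < j, p i = 0) :
    partialDeriv j (iterPartial p f) = iterPartial (Function.update p j (p j + 1)) f :=
  foldr_partialDeriv_succ f j p hp _ (List.pairwise_lt_finRange d) (List.mem_finRange j)

theorem iterPartial_zero {d : ℕ} (f : (Fin d → ℝ) → ℝ) : iterPartial 0 f = f := by
  unfold iterPartial
  induction List.finRange d with
  | nil => rfl
  | cons a l _ => simp

/-- The monomial `(x - x₀)^p / p!`. -/
def taylorMonomial {d : ℕ} (p : Fin d → ℕ) (w : Fin d → ℝ) : ℝ :=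
  ∏ j, w j ^ p j / (p j).factorial

theorem sum_update_eq {d : ℕ} (q : Fin d → ℕ) (j : Fin d) (hq : q j = 0) (k : ℕ) :
    ∑ i, Function.update q j k i = (∑ i, q i) + k := by
  rw [Finset.sum_update_of_mem (Finset.mem_univ j), add_comm,
    ← Finset.add_sum_erase _ _ (Finset.mem_univ j), hq, zero_add, Finset.sdiff_singleton_eq_erase]

theorem taylorMonomial_update {d : ℕ} (q : Fin d → ℕ) (j : Fin d) (hq : q j = 0) (k : ℕ)
    (w : Fin d → ℝ) :
    taylorMonomial (Function.update q j k) w = w j ^ k / k.factorial * taylorMonomial q w := by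
  unfold taylorMonomial
  rw [← Finset.mul_prod_erase _ _ (Finset.mem_univ j),
    ← Finset.mul_prod_erase Finset.univ (fun i => w i ^ q i / (q i).factorial)
      (Finset.mem_univ j)]
  simp only [Function.update_self, hq, pow_zero, Nat.factorial_zero, Nat.cast_one, div_one, one_mul]
  congr 1
  refine Finset.prod_congr rfl fun i hi => ?_
  rw [Function.update_of_ne (Finset.ne_of_mem_erase hi)]

theorem abs_taylorMonomial_le {d : ℕ} (p : Fin d → ℕ) (w : Fin d → ℝ) {Δ : ℝ}
    (hw : ∀ j, |w j| ≤ Δ) : |taylorMonomial p w| ≤ Δ ^ (∑ j, p j) := by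
  unfold taylorMonomial
  rw [Finset.abs_prod, ← Finset.prod_pow_eq_pow_sum]
  refine Finset.prod_le_prod (fun _ _ => abs_nonneg _) fun j _ => ?_
  rw [abs_div, abs_pow, Nat.abs_cast]
  refine (div_le_self (by positivity) (by exact_mod_cast Nat.factorial_pos _)).trans ?_
  exact pow_le_pow_left₀ (abs_nonneg _) (hw j) _

/-- The multi-indices of order at most `b` supported in the coordinates `≥ j`. -/
def tailIndices (d b j : ℕ) : Finset (Fin d → ℕ) :=
  (multiIndices d b).filter fun p => ∀ i : Fin d, i.1 < j → p i = 0

theorem mem_tailIndices {d b j : ℕ} {p : Fin d → ℕ} :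
    p ∈ tailIndices d b j ↔ ∑ i, p i ≤ b ∧ ∀ i : Fin d, i.1 < j → p i = 0 := by
  simp [tailIndices, mem_multiIndices]

/-- Splits off the `j`-th exponent: `p` corresponds to the pair formed by `p` with its `j`-th entry
erased and that entry. -/
theorem sum_tailIndices {d b : ℕ} (j : Fin d) (F : (Fin d → ℕ) → ℝ) :
    ∑ p ∈ tailIndices d b j, F p =
      ∑ q ∈ tailIndices d b (j + 1), ∑ k ∈ Finset.range (b - ∑ i, q i + 1),
        F (Function.update q j k) := by
  rw [Finset.sum_sigma']
  have key : ∀ q ∈ tailIndices d b (j + 1), q j = 0 := fun q hq =>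
    (mem_tailIndices.1 hq).2 j (Nat.lt_succ_self _)
  refine Finset.sum_bij' (fun p _ => ⟨Function.update p j 0, p j⟩)
    (fun s _ => Function.update s.1 j s.2) ?_ ?_ ?_ ?_ ?_
  · intro p hp
    rw [mem_tailIndices] at hp
    have h0 := sum_update_eq (Function.update p j 0) j (by simp) (p j)
    simp only [Function.update_idem, Function.update_eq_self] at h0
    simp only [Finset.mem_sigma, mem_tailIndices, Finset.mem_range]
    refine ⟨⟨by omega, fun i hi => ?_⟩, by omega⟩
    rcases eq_or_ne i j with rfl | hij
    · simp
    · rw [Function.update_of_ne hij]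
      refine hp.2 i ?_
      have : i.1 ≠ j.1 := fun h => hij (Fin.ext h)
      omega
  · intro s hs
    simp only [Finset.mem_sigma, Finset.mem_range] at hs
    have hz := key _ hs.1
    rw [mem_tailIndices] at hs
    rw [mem_tailIndices, sum_update_eq _ _ hz]
    refine ⟨by omega, fun i hi => ?_⟩
    rw [Function.update_of_ne (by rintro rfl; omega)]
    exact hs.1.2 i (by omega)
  · intro p _
    simp
  · rintro ⟨q, k⟩ hs
    simp only [Finset.mem_sigma] at hs
    have hz := key _ hs.1
    simp only [Function.update_idem, Function.update_self, ← hz, Function.update_eq_self]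
  · intro p _
    simp

/-- The point whose coordinates are those of `x` below `j` and those of `x₀` from `j` on. -/
def mixPoint {d : ℕ} (x x₀ : Fin d → ℝ) (j : ℕ) : Fin d → ℝ := fun i => if i.1 < j then x i else x₀ i

theorem mixPoint_mem {d : ℕ} {x x₀ : Fin d → ℝ} (hx : x ∈ cube d) (hx₀ : x₀ ∈ cube d) (j : ℕ) :
    mixPoint x x₀ j ∈ cube d := by
  constructor <;> intro i <;> unfold mixPoint <;> split_ifs
  exacts [hx.1 i, hx₀.1 i, hx.2 i, hx₀.2 i]

theorem mixPoint_succ {d : ℕ} (x x₀ : Fin d → ℝ) (j : Fin d) :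
    mixPoint x x₀ (j + 1) = Function.update (mixPoint x x₀ j) j (x j) := by
  ext i
  rcases eq_or_ne i j with rfl | hij
  · simp [mixPoint]
  · rw [Function.update_of_ne hij]
    have : i.1 ≠ j.1 := fun h => hij (Fin.ext h)
    have : (i.1 < j + 1) ↔ i.1 < j := by omega
    simp [mixPoint, this]

theorem strictFloor_add_le {β : ℝ} (hβ : 0 < β) :
    (strictFloor β : ℝ) < β ∧ β ≤ strictFloor β + 1 := by
  have h1 : 1 ≤ ⌈β⌉₊ := Nat.one_le_iff_ne_zero.2 (Nat.ceil_pos.2 hβ).ne'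
  have h2 : ((strictFloor β : ℕ) : ℝ) = (⌈β⌉₊ : ℝ) - 1 := by
    simp [strictFloor, Nat.cast_sub h1]
  rw [h2]
  exact ⟨by linarith [Nat.ceil_lt_add_one hβ.le], by linarith [Nat.le_ceil β]⟩

/-- Moving only coordinate `j` from `x₀ j` to `x j`, each index `q` supported beyond `j` contributes
the one-dimensional Taylor remainder of `∂^q f` of order `b - |q|`, times the monomial of `q`. -/
theorem IsHolder.taylor_step {d : ℕ} {β L M : ℝ} (hβ : 0 < β) (hL : 0 ≤ L)
    {f : (Fin d → ℝ) → ℝ} (hf : IsHolder d β L M f) {x x₀ : Fin d → ℝ} (hx : x ∈ cube d)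
    (hx₀ : x₀ ∈ cube d) {Δ : ℝ} (hΔ : ∀ j, |x j - x₀ j| ≤ Δ) (j : Fin d) :
    |∑ p ∈ tailIndices d (strictFloor β) (j + 1),
        iterPartial p f (mixPoint x x₀ (j + 1)) * taylorMonomial p (x - x₀) -
      ∑ p ∈ tailIndices d (strictFloor β) j,
        iterPartial p f (mixPoint x x₀ j) * taylorMonomial p (x - x₀)| ≤
      (multiIndices d (strictFloor β)).card * (L * Δ ^ β) := by
  set b := strictFloor β with hb
  obtain ⟨hb1, hb2⟩ := strictFloor_add_le hβ
  rw [sum_tailIndices j, ← Finset.sum_sub_distrib]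
  refine (Finset.abs_sum_le_sum_abs _ _).trans ?_
  have hΔ0 : 0 ≤ Δ := (abs_nonneg _).trans (hΔ j)
  refine (Finset.sum_le_card_nsmul _ _ (L * Δ ^ β) fun q hq => ?_).trans ?_
  · have hq' := mem_tailIndices.1 hq
    have hqj : q j = 0 := hq'.2 j (Nat.lt_succ_self _)
    set m := b - ∑ i, q i with hm
    set y := mixPoint x x₀ j with hy
    have hyc : y ∈ cube d := mixPoint_mem hx hx₀ _
    have hyj : y j = x₀ j := by simp [hy, mixPoint]
    have hIcc : ∀ z ∈ cube d, z j ∈ Icc (0 : ℝ) 1 := fun z hz => ⟨hz.1 j, hz.2 j⟩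
    have hmb : (m : ℝ) + ∑ i, (q i : ℝ) = b := by
      have : m + ∑ i, q i = b := by omega
      exact_mod_cast this
    have ht := abs_sub_taylor_le (γ := β - b) hL (by linarith) (hIcc x₀ hx₀) m
      (fun k t => iterPartial (Function.update q j k) f (Function.update y j t)) ?_ ?_
      (x j) (hIcc x hx)
    · rw [mixPoint_succ, ← hy]
      have hqq : Function.update q j 0 = q := by rw [← hqj]; simp
      have hyy : Function.update y j (x₀ j) = y := by rw [← hyj]; simp
      simp only [hqq, hyy] at ht
      have hrw : iterPartial q f (Function.update y j (x j)) * taylorMonomial q (x - x₀) -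
          ∑ k ∈ Finset.range (m + 1), iterPartial (Function.update q j k) f y *
            taylorMonomial (Function.update q j k) (x - x₀) =
          (iterPartial q f (Function.update y j (x j)) - ∑ k ∈ Finset.range (m + 1),
            iterPartial (Function.update q j k) f y * ((x j - x₀ j) ^ k / k.factorial)) *
            taylorMonomial q (x - x₀) := by
        rw [sub_mul, Finset.sum_mul]
        congr 1
        refine Finset.sum_congr rfl fun k _ => ?_
        rw [taylorMonomial_update _ _ hqj, Pi.sub_apply, mul_assoc]
      rw [hrw, abs_mul]
      -- The exponents add up to `β` because `m + |q| = b`.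
      calc _ ≤ (L * |x j - x₀ j| ^ ((m : ℝ) + (β - b))) * Δ ^ (∑ i, q i) :=
            mul_le_mul ht (abs_taylorMonomial_le _ _ hΔ) (abs_nonneg _) (by positivity)
        _ ≤ (L * Δ ^ ((m : ℝ) + (β - b))) * Δ ^ (∑ i, q i) := by
            gcongr
            exact hΔ j
        _ = L * Δ ^ β := by
            rw [mul_assoc, ← Real.rpow_natCast, ← Real.rpow_add_of_nonneg hΔ0]
            · congr 2
              push_cast
              linarith
            · have : (0 : ℝ) ≤ m := by positivity
              linarith
            · positivity
    · intro k hk t ht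
      have hsum : ∑ i, Function.update q j k i < b := by
        rw [sum_update_eq _ _ hqj]; omega
      have hdiff := hf.exists_partial _ hsum j _ (update_mem_cube hyc j ht)
      simp only [Function.update_idem, Function.update_self] at hdiff
      have hD := hdiff.hasDerivWithinAt
      have hp : ∀ i < j, Function.update q j k i = 0 := fun i hi => by
        rw [Function.update_of_ne hi.ne]
        exact hq'.2 i (by have : i.1 < j.1 := hi; omega)
      have heq := congrFun (partialDeriv_iterPartial f j _ hp) (Function.update y j t)
      simp only [Function.update_idem, Function.update_self] at heq
      rw [← heq]
      simpa only [partialDeriv, Function.update_idem, Function.update_self] using hD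
    · intro t ht
      have hsum : ∑ i, Function.update q j m i = b := by
        rw [sum_update_eq _ _ hqj]; omega
      have h := hf.holder _ hsum _ (update_mem_cube hyc j ht) _
        (update_mem_cube hyc j (hIcc x₀ hx₀))
      refine h.trans (le_of_eq ?_)
      congr 2
      rw [Finset.sum_eq_single j]
      · simp
      · intro i _ hi
        simp [hi]
      · simp
  · rw [nsmul_eq_mul]
    gcongr
    exact Finset.filter_subset _ _

/-- Taylor expansion in the Hölder class. -/
theorem IsHolder.abs_sub_taylor_le {d : ℕ} {β L M : ℝ} (hβ : 0 < β) (hL : 0 ≤ L)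
    {f : (Fin d → ℝ) → ℝ} (hf : IsHolder d β L M f) {x x₀ : Fin d → ℝ} (hx : x ∈ cube d)
    (hx₀ : x₀ ∈ cube d) {Δ : ℝ} (hΔ : ∀ j, |x j - x₀ j| ≤ Δ) :
    |f x - ∑ p ∈ multiIndices d (strictFloor β),
        iterPartial p f x₀ * taylorMonomial p (x - x₀)| ≤
      d * ((multiIndices d (strictFloor β)).card * (L * Δ ^ β)) := by
  -- The sum telescopes along the path that switches coordinates one at a time: `S 0` is the Taylor
  -- polynomial at `x₀`, and `S d` is `f x` since only the zero index survives.
  set S : ℕ → ℝ := fun j => ∑ p ∈ tailIndices d (strictFloor β) j,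
    iterPartial p f (mixPoint x x₀ j) * taylorMonomial p (x - x₀) with hS
  have h0 : S 0 = ∑ p ∈ multiIndices d (strictFloor β),
        iterPartial p f x₀ * taylorMonomial p (x - x₀) := by
    have h1 : tailIndices d (strictFloor β) 0 = multiIndices d (strictFloor β) := by
      ext p; simp [tailIndices]
    have h2 : mixPoint x x₀ 0 = x₀ := by ext i; simp [mixPoint]
    simp only [hS, h1, h2]
  have hd : S d = f x := by
    have h1 : tailIndices d (strictFloor β) d = {0} := by
      ext p
      simp only [mem_tailIndices, Finset.mem_singleton]
      constructor
      · rintro ⟨_, h⟩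
        ext i
        exact h i i.2
      · rintro rfl
        simp
    have h2 : mixPoint x x₀ d = x := by ext i; simp [mixPoint]
    simp [hS, h1, h2, iterPartial_zero, taylorMonomial]
  rw [← h0, ← hd, ← Finset.sum_range_sub]
  refine (Finset.abs_sum_le_sum_abs _ _).trans ?_
  refine (Finset.sum_le_card_nsmul _ _ ((multiIndices d (strictFloor β)).card * (L * Δ ^ β))
    fun j hj => ?_).trans_eq ?_
  · exact hf.taylor_step hβ hL hx hx₀ hΔ ⟨j, Finset.mem_range.1 hj⟩
  · simp

/-- Near each point `f` is a polynomial up to `O(‖x - x₀‖ ^ β)`. Continuity supplies the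
measurability needed to handle the law of an observation. -/
theorem IsHolder.continuousOn {d : ℕ} {β L M : ℝ} (hβ : 0 < β) (hL : 0 ≤ L)
    {f : (Fin d → ℝ) → ℝ} (hf : IsHolder d β L M f) : ContinuousOn f (cube d) := by
  intro x₀ hx₀
  set T : (Fin d → ℝ) → ℝ := fun x => ∑ p ∈ multiIndices d (strictFloor β),
        iterPartial p f x₀ * taylorMonomial p (x - x₀) with hT
  have hTc : Continuous T := by
    unfold T taylorMonomial
    simp only [Pi.sub_apply]
    fun_prop
  set C : ℝ := d * ((multiIndices d (strictFloor β)).card * L) with hC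
  have hbound : ∀ x ∈ cube d, |f x - T x| ≤ C * ‖x - x₀‖ ^ β := fun x hx => by
    refine (hf.abs_sub_taylor_le hβ hL hx hx₀ (Δ := ‖x - x₀‖) fun j => ?_).trans_eq ?_
    · exact norm_le_pi_norm (x - x₀) j
    · rw [hC]; ring
  have hTx : T x₀ = f x₀ := by
    have := hbound x₀ hx₀
    simp only [sub_self, norm_zero, Real.zero_rpow hβ.ne', mul_zero, abs_nonpos_iff] at this
    linarith
  have hlim : Tendsto (fun x => C * ‖x - x₀‖ ^ β) (𝓝[cube d] x₀) (𝓝 0) := by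
    have : Continuous fun x : Fin d → ℝ => C * ‖x - x₀‖ ^ β :=
      continuous_const.mul ((continuous_id.sub continuous_const).norm.rpow_const
        fun _ => Or.inr hβ.le)
    have h := (this.tendsto x₀).mono_left (nhdsWithin_le_nhds (s := cube d))
    simpa [Real.zero_rpow hβ.ne'] using h
  have h1 : Tendsto (fun x => f x - T x) (𝓝[cube d] x₀) (𝓝 0) :=
    squeeze_zero_norm' (eventually_nhdsWithin_of_forall fun x hx => hbound x hx) hlim
  have h2 := h1.add (hTc.continuousWithinAt (s := cube d) (x := x₀))
  simpa [ContinuousWithinAt, hTx] using h2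

theorem IsHolder.sum_abs_le {d : ℕ} {β L M : ℝ} (hM : 0 ≤ M) {f : (Fin d → ℝ) → ℝ}
    (hf : IsHolder d β L M f) {x : Fin d → ℝ} (hx : x ∈ cube d) :
    ∑ p ∈ multiIndices d (strictFloor β), |iterPartial p f x| ≤ M := by
  rw [← ENNReal.ofReal_le_ofReal_iff hM, ENNReal.ofReal_sum_of_nonneg fun _ _ => abs_nonneg _]
  refine le_trans (Finset.sum_le_sum fun p _ => ?_) hf.bounded
  exact le_iSup₂ (f := fun y (_ : y ∈ cube d) => ENNReal.ofReal |iterPartial p f y|) x hx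

/-! ### Noise densities and the mean score -/

theorem IsNoiseDensity.isProbabilityMeasure {g : ℝ → ℝ} (hg : IsNoiseDensity g) :
    IsProbabilityMeasure (noiseLaw g) :=
  ⟨by rw [noiseLaw, withDensity_apply _ MeasurableSet.univ, Measure.restrict_univ,
    hg.lintegral_eq_one]⟩

theorem IsNoiseDensity.integral_noiseLaw {g : ℝ → ℝ} (hg : IsNoiseDensity g) (F : ℝ → ℝ) :
    ∫ z, F z ∂noiseLaw g = ∫ z, F z * g z := by
  rw [noiseLaw, integral_withDensity_eq_integral_toReal_smul hg.measurable.ennreal_ofReal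
    (ae_of_all _ fun _ => ENNReal.ofReal_lt_top)]
  refine integral_congr_ae (ae_of_all _ fun z => ?_)
  simp only [ENNReal.toReal_ofReal (hg.nonneg z), smul_eq_mul, mul_comm]

theorem noiseLaw_absolutelyContinuous (g : ℝ → ℝ) : noiseLaw g ≪ volume :=
  withDensity_absolutelyContinuous _ _

/-- The expectation of `ρ'(ξ + v)` for `ξ` of density `g`. -/
def meanScore (ρ g : ℝ → ℝ) (v : ℝ) : ℝ := ∫ z, deriv ρ (z + v) ∂noiseLaw g

namespace IsContrast

variable {ρ : ℝ → ℝ} {g : ℕ → ℝ → ℝ}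

theorem abs_score_sub_le (hρ : IsContrast ρ g) (x y : ℝ) :
    |deriv ρ x - deriv ρ y| ≤ |x - y| := by
  simpa [Real.dist_eq] using hρ.lipschitz_deriv.dist_le_mul x y

theorem measurable_score (hρ : IsContrast ρ g) : Measurable (deriv ρ) :=
  hρ.lipschitz_deriv.continuous.measurable

theorem integrable_score (hρ : IsContrast ρ g) (μ : Measure ℝ) [IsFiniteMeasure μ] (v : ℝ) :
    Integrable (fun z => deriv ρ (z + v)) μ := by
  obtain ⟨B, hB⟩ := hρ.bounded_deriv
  exact Integrable.of_bound
    (hρ.measurable_score.comp (measurable_id.add_const v)).aestronglyMeasurable B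
    (ae_of_all _ fun _ => hB _)

/-- The score `ρ'` is odd and the density is even. -/
theorem meanScore_zero (hρ : IsContrast ρ g) {f : ℝ → ℝ} (hf : IsNoiseDensity f) :
    meanScore ρ f 0 = 0 := by
  have hodd : ∀ z, deriv ρ (-z) = -deriv ρ z := fun z => by
    have h := deriv_comp_neg ρ z
    have h2 : (fun x => ρ (-x)) = ρ := funext hρ.symm
    rw [h2] at h
    linarith
  have h1 : meanScore ρ f 0 = ∫ z, deriv ρ z * f z := by
    simp only [meanScore, add_zero, hf.integral_noiseLaw]
  have h2 := integral_neg_eq_self (fun z => deriv ρ z * f z) volume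
  simp only [hodd, hf.symm, neg_mul, integral_neg] at h2
  linarith

theorem abs_meanScore_le (hρ : IsContrast ρ g) {f : ℝ → ℝ} (hf : IsNoiseDensity f) (v : ℝ) :
    |meanScore ρ f v| ≤ |v| := by
  have := hf.isProbabilityMeasure
  have h : meanScore ρ f v = ∫ z, (deriv ρ (z + v) - deriv ρ (z + 0)) ∂noiseLaw f := by
    rw [integral_sub (hρ.integrable_score _ v) (hρ.integrable_score _ 0)]
    change _ = meanScore ρ f v - meanScore ρ f 0
    rw [hρ.meanScore_zero hf, sub_zero]
  rw [h]
  have h2 := norm_integral_le_of_norm_le_const (μ := noiseLaw f) (C := |v|)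
    (f := fun z => deriv ρ (z + v) - deriv ρ (z + 0)) (ae_of_all _ fun z => by
      simpa using hρ.abs_score_sub_le (z + v) (z + 0))
  simpa using h2

theorem abs_second_le (hρ : IsContrast ρ g) (z : ℝ) : |deriv (deriv ρ) z| ≤ 1 := by
  simpa using norm_deriv_le_of_lipschitz hρ.lipschitz_deriv (x₀ := z)

theorem integrable_second (hρ : IsContrast ρ g) (μ : Measure ℝ) [IsFiniteMeasure μ] (v : ℝ) :
    Integrable (fun z => deriv (deriv ρ) (z + v)) μ :=
  Integrable.of_bound
    ((measurable_deriv _).comp (measurable_id.add_const v)).aestronglyMeasurable 1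
    (ae_of_all _ fun _ => hρ.abs_second_le _)

/-- Differentiation under the integral needs `ρ''` only almost everywhere: the noise law is
absolutely continuous, and the Lipschitz bound on `ρ'` dominates the difference quotients. -/
theorem hasDerivAt_meanScore (hρ : IsContrast ρ g) {f : ℝ → ℝ} (hf : IsNoiseDensity f) (v : ℝ) :
    HasDerivAt (meanScore ρ f) (∫ z, deriv (deriv ρ) (z + v) ∂noiseLaw f) v := by
  have := hf.isProbabilityMeasure
  refine (hasDerivAt_integral_of_dominated_loc_of_lip (μ := noiseLaw f) (s := univ)
    (bound := fun _ => 1) (F := fun v z => deriv ρ (z + v)) univ_mem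
    (Eventually.of_forall fun w => (hρ.integrable_score _ w).aestronglyMeasurable)
    (hρ.integrable_score _ v) (hρ.integrable_second _ v).aestronglyMeasurable
    (ae_of_all _ fun z => ?_) (integrable_const _) ?_).2
  · refine LipschitzOnWith.of_dist_le_mul fun x _ y _ => ?_
    simpa [Real.dist_eq] using hρ.abs_score_sub_le (z + x) (z + y)
  · refine (noiseLaw_absolutelyContinuous f).ae_le ?_
    have h := (measurePreserving_add_right volume v).quasiMeasurePreserving.ae
      hρ.ae_twice_differentiable
    filter_upwards [h] with z hz
    simpa using HasDerivAt.comp_const_add z v hz.hasDerivAt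

/-- The mean scores are uniformly strongly increasing near zero. -/
theorem exists_meanScore_growth (hρ : IsContrast ρ g) {c : ℝ} (hc : 0 < c)
    (hg : g ∈ densityClass ρ c) :
    ∃ v₁ : ℝ, 0 < v₁ ∧ ∀ i, ∀ v w : ℝ, |v| ≤ v₁ → |w| ≤ v₁ →
      c / 2 * (w - v) ^ 2 ≤ (meanScore ρ (g i) w - meanScore ρ (g i) v) * (w - v) := by
  obtain ⟨Lρ, hLρ, α, hα, hsm⟩ := hρ.smooth_second
  -- This radius makes `Lρ * |v| ^ α ≤ c / 2`, so the slope of the mean score, at least `c` at `0`,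
  -- stays at least `c / 2`.
  refine ⟨(c / (2 * Lρ)) ^ (1 / α), by positivity, fun i => ?_⟩
  set v₁ := (c / (2 * Lρ)) ^ (1 / α) with hv₁
  have hgi := hg.1 i
  have := hgi.isProbabilityMeasure
  have hlow : ∀ v, |v| ≤ v₁ → c / 2 ≤ ∫ z, deriv (deriv ρ) (z + v) ∂noiseLaw (g i) := by
    intro v hv
    have h1 := hg.2 i
    have h2 := hsm i v 0
    rw [← hgi.integral_noiseLaw] at h1 h2
    have h3 : ∫ z, (deriv (deriv ρ) (z + 0) - deriv (deriv ρ) (z + v)) ∂noiseLaw (g i) ≤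
        ∫ z, |deriv (deriv ρ) (z + v) - deriv (deriv ρ) (z + 0)| ∂noiseLaw (g i) := by
      refine integral_mono ((hρ.integrable_second _ 0).sub (hρ.integrable_second _ v))
        ((hρ.integrable_second _ v).sub (hρ.integrable_second _ 0)).abs fun z => ?_
      simp only
      rw [abs_sub_comm]
      exact le_abs_self _
    rw [integral_sub (hρ.integrable_second _ 0) (hρ.integrable_second _ v)] at h3
    simp only [add_zero, sub_zero] at h2 h3
    have h4 : Lρ * |v| ^ α ≤ c / 2 := by
      calc Lρ * |v| ^ α ≤ Lρ * v₁ ^ α := by gcongr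
        _ = c / 2 := by
          rw [hv₁, ← Real.rpow_mul (by positivity), one_div_mul_cancel hα.ne', Real.rpow_one]
          field_simp
    linarith
  have key : ∀ v w : ℝ, |v| ≤ v₁ → |w| ≤ v₁ → v ≤ w →
      c / 2 * (w - v) ≤ meanScore ρ (g i) w - meanScore ρ (g i) v := by
    intro v w hv hw hvw
    refine (convex_Icc (-v₁) v₁).mul_sub_le_image_sub_of_le_deriv
      (fun x _ => (hρ.hasDerivAt_meanScore hgi x).continuousAt.continuousWithinAt)
      (fun x _ => (hρ.hasDerivAt_meanScore hgi x).differentiableAt.differentiableWithinAt)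
      (fun x hx => ?_) v (abs_le.1 hv) w (abs_le.1 hw) hvw
    rw [(hρ.hasDerivAt_meanScore hgi x).deriv]
    have hx' : x ∈ Icc (-v₁) v₁ := interior_subset hx
    exact hlow x (abs_le.2 hx')
  intro v w hv hw
  rcases le_total v w with h | h
  · nlinarith [key v w hv hw h]
  · nlinarith [key w v hw hv h]

end IsContrast

/-! ### A Chernoff bound -/

theorem integrable_exp_neg_mul {E : Type*} [MeasurableSpace E] {μ : Measure E}
    [IsProbabilityMeasure μ] {Z : E → ℝ} (hZ : Measurable Z) {B l : ℝ} (hB : ∀ z, |Z z| ≤ B)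
    (hl : 0 ≤ l) : Integrable (fun z => Real.exp (-l * Z z)) μ := by
  refine Integrable.of_bound (by fun_prop) (Real.exp (l * B)) (ae_of_all _ fun z => ?_)
  rw [Real.norm_eq_abs, abs_of_pos (Real.exp_pos _), Real.exp_le_exp]
  nlinarith [(abs_le.1 (hB z)).1]

/-- From `exp y ≤ 1 + y + y ^ 2` for `|y| ≤ 1`. Bounding `Z ^ 2` by `B * |Z|` keeps the first
absolute moment in the variance term. For localised summands this moment is of order `h ^ d`, which
gives the effective sample size `n * h ^ d` in the exponent. -/
theorem integral_exp_neg_mul_le {E : Type*} [MeasurableSpace E] {μ : Measure E}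
    [IsProbabilityMeasure μ] {Z : E → ℝ} (hZ : Measurable Z) {B S m l : ℝ}
    (hB : ∀ z, |Z z| ≤ B) (hS : ∫ z, |Z z| ∂μ ≤ S) (hm : m ≤ ∫ z, Z z ∂μ)
    (hB0 : 0 ≤ B) (hl : 0 ≤ l) (hlB : l * B ≤ 1) :
    ∫ z, Real.exp (-l * Z z) ∂μ ≤ Real.exp (-(l * m - l ^ 2 * (B * S))) := by
  have hint : Integrable Z μ := Integrable.of_bound hZ.aestronglyMeasurable B (ae_of_all _ hB)
  have hpt : ∀ z, Real.exp (-l * Z z) ≤ 1 - l * Z z + l ^ 2 * B * |Z z| := fun z => by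
    have h1 : |-l * Z z| ≤ 1 := by
      rw [abs_mul, abs_neg, abs_of_nonneg hl]
      exact (mul_le_mul_of_nonneg_left (hB z) hl).trans hlB
    have h2 := (abs_le.1 (Real.abs_exp_sub_one_sub_id_le h1)).2
    have h3 : (-l * Z z) ^ 2 ≤ l ^ 2 * B * |Z z| := by
      rw [mul_pow, neg_sq, mul_assoc, ← sq_abs (Z z), sq |Z z|]
      have := mul_le_mul_of_nonneg_right (hB z) (abs_nonneg (Z z))
      gcongr
    linarith
  calc ∫ z, Real.exp (-l * Z z) ∂μ ≤ ∫ z, (1 - l * Z z + l ^ 2 * B * |Z z|) ∂μ :=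
        integral_mono (integrable_exp_neg_mul hZ hB hl)
          (((integrable_const _).sub (hint.const_mul l)).add (hint.abs.const_mul _)) hpt
    _ = 1 - l * ∫ z, Z z ∂μ + l ^ 2 * B * ∫ z, |Z z| ∂μ := by
        have h1 : Integrable (fun z => 1 - l * Z z) μ :=
          (integrable_const _).sub (hint.const_mul l)
        rw [integral_add h1 (hint.abs.const_mul _),
          integral_sub (integrable_const _) (hint.const_mul l), integral_const_mul,
          integral_const_mul]
        simp
    _ ≤ 1 - l * m + l ^ 2 * (B * S) := by
        rw [← mul_assoc]
        gcongr
    _ ≤ Real.exp (-(l * m - l ^ 2 * (B * S))) := by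
        linarith [Real.add_one_le_exp (-(l * m - l ^ 2 * (B * S)))]

/-- Chernoff bound for a sum of independent bounded variables with positive mean. -/
theorem measureReal_sum_nonpos_le {E : Type*} [MeasurableSpace E] {n : ℕ}
    (μ : Fin n → Measure E) [∀ i, IsProbabilityMeasure (μ i)] {Z : E → ℝ} (hZ : Measurable Z)
    {B S m l : ℝ} (hB : ∀ z, |Z z| ≤ B) (hS : ∀ i, ∫ z, |Z z| ∂μ i ≤ S)
    (hm : ∀ i, m ≤ ∫ z, Z z ∂μ i) (hB0 : 0 ≤ B) (hl : 0 ≤ l) (hlB : l * B ≤ 1) :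
    (Measure.pi μ).real {z | ∑ i, Z (z i) ≤ 0} ≤
      Real.exp (-(n * (l * m - l ^ 2 * (B * S)))) := by
  have hint : Integrable (fun z : Fin n → E => ∏ i, Real.exp (-l * Z (z i))) (Measure.pi μ) :=
    Integrable.fintype_prod (f := fun _ z => Real.exp (-l * Z z))
      fun i => integrable_exp_neg_mul hZ hB hl
  have hmeas : MeasurableSet {z : Fin n → E | ∑ i, Z (z i) ≤ 0} :=
    measurableSet_le (by fun_prop) measurable_const
  calc (Measure.pi μ).real {z | ∑ i, Z (z i) ≤ 0}
      = ∫ z, indicator {z : Fin n → E | ∑ i, Z (z i) ≤ 0} 1 z ∂Measure.pi μ := by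
        rw [integral_indicator_one hmeas]
    _ ≤ ∫ z, ∏ i, Real.exp (-l * Z (z i)) ∂Measure.pi μ := by
        refine integral_mono ((integrable_const (1 : ℝ)).indicator hmeas) hint fun z => ?_
        simp only [indicator_apply, mem_ofPred_eq, Pi.one_apply]
        split_ifs with h
        · rw [← Real.exp_sum, ← Finset.mul_sum]
          exact Real.one_le_exp (by nlinarith)
        · exact Finset.prod_nonneg fun i _ => (Real.exp_pos _).le
    _ = ∏ i, ∫ z, Real.exp (-l * Z z) ∂μ i :=
        integral_fintype_prod_eq_prod (fun _ z => Real.exp (-l * Z z))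
    _ ≤ ∏ _i : Fin n, Real.exp (-(l * m - l ^ 2 * (B * S))) :=
        Finset.prod_le_prod (fun i _ => integral_nonneg fun z => (Real.exp_pos _).le)
          fun i _ => integral_exp_neg_mul_le hZ hB (hS i) (hm i) hB0 hl hlB
    _ = _ := by
        rw [Finset.prod_const, ← Real.exp_nat_mul, Finset.card_univ, Fintype.card_fin]
        ring_nf

/-! ### Local polynomials and the kernel -/

/-- A nonzero polynomial is almost everywhere nonzero. -/
theorem ae_mvPolynomial_eval_ne_zero : ∀ (n : ℕ) (P : MvPolynomial (Fin n) ℝ), P ≠ 0 →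
    ∀ᵐ x : Fin n → ℝ, MvPolynomial.eval x P ≠ 0
  | 0, P, hP => by
    refine ae_of_all _ fun x h => hP ?_
    rw [MvPolynomial.eq_C_of_isEmpty P] at h ⊢
    rw [MvPolynomial.eval_C] at h
    rw [h, MvPolynomial.C_0]
  | n + 1, P, hP => by
    set Q := MvPolynomial.finSuccEquiv ℝ n P with hQ
    have hQ0 : Q ≠ 0 := by
      rw [hQ]
      simpa using hP
    have ih := ae_mvPolynomial_eval_ne_zero n Q.leadingCoeff (by simpa using hQ0)
    have hcont : Continuous fun w : ℝ × (Fin n → ℝ) =>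
        MvPolynomial.eval (Fin.cons w.1 w.2 : Fin (n + 1) → ℝ) P := by
      refine (MvPolynomial.continuous_eval P).comp (continuous_pi fun i => ?_)
      refine Fin.cases ?_ (fun j => ?_) i
      · simpa using continuous_fst
      · simp only [Fin.cons_succ]
        fun_prop
    have hmeas : MeasurableSet {w : ℝ × (Fin n → ℝ) |
        MvPolynomial.eval (Fin.cons w.1 w.2 : Fin (n + 1) → ℝ) P ≠ 0} :=
      (isOpen_ne.preimage hcont).measurableSet
    -- Viewed as a polynomial in the first variable, `P` has a leading coefficient that is nonzero
    -- for almost every value `s` of the others. For such `s` only finitely many `y` are roots, and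
    -- Fubini concludes.
    have h1 : ∀ᵐ s : Fin n → ℝ, ∀ᵐ y : ℝ,
        MvPolynomial.eval (Fin.cons y s : Fin (n + 1) → ℝ) P ≠ 0 := by
      filter_upwards [ih] with s hs
      have hR : Polynomial.map (MvPolynomial.eval s) Q ≠ 0 := fun h0 => by
        have := congrArg (fun R => Polynomial.coeff R Q.natDegree) h0
        simp only [Polynomial.coeff_map, Polynomial.coeff_zero] at this
        exact hs this
      have hfin : {y : ℝ | (Polynomial.map (MvPolynomial.eval s) Q).IsRoot y}.Finite :=
        Polynomial.finite_setOfPred_isRoot hR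
      have := hfin.measure_zero volume
      filter_upwards [measure_eq_zero_iff_ae_notMem.1 this] with y hy h0
      exact hy (by
        change Polynomial.eval y _ = 0
        rw [← h0, MvPolynomial.eval_eq_eval_mv_eval'])
    have h2 : ∀ᵐ w : ℝ × (Fin n → ℝ),
        MvPolynomial.eval (Fin.cons w.1 w.2 : Fin (n + 1) → ℝ) P ≠ 0 := by
      rw [Measure.volume_eq_prod, Measure.ae_prod_iff_ae_ae hmeas, Measure.ae_ae_comm hmeas]
      exact h1
    have h3 := (volume_preserving_piFinSuccAbove (fun _ : Fin (n + 1) => ℝ)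
      0).quasiMeasurePreserving.ae h2
    filter_upwards [h3] with x hx
    have hcons : x = Fin.cons (MeasurableEquiv.piFinSuccAbove (fun _ => ℝ) 0 x).1
        (MeasurableEquiv.piFinSuccAbove (fun _ => ℝ) 0 x).2 := by
      funext i
      refine Fin.cases rfl (fun j => rfl) i
    rw [hcons]
    exact hx

/-- The value at `u` of the polynomial with coefficients `t`. -/
def polyVal {d b : ℕ} (t : multiIndices d b → ℝ) (u : Fin d → ℝ) : ℝ :=
  ∑ p, t p * ∏ j, u j ^ p.1 j

theorem polyVal_add {d b : ℕ} (s t : multiIndices d b → ℝ) (u : Fin d → ℝ) :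
    polyVal (s + t) u = polyVal s u + polyVal t u := by
  simp [polyVal, add_mul, Finset.sum_add_distrib]

theorem polyVal_smul {d b : ℕ} (a : ℝ) (t : multiIndices d b → ℝ) (u : Fin d → ℝ) :
    polyVal (a • t) u = a * polyVal t u := by
  simp [polyVal, Finset.mul_sum, mul_assoc]

theorem polyVal_sub {d b : ℕ} (s t : multiIndices d b → ℝ) (u : Fin d → ℝ) :
    polyVal (s - t) u = polyVal s u - polyVal t u := by
  simp [polyVal, sub_mul, Finset.sum_sub_distrib]

theorem continuous_polyVal {d b : ℕ} (t : multiIndices d b → ℝ) :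
    Continuous (polyVal t) := by
  unfold polyVal
  fun_prop

theorem continuous_polyVal_left {d b : ℕ} (u : Fin d → ℝ) :
    Continuous fun t : multiIndices d b → ℝ => polyVal t u := by
  unfold polyVal
  fun_prop

theorem abs_monomial_le {d : ℕ} (p : Fin d → ℕ) {u : Fin d → ℝ} (hu : ∀ j, |u j| ≤ 1) :
    |∏ j, u j ^ p j| ≤ 1 := by
  rw [Finset.abs_prod]
  exact Finset.prod_le_one (fun _ _ => abs_nonneg _) fun j _ => by
    rw [abs_pow]; exact pow_le_one₀ (abs_nonneg _) (hu j)

theorem abs_polyVal_le {d b : ℕ} (t : multiIndices d b → ℝ) {u : Fin d → ℝ}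
    (hu : ∀ j, |u j| ≤ 1) : |polyVal t u| ≤ (multiIndices d b).card * ‖t‖ := by
  unfold polyVal
  refine (Finset.abs_sum_le_sum_abs _ _).trans ?_
  refine (Finset.sum_le_card_nsmul _ _ ‖t‖ fun p _ => ?_).trans_eq (by simp)
  rw [abs_mul]
  have h1 : |t p| ≤ ‖t‖ := norm_le_pi_norm t p
  nlinarith [abs_monomial_le p.1 hu, abs_nonneg (t p), abs_nonneg (∏ j, u j ^ p.1 j)]

theorem ae_polyVal_ne_zero {d b : ℕ} {t : multiIndices d b → ℝ} (ht : t ≠ 0) :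
    ∀ᵐ u : Fin d → ℝ, polyVal t u ≠ 0 := by
  set P : MvPolynomial (Fin d) ℝ :=
    ∑ p : multiIndices d b, MvPolynomial.monomial (Finsupp.equivFunOnFinite.symm p.1) (t p) with hP
  have heval : ∀ u, MvPolynomial.eval u P = polyVal t u := fun u => by
    simp [hP, polyVal, MvPolynomial.eval_monomial, Finsupp.prod_fintype]
  obtain ⟨p, hp⟩ := Function.ne_iff.1 ht
  have hP0 : P ≠ 0 := fun h => hp (by
    have := congrArg (MvPolynomial.coeff (Finsupp.equivFunOnFinite.symm p.1)) h
    rw [hP, MvPolynomial.coeff_sum, Finset.sum_eq_single p] at this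
    · simpa using this
    · intro q _ hq
      rw [MvPolynomial.coeff_monomial, if_neg]
      exact fun h => hq (Subtype.ext (Finsupp.equivFunOnFinite.symm.injective h))
    · simp)
  filter_upwards [ae_mvPolynomial_eval_ne_zero d P hP0] with u hu
  rwa [← heval]

namespace IsKernel

variable {d : ℕ} {K : (Fin d → ℝ) → ℝ}

theorem integrable (hK : IsKernel K) : Integrable K := by
  by_contra h
  have := hK.integral_eq_one
  rw [integral_undef h] at this
  exact zero_ne_one this

theorem abs_le_half (hK : IsKernel K) {u : Fin d → ℝ} (hu : K u ≠ 0) (j : Fin d) :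
    |u j| ≤ 1 / 2 := by
  have := hK.support hu
  exact abs_le.2 ⟨this.1 j, this.2 j⟩

end IsKernel

theorem measurableSet_inwardDirections {d : ℕ} (x₀ : Fin d → ℝ) :
    MeasurableSet (inwardDirections x₀) := by
  have : inwardDirections x₀ =
      ⋂ j, {z : Fin d → ℝ | (x₀ j = 0 → 0 ≤ z j) ∧ (x₀ j = 1 → z j ≤ 0)} := by
    ext z; simp [inwardDirections]
  rw [this]
  refine MeasurableSet.iInter fun j => ?_
  have h0 : MeasurableSet {z : Fin d → ℝ | x₀ j = 0 → 0 ≤ z j} :=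
    (MeasurableSet.const _).imp (measurableSet_le measurable_const (measurable_pi_apply j))
  have h1 : MeasurableSet {z : Fin d → ℝ | x₀ j = 1 → z j ≤ 0} :=
    (MeasurableSet.const _).imp (measurableSet_le (measurable_pi_apply j) measurable_const)
  exact h0.inter h1

/-- The design quadratic form is uniformly positive on the unit sphere. -/
theorem exists_design_lower_bound {d : ℕ} (b : ℕ) {K : (Fin d → ℝ) → ℝ} (hK : IsKernel K)
    {x₀ : Fin d → ℝ} (hKx₀ : 0 < ∫ z in inwardDirections x₀, K z) :
    ∃ q : ℝ, 0 < q ∧ ∀ e : multiIndices d b → ℝ, ‖e‖ = 1 →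
      q ≤ ∫ z in inwardDirections x₀, K z * polyVal e z ^ 2 := by
  set D : ℝ := ((multiIndices d b).card : ℝ) with hD
  have hbound : ∀ e : multiIndices d b → ℝ, ‖e‖ = 1 → ∀ z, ‖K z * polyVal e z ^ 2‖ ≤ K z * D ^ 2 := by
    intro e he z
    rw [norm_mul, Real.norm_eq_abs, abs_of_nonneg (hK.nonneg z), norm_pow, Real.norm_eq_abs]
    rcases eq_or_ne (K z) 0 with h0 | h0
    · simp [h0]
    · have h1 := abs_polyVal_le e (u := z) fun j => (hK.abs_le_half h0 j).trans (by norm_num)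
      rw [he, mul_one] at h1
      have := hK.nonneg z
      gcongr
  have hmeas : ∀ e : multiIndices d b → ℝ, Measurable fun z => K z * polyVal e z ^ 2 := fun e =>
    hK.measurable.mul ((continuous_polyVal e).measurable.pow_const 2)
  have hint : ∀ e : multiIndices d b → ℝ, ‖e‖ = 1 → Integrable fun z => K z * polyVal e z ^ 2 :=
    fun e he => (hK.integrable.mul_const _).mono' (hmeas e).aestronglyMeasurable
      (ae_of_all _ (hbound e he))
  have hcont : ContinuousOn (fun e : multiIndices d b → ℝ =>
      ∫ z in inwardDirections x₀, K z * polyVal e z ^ 2) (Metric.sphere 0 1) := by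
    refine continuousOn_of_dominated (bound := fun z => K z * D ^ 2)
      (fun e _ => (hmeas e).aestronglyMeasurable)
      (fun e he => ae_of_all _ (hbound e (by simpa using he)))
      (hK.integrable.mul_const _).integrableOn (ae_of_all _ fun z => ?_)
    exact (continuous_const.mul ((continuous_polyVal_left z).pow 2)).continuousOn
  -- A vanishing integral would force `K = 0` a.e. on the inward directions, since `polyVal e` is
  -- a.e. nonzero; this contradicts `hKx₀`. Continuity on the compact sphere makes the bound
  -- uniform.
  have hpos : ∀ e : multiIndices d b → ℝ, ‖e‖ = 1 →
      0 < ∫ z in inwardDirections x₀, K z * polyVal e z ^ 2 := by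
    intro e he
    have hnn : 0 ≤ ∫ z in inwardDirections x₀, K z * polyVal e z ^ 2 :=
      integral_nonneg fun z => mul_nonneg (hK.nonneg z) (sq_nonneg _)
    refine hnn.lt_of_ne fun h0 => hKx₀.ne' ?_
    have h1 := (setIntegral_eq_zero_iff_of_nonneg_ae
      (ae_of_all _ fun z => mul_nonneg (hK.nonneg z) (sq_nonneg (polyVal e z)))
      (hint e he).integrableOn).1 h0.symm
    have he0 : e ≠ 0 := by rintro rfl; simp at he
    have h2 : K =ᵐ[volume.restrict (inwardDirections x₀)] 0 := by
      filter_upwards [h1, ae_restrict_of_ae (ae_polyVal_ne_zero he0)] with z hz hz'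
      simpa [hz'] using hz
    rw [integral_congr_ae h2]
    simp
  have hne : (Metric.sphere (0 : multiIndices d b → ℝ) 1).Nonempty := by
    have : Nonempty (multiIndices d b) := ⟨zeroIndex d b⟩
    exact ⟨fun _ => 1, by simp⟩
  obtain ⟨e₀, he₀, hmin⟩ := (isCompact_sphere (0 : multiIndices d b → ℝ) 1).exists_isMinOn hne hcont
  exact ⟨_, hpos e₀ (by simpa using he₀), fun e he => hmin (by simpa using he)⟩

theorem measurableSet_cube (d : ℕ) : MeasurableSet (cube d) := measurableSet_Icc

theorem volume_cube (d : ℕ) : volume (cube d) = 1 := by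
  simp [cube, Real.volume_Icc_pi]

/-- The rescaled design point. -/
def rescale {d : ℕ} (x₀ : Fin d → ℝ) (h : ℝ) (x : Fin d → ℝ) : Fin d → ℝ :=
  fun j => (x j - x₀ j) / h

theorem rescale_eq {d : ℕ} (x₀ : Fin d → ℝ) (h : ℝ) (x : Fin d → ℝ) :
    rescale x₀ h x = h⁻¹ • (x - x₀) := by
  ext j; simp [rescale, div_eq_inv_mul]

theorem continuous_rescale {d : ℕ} (x₀ : Fin d → ℝ) (h : ℝ) : Continuous (rescale x₀ h) := by
  unfold rescale
  fun_prop

theorem integral_rescale {d : ℕ} (x₀ : Fin d → ℝ) {h : ℝ} (hh : 0 < h) (F : (Fin d → ℝ) → ℝ) :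
    ∫ x, F (rescale x₀ h x) = h ^ d * ∫ u, F u := by
  simp only [rescale_eq]
  rw [integral_sub_right_eq_self (fun x => F (h⁻¹ • x)) x₀,
    Measure.integral_comp_inv_smul_of_nonneg volume F hh.le]
  simp

theorem integrable_rescale {d : ℕ} (x₀ : Fin d → ℝ) {h : ℝ} (hh : 0 < h) {F : (Fin d → ℝ) → ℝ}
    (hF : Integrable F) : Integrable fun x => F (rescale x₀ h x) := by
  simp only [rescale_eq]
  exact (hF.comp_smul (inv_ne_zero hh.ne')).comp_sub_right x₀

theorem setIntegral_kernel_le {d : ℕ} {K : (Fin d → ℝ) → ℝ} (hK : IsKernel K) (x₀ : Fin d → ℝ)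
    {h : ℝ} (hh : 0 < h) : ∫ x in cube d, K (rescale x₀ h x) ≤ h ^ d := by
  calc ∫ x in cube d, K (rescale x₀ h x) ≤ ∫ x, K (rescale x₀ h x) :=
        setIntegral_le_integral (integrable_rescale x₀ hh hK.integrable)
          (ae_of_all _ fun x => hK.nonneg _)
    _ = h ^ d := by rw [integral_rescale x₀ hh, hK.integral_eq_one, mul_one]

/-- For small bandwidths the inward directions of size at most `h/2` stay in the cube. -/
theorem exists_inward_subset {d : ℕ} {x₀ : Fin d → ℝ} (hx₀ : x₀ ∈ cube d) :
    ∃ h₀ : ℝ, 0 < h₀ ∧ h₀ ≤ 1 ∧ ∀ h, 0 < h → h ≤ h₀ → ∀ x, rescale x₀ h x ∈ inwardDirections x₀ →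
      (∀ j, |rescale x₀ h x j| ≤ 1 / 2) → x ∈ cube d := by
  have hj : ∀ j, ∃ h₀ : ℝ, 0 < h₀ ∧ h₀ ≤ 1 ∧ ∀ h, 0 < h → h ≤ h₀ → ∀ u : ℝ,
      (x₀ j = 0 → 0 ≤ u) → (x₀ j = 1 → u ≤ 0) → |u| ≤ 1 / 2 →
        0 ≤ x₀ j + h * u ∧ x₀ j + h * u ≤ 1 := by
    intro j
    have h0 : 0 ≤ x₀ j := hx₀.1 j
    have h1 : x₀ j ≤ 1 := hx₀.2 j
    rcases h0.eq_or_lt with h0 | h0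
    · refine ⟨1, one_pos, le_rfl, fun h hh hh1 u hu _ hu2 => ?_⟩
      have := hu h0.symm
      rw [← h0]
      have h3 := (abs_le.1 hu2).2
      constructor <;> nlinarith
    rcases h1.eq_or_lt with h1 | h1
    · refine ⟨1, one_pos, le_rfl, fun h hh hh1 u _ hu hu2 => ?_⟩
      have := hu h1
      rw [h1]
      have h3 := (abs_le.1 hu2).1
      constructor <;> nlinarith
    -- In an interior coordinate both signs of `u` are allowed, so `h` must not exceed the distance
    -- to either face.
    · refine ⟨min (x₀ j) (1 - x₀ j), lt_min h0 (by linarith), (min_le_left _ _).trans h1.le,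
        fun h hh hh1 u _ _ hu2 => ?_⟩
      have h3 := abs_le.1 hu2
      have h4 := hh1.trans (min_le_left _ _)
      have h5 := hh1.trans (min_le_right _ _)
      constructor <;> nlinarith
  choose H hH0 hH1 hH using hj
  have hfin : ∃ h₀ : ℝ, 0 < h₀ ∧ h₀ ≤ 1 ∧ ∀ j, h₀ ≤ H j := by
    rcases isEmpty_or_nonempty (Fin d) with hd | hd
    · exact ⟨1, one_pos, le_rfl, fun j => isEmptyElim j⟩
    · refine ⟨Finset.univ.inf' Finset.univ_nonempty H, ?_, ?_, fun j =>
        Finset.inf'_le _ (Finset.mem_univ j)⟩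
      · rw [Finset.lt_inf'_iff]
        exact fun j _ => hH0 j
      · exact (Finset.inf'_le _ (Finset.mem_univ (Classical.arbitrary _))).trans (hH1 _)
  obtain ⟨h₀, hpos, hle1, hle⟩ := hfin
  refine ⟨h₀, hpos, hle1, fun h hh hh0 x hx hx2 => ?_⟩
  have hall : ∀ j, 0 ≤ x j ∧ x j ≤ 1 := fun j => by
    have := hH j h hh (hh0.trans (hle j)) (rescale x₀ h x j) (hx j).1 (hx j).2 (hx2 j)
    have hxj : x₀ j + h * rescale x₀ h x j = x j := by
      simp only [rescale]
      field_simp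
      ring
    rwa [hxj] at this
  exact ⟨fun j => (hall j).1, fun j => (hall j).2⟩

/-! ### One observation -/

/-- The law of one observation `(X, f(X) + ξ)`, `ξ` having density `g`. -/
def obsLaw {d : ℕ} (f : (Fin d → ℝ) → ℝ) (g : ℝ → ℝ) : Measure ((Fin d → ℝ) × ℝ) :=
  Measure.map (fun w : (Fin d → ℝ) × ℝ => (w.1, f w.1 + w.2))
    ((volume.restrict (cube d)).prod (noiseLaw g))

theorem sampleLaw_eq_pi (d n : ℕ) (g : ℕ → ℝ → ℝ) (f : (Fin d → ℝ) → ℝ) :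
    sampleLaw d n g f = Measure.pi fun i : Fin n => obsLaw f (g i) := rfl

instance isProbabilityMeasure_cube (d : ℕ) :
    IsProbabilityMeasure (volume.restrict (cube d) : Measure (Fin d → ℝ)) :=
  ⟨by rw [Measure.restrict_apply_univ, volume_cube]⟩

/-- Values of `f` off the cube are arbitrary, so only almost everywhere measurability under the
design law is available. -/
theorem aemeasurable_obs {d : ℕ} {f : (Fin d → ℝ) → ℝ} (hf : ContinuousOn f (cube d))
    (ν : Measure ℝ) [SFinite ν] : AEMeasurable (fun w : (Fin d → ℝ) × ℝ => (w.1, f w.1 + w.2))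
      ((volume.restrict (cube d)).prod ν) :=
  measurable_fst.aemeasurable.prodMk
    (((hf.aemeasurable (measurableSet_cube d)).comp_quasiMeasurePreserving
      Measure.quasiMeasurePreserving_fst).add measurable_snd.aemeasurable)

theorem isProbabilityMeasure_obsLaw {d : ℕ} {f : (Fin d → ℝ) → ℝ} (hf : ContinuousOn f (cube d))
    {g : ℝ → ℝ} (hg : IsNoiseDensity g) : IsProbabilityMeasure (obsLaw f g) := by
  have := hg.isProbabilityMeasure
  exact Measure.isProbabilityMeasure_map (aemeasurable_obs hf _)

theorem ae_obsLaw_mem_cube {d : ℕ} {f : (Fin d → ℝ) → ℝ} (hf : ContinuousOn f (cube d))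
    {g : ℝ → ℝ} (hg : IsNoiseDensity g) : ∀ᵐ z ∂obsLaw f g, z.1 ∈ cube d := by
  have := hg.isProbabilityMeasure
  rw [obsLaw, ae_map_iff (aemeasurable_obs hf _) (measurable_fst (measurableSet_cube d))]
  exact Measure.quasiMeasurePreserving_fst.ae (ae_restrict_mem (measurableSet_cube d))

section Expectation

variable {d : ℕ} {f : (Fin d → ℝ) → ℝ} {g : ℝ → ℝ} {F : (Fin d → ℝ) × ℝ → ℝ} {B : ℝ}

theorem integrable_obs_prod (hf : ContinuousOn f (cube d)) (hg : IsNoiseDensity g)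
    (hF : Measurable F) (hB : ∀ z, |F z| ≤ B) :
    Integrable (fun w : (Fin d → ℝ) × ℝ => F (w.1, f w.1 + w.2))
      ((volume.restrict (cube d)).prod (noiseLaw g)) := by
  have := hg.isProbabilityMeasure
  exact Integrable.of_bound (hF.comp_aemeasurable (aemeasurable_obs hf _)).aestronglyMeasurable B
    (ae_of_all _ fun w => hB _)

theorem integral_obsLaw (hf : ContinuousOn f (cube d)) (hg : IsNoiseDensity g)
    (hF : Measurable F) (hB : ∀ z, |F z| ≤ B) :
    ∫ z, F z ∂obsLaw f g = ∫ x in cube d, ∫ w, F (x, f x + w) ∂noiseLaw g := by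
  have := hg.isProbabilityMeasure
  rw [obsLaw, integral_map (aemeasurable_obs hf _) hF.aestronglyMeasurable,
    integral_prod _ (integrable_obs_prod hf hg hF hB)]

theorem integrable_inner (hf : ContinuousOn f (cube d)) (hg : IsNoiseDensity g)
    (hF : Measurable F) (hB : ∀ z, |F z| ≤ B) :
    IntegrableOn (fun x => ∫ w, F (x, f x + w) ∂noiseLaw g) (cube d) := by
  have := hg.isProbabilityMeasure
  exact (integrable_obs_prod hf hg hF hB).integral_prod_left

variable {K : (Fin d → ℝ) → ℝ} {x₀ : Fin d → ℝ} {h : ℝ} {A : ℝ}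

theorem integrableOn_kernel (hK : IsKernel K) (hh : 0 < h) :
    IntegrableOn (fun x => K (rescale x₀ h x)) (cube d) :=
  (integrable_rescale x₀ hh hK.integrable).integrableOn

theorem measurable_kernel_fst (hK : IsKernel K) :
    Measurable fun z : (Fin d → ℝ) × ℝ => K (rescale x₀ h z.1) :=
  hK.measurable.comp ((continuous_rescale x₀ h).measurable.comp measurable_fst)

/-- The kernel has mass at most `h ^ d` under the design. This is the first-moment input of the
Chernoff bound. -/
theorem integral_abs_kernel_mul_le (hf : ContinuousOn f (cube d)) (hg : IsNoiseDensity g)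
    (hK : IsKernel K) (hh : 0 < h) (hF : Measurable F)
    (hA : ∀ z, K (rescale x₀ h z.1) ≠ 0 → |F z| ≤ A) (hA0 : 0 ≤ A) :
    ∫ z, |K (rescale x₀ h z.1) * F z| ∂obsLaw f g ≤ A * h ^ d := by
  have := isProbabilityMeasure_obsLaw hf hg
  have := hg.isProbabilityMeasure
  obtain ⟨BK, hBK⟩ := hK.bounded
  have hbd : ∀ z : (Fin d → ℝ) × ℝ, |A * K (rescale x₀ h z.1)| ≤ A * BK := fun z => by
    rw [abs_mul, abs_of_nonneg hA0, abs_of_nonneg (hK.nonneg _)]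
    exact mul_le_mul_of_nonneg_left (hBK _) hA0
  have hmeas : Measurable fun z : (Fin d → ℝ) × ℝ => A * K (rescale x₀ h z.1) :=
    (measurable_kernel_fst hK).const_mul A
  have hpt : ∀ z : (Fin d → ℝ) × ℝ,
      |K (rescale x₀ h z.1) * F z| ≤ A * K (rescale x₀ h z.1) := fun z => by
    rw [abs_mul, abs_of_nonneg (hK.nonneg _)]
    rcases eq_or_ne (K (rescale x₀ h z.1)) 0 with h0 | h0
    · simp [h0]
    · rw [mul_comm]
      exact mul_le_mul_of_nonneg_right (hA z h0) (hK.nonneg _)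
  have hi : Integrable (fun z : (Fin d → ℝ) × ℝ => A * K (rescale x₀ h z.1)) (obsLaw f g) :=
    Integrable.of_bound hmeas.aestronglyMeasurable (A * BK) (ae_of_all _ hbd)
  calc ∫ z, |K (rescale x₀ h z.1) * F z| ∂obsLaw f g
      ≤ ∫ z, A * K (rescale x₀ h z.1) ∂obsLaw f g :=
        integral_mono (hi.mono' ((measurable_kernel_fst hK).mul hF).abs.aestronglyMeasurable
          (ae_of_all _ fun z => by simpa [abs_mul] using hpt z)) hi hpt
    _ = ∫ x in cube d, A * K (rescale x₀ h x) := by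
        rw [integral_obsLaw hf hg hmeas hbd]
        simp
    _ ≤ A * h ^ d := by
        rw [integral_const_mul]
        exact mul_le_mul_of_nonneg_left (setIntegral_kernel_le hK x₀ hh) hA0

end Expectation

/-- The design quadratic form over the cube dominates the one over the inward directions. -/
theorem design_lower_bound {d b : ℕ} {K : (Fin d → ℝ) → ℝ} (hK : IsKernel K) {x₀ : Fin d → ℝ}
    {h : ℝ} (hh : 0 < h) (hsub : ∀ x, rescale x₀ h x ∈ inwardDirections x₀ →
      (∀ j, |rescale x₀ h x j| ≤ 1 / 2) → x ∈ cube d) (e : multiIndices d b → ℝ) :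
    h ^ d * ∫ u in inwardDirections x₀, K u * polyVal e u ^ 2 ≤
      ∫ x in cube d, K (rescale x₀ h x) * polyVal e (rescale x₀ h x) ^ 2 := by
  have hint : Integrable fun u => K u * polyVal e u ^ 2 := by
    refine (hK.integrable.mul_const (((multiIndices d b).card * ‖e‖) ^ 2)).mono'
      (hK.measurable.mul ((continuous_polyVal e).measurable.pow_const 2)).aestronglyMeasurable
      (ae_of_all _ fun u => ?_)
    rw [norm_mul, Real.norm_eq_abs, abs_of_nonneg (hK.nonneg u), norm_pow, Real.norm_eq_abs]
    rcases eq_or_ne (K u) 0 with h0 | h0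
    · simp [h0]
    · have h1 := abs_polyVal_le e (u := u) fun j => (hK.abs_le_half h0 j).trans (by norm_num)
      have := hK.nonneg u
      gcongr
  rw [← integral_indicator (measurableSet_inwardDirections x₀), ← integral_rescale x₀ hh,
    ← integral_indicator (measurableSet_cube d)]
  refine integral_mono
    (integrable_rescale x₀ hh (hint.indicator (measurableSet_inwardDirections x₀)))
    ((integrable_rescale x₀ hh hint).indicator (measurableSet_cube d)) fun x => ?_
  have hnn : 0 ≤ K (rescale x₀ h x) * polyVal e (rescale x₀ h x) ^ 2 :=
    mul_nonneg (hK.nonneg _) (sq_nonneg _)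
  by_cases hin : rescale x₀ h x ∈ inwardDirections x₀
  · simp only [indicator_of_mem hin]
    rcases eq_or_ne (K (rescale x₀ h x)) 0 with h0 | h0
    · simp only [h0, zero_mul]
      exact indicator_nonneg (fun y _ => mul_nonneg (hK.nonneg _) (sq_nonneg _)) x
    · rw [indicator_of_mem (hsub x hin (hK.abs_le_half h0))]
  · simp only [indicator_of_notMem hin]
    exact indicator_nonneg (fun y _ => mul_nonneg (hK.nonneg _) (sq_nonneg _)) x

/-! ### Means of the score and of its increments -/

section Score

variable {d b : ℕ} {f : (Fin d → ℝ) → ℝ} {g : ℕ → ℝ → ℝ} {ρ : ℝ → ℝ} {K : (Fin d → ℝ) → ℝ}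
  {x₀ : Fin d → ℝ} {h : ℝ}

/-- The residual of an observation with respect to a local polynomial. -/
def residual (x₀ : Fin d → ℝ) (h : ℝ) (θ : multiIndices d b → ℝ) (z : (Fin d → ℝ) × ℝ) : ℝ :=
  z.2 - polyVal θ (rescale x₀ h z.1)

theorem measurable_residual (θ : multiIndices d b → ℝ) : Measurable (residual x₀ h θ) :=
  measurable_snd.sub ((continuous_polyVal θ).measurable.comp
    ((continuous_rescale x₀ h).measurable.comp measurable_fst))

theorem measurable_polyVal_fst (e : multiIndices d b → ℝ) :
    Measurable fun z : (Fin d → ℝ) × ℝ => polyVal e (rescale x₀ h z.1) :=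
  (continuous_polyVal e).measurable.comp ((continuous_rescale x₀ h).measurable.comp measurable_fst)

theorem residual_obs (θ : multiIndices d b → ℝ) (x : Fin d → ℝ) (w : ℝ) :
    residual x₀ h θ (x, f x + w) = w + (f x - polyVal θ (rescale x₀ h x)) := by
  simp only [residual]; ring

theorem abs_kernel_mul_le {BK : ℝ} (hK : IsKernel K) (hBK : ∀ u, K u ≤ BK) {F A : ℝ}
    {u : Fin d → ℝ} (hA0 : 0 ≤ A) (hA : K u ≠ 0 → |F| ≤ A) : |K u * F| ≤ BK * A := by
  rw [abs_mul, abs_of_nonneg (hK.nonneg _)]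
  rcases eq_or_ne (K u) 0 with h0 | h0
  · rw [h0, zero_mul]
    exact mul_nonneg ((hK.nonneg u).trans (hBK u)) hA0
  · exact mul_le_mul (hBK _) (hA h0) (abs_nonneg _) ((hK.nonneg u).trans (hBK u))

/-- Given `X = x`, the expected score is the mean score at the bias `f x - polyVal θ (rescale x₀ h
x)`, hence at most the bias in absolute value. Integrating the kernel contributes `h ^ d`. -/
theorem abs_integral_gradient_le (hρ : IsContrast ρ g) {i : ℕ} (hg : IsNoiseDensity (g i))
    (hf : ContinuousOn f (cube d)) (hK : IsKernel K) (hh : 0 < h) (θ : multiIndices d b → ℝ)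
    {η : ℝ} (hη0 : 0 ≤ η)
    (hη : ∀ x ∈ cube d, K (rescale x₀ h x) ≠ 0 → |f x - polyVal θ (rescale x₀ h x)| ≤ η)
    (e : multiIndices d b → ℝ) (he : ∀ u : Fin d → ℝ, (∀ j, |u j| ≤ 1) → |polyVal e u| ≤ 1) :
    |∫ z, K (rescale x₀ h z.1) * (deriv ρ (residual x₀ h θ z) * polyVal e (rescale x₀ h z.1))
      ∂obsLaw f (g i)| ≤ η * h ^ d := by
  have := hg.isProbabilityMeasure
  obtain ⟨BK, hBK⟩ := hK.bounded
  obtain ⟨B, hB⟩ := hρ.bounded_deriv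
  have hB0 : 0 ≤ B := (abs_nonneg _).trans (hB 0)
  have hunit : ∀ u, K u ≠ 0 → |polyVal e u| ≤ 1 := fun u hu =>
    he u fun j => (hK.abs_le_half hu j).trans (by norm_num)
  have hmeas : Measurable fun z : (Fin d → ℝ) × ℝ => K (rescale x₀ h z.1) *
      (deriv ρ (residual x₀ h θ z) * polyVal e (rescale x₀ h z.1)) :=
    (measurable_kernel_fst hK).mul
      ((hρ.measurable_score.comp (measurable_residual θ)).mul (measurable_polyVal_fst e))
  rw [integral_obsLaw hf hg hmeas (B := BK * B)
    fun z => abs_kernel_mul_le hK hBK hB0 fun h0 => by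
      rw [abs_mul]
      exact (mul_le_mul (hB _) (hunit _ h0) (abs_nonneg _) hB0).trans_eq (mul_one B)]
  have hpt : ∀ᵐ x ∂volume.restrict (cube d),
      ‖∫ w, K (rescale x₀ h x) * (deriv ρ (residual x₀ h θ (x, f x + w)) *
        polyVal e (rescale x₀ h x)) ∂noiseLaw (g i)‖ ≤ η * K (rescale x₀ h x) := by
    filter_upwards [ae_restrict_mem (measurableSet_cube d)] with x hx
    simp only [residual_obs, integral_const_mul, integral_mul_const]
    change ‖_ * (meanScore ρ (g i) _ * _)‖ ≤ _
    rw [Real.norm_eq_abs, abs_mul, abs_mul, abs_of_nonneg (hK.nonneg _)]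
    rcases eq_or_ne (K (rescale x₀ h x)) 0 with h0 | h0
    · simp [h0]
    · rw [mul_comm η]
      refine mul_le_mul_of_nonneg_left ?_ (hK.nonneg _)
      exact (mul_le_mul ((hρ.abs_meanScore_le hg _).trans (hη x hx h0)) (hunit _ h0)
        (abs_nonneg _) hη0).trans_eq (mul_one η)
  refine (norm_integral_le_of_norm_le ((integrableOn_kernel hK hh).const_mul η) hpt).trans ?_
  rw [integral_const_mul]
  exact mul_le_mul_of_nonneg_left (setIntegral_kernel_le hK x₀ hh) hη0

/-- The increment of the score in the direction `e`. -/
def scoreIncrement (ρ : ℝ → ℝ) (x₀ : Fin d → ℝ) (h : ℝ) (θ e : multiIndices d b → ℝ) (δ : ℝ)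
    (z : (Fin d → ℝ) × ℝ) : ℝ :=
  (deriv ρ (residual x₀ h θ z) -
    deriv ρ (residual x₀ h θ z - δ * polyVal e (rescale x₀ h z.1))) *
    polyVal e (rescale x₀ h z.1)

theorem measurable_scoreIncrement (hρ : IsContrast ρ g) (θ e : multiIndices d b → ℝ) (δ : ℝ) :
    Measurable (scoreIncrement ρ x₀ h θ e δ) :=
  ((hρ.measurable_score.comp (measurable_residual θ)).sub
    (hρ.measurable_score.comp
      ((measurable_residual θ).sub ((measurable_polyVal_fst e).const_mul δ)))).mul
    (measurable_polyVal_fst e)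

theorem abs_scoreIncrement_le (hρ : IsContrast ρ g) (θ e : multiIndices d b → ℝ) {δ : ℝ}
    (hδ : 0 ≤ δ) (z : (Fin d → ℝ) × ℝ) :
    |scoreIncrement ρ x₀ h θ e δ z| ≤ δ * polyVal e (rescale x₀ h z.1) ^ 2 := by
  rw [scoreIncrement, abs_mul]
  have := hρ.abs_score_sub_le (residual x₀ h θ z)
    (residual x₀ h θ z - δ * polyVal e (rescale x₀ h z.1))
  rw [sub_sub_cancel, abs_mul, abs_of_nonneg hδ] at this
  rw [← sq_abs (polyVal e _), sq, ← mul_assoc]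
  exact mul_le_mul_of_nonneg_right this (abs_nonneg _)

/-- Given `X = x`, the increment has mean `(ψ (bias) - ψ (bias - δ * a)) * a`, where `ψ` is the mean
score and `a` the value of `e` at the rescaled point. Growth of `ψ` near `0` makes this at least `c
/ 2 * δ * a ^ 2`, and integrating over the design produces the quadratic form bounded below by `q`.
-/
theorem le_integral_scoreIncrement (hρ : IsContrast ρ g) {i : ℕ} (hg : IsNoiseDensity (g i))
    (hf : ContinuousOn f (cube d)) (hK : IsKernel K) (hh : 0 < h) (θ : multiIndices d b → ℝ)
    {v₁ c q δ : ℝ} (hδ : 0 < δ) (hc : 0 ≤ c)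
    (hm : ∀ v w : ℝ, |v| ≤ v₁ → |w| ≤ v₁ →
      c / 2 * (w - v) ^ 2 ≤ (meanScore ρ (g i) w - meanScore ρ (g i) v) * (w - v))
    (hη : ∀ x ∈ cube d, K (rescale x₀ h x) ≠ 0 →
      |f x - polyVal θ (rescale x₀ h x)| ≤ v₁ / 2)
    (hsub : ∀ x, rescale x₀ h x ∈ inwardDirections x₀ →
      (∀ j, |rescale x₀ h x j| ≤ 1 / 2) → x ∈ cube d)
    (e : multiIndices d b → ℝ) (he : ‖e‖ = 1) (hδ1 : δ * (multiIndices d b).card ≤ v₁ / 2)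
    (hq : q ≤ ∫ z in inwardDirections x₀, K z * polyVal e z ^ 2) :
    c / 2 * δ * q * h ^ d ≤
      ∫ z, K (rescale x₀ h z.1) * scoreIncrement ρ x₀ h θ e δ z ∂obsLaw f (g i) := by
  have := hg.isProbabilityMeasure
  obtain ⟨BK, hBK⟩ := hK.bounded
  have hunit : ∀ u, K u ≠ 0 → |polyVal e u| ≤ (multiIndices d b).card := fun u hu => by
    have := abs_polyVal_le e fun j => (hK.abs_le_half hu j).trans (by norm_num)
    rwa [he, mul_one] at this
  have hmeas : Measurable fun z : (Fin d → ℝ) × ℝ =>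
      K (rescale x₀ h z.1) * scoreIncrement ρ x₀ h θ e δ z :=
    (measurable_kernel_fst hK).mul (measurable_scoreIncrement hρ θ e δ)
  have hbd : ∀ z : (Fin d → ℝ) × ℝ, |K (rescale x₀ h z.1) * scoreIncrement ρ x₀ h θ e δ z| ≤
      BK * (δ * (multiIndices d b).card ^ 2) := fun z =>
    abs_kernel_mul_le hK hBK (by positivity) fun h0 => by
      refine (abs_scoreIncrement_le hρ θ e hδ.le z).trans ?_
      rw [← sq_abs (polyVal e _)]
      have := hunit _ h0
      gcongr
  rw [integral_obsLaw hf hg hmeas hbd]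
  calc c / 2 * δ * q * h ^ d = c / 2 * δ * (h ^ d * q) := by ring
    _ ≤ c / 2 * δ * (h ^ d * ∫ z in inwardDirections x₀, K z * polyVal e z ^ 2) := by gcongr
    _ ≤ c / 2 * δ * ∫ x in cube d, K (rescale x₀ h x) * polyVal e (rescale x₀ h x) ^ 2 :=
        mul_le_mul_of_nonneg_left (design_lower_bound hK hh hsub e) (by positivity)
    _ = ∫ x in cube d, c / 2 * δ * (K (rescale x₀ h x) * polyVal e (rescale x₀ h x) ^ 2) :=
        (integral_const_mul _ _).symm
    _ ≤ _ := by
        have hi : IntegrableOn (fun x => c / 2 * δ *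
            (K (rescale x₀ h x) * polyVal e (rescale x₀ h x) ^ 2)) (cube d) := by
          refine ((integrableOn_kernel hK hh (x₀ := x₀)).const_mul
            (c / 2 * δ * (multiIndices d b).card ^ 2)).mono' ?_ (ae_of_all _ fun x => ?_)
          · exact (((hK.measurable.comp (continuous_rescale x₀ h).measurable).mul
              (((continuous_polyVal e).measurable.comp
                (continuous_rescale x₀ h).measurable).pow_const 2)).const_mul _).aestronglyMeasurable
          · rw [Real.norm_eq_abs, abs_of_nonneg
              (mul_nonneg (by positivity) (mul_nonneg (hK.nonneg _) (sq_nonneg _)))]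
            rcases eq_or_ne (K (rescale x₀ h x)) 0 with h0 | h0
            · simp [h0]
            · have h1 := hunit _ h0
              have h2 := hK.nonneg (rescale x₀ h x)
              rw [← sq_abs (polyVal e _), mul_comm (K _), ← mul_assoc]
              gcongr
        refine setIntegral_mono_on hi (integrable_inner hf hg hmeas hbd) (measurableSet_cube d)
          fun x hx => ?_
        simp only [scoreIncrement, residual_obs, integral_const_mul, integral_mul_const, add_sub_assoc]
        rcases eq_or_ne (K (rescale x₀ h x)) 0 with h0 | h0
        · simp [h0]
        set a := polyVal e (rescale x₀ h x) with ha
        set bias := f x - polyVal θ (rescale x₀ h x) with hbias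
        rw [integral_sub (hρ.integrable_score _ _) (hρ.integrable_score _ _)]
        change _ ≤ _ * ((meanScore ρ (g i) bias - meanScore ρ (g i) (bias - δ * a)) * a)
        have hb1 : |bias| ≤ v₁ / 2 := hη x hx h0
        have ha1 : |δ * a| ≤ v₁ / 2 := by
          rw [abs_mul, abs_of_pos hδ]
          exact (mul_le_mul_of_nonneg_left (hunit _ h0) hδ.le).trans hδ1
        have hv : 0 ≤ v₁ / 2 := (abs_nonneg _).trans hb1
        -- Bias and shift are each at most `v₁ / 2`, so both arguments stay where the mean score is
        -- known to grow.
        have h1 := hm (bias - δ * a) bias ((abs_sub _ _).trans (by linarith)) (by linarith)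
        rw [sub_sub_cancel] at h1
        have h2 : c / 2 * δ * a ^ 2 ≤
            (meanScore ρ (g i) bias - meanScore ρ (g i) (bias - δ * a)) * a := by
          refine le_of_mul_le_mul_left ?_ hδ
          linarith
        calc _ = K (rescale x₀ h x) * (c / 2 * δ * a ^ 2) := by ring
          _ ≤ _ := mul_le_mul_of_nonneg_left h2 (hK.nonneg _)

/-- Lipschitz dependence on the direction, with the factor `δ` retained: the error of replacing `e`
by a net point has the same order in `δ` as the mean curvature. -/
theorem abs_scoreIncrement_sub_le (hρ : IsContrast ρ g) (θ e e' : multiIndices d b → ℝ) {δ D ε : ℝ}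
    (hδ : 0 ≤ δ) (z : (Fin d → ℝ) × ℝ) (he : |polyVal e (rescale x₀ h z.1)| ≤ D)
    (he' : |polyVal e' (rescale x₀ h z.1)| ≤ D)
    (hee' : |polyVal e (rescale x₀ h z.1) - polyVal e' (rescale x₀ h z.1)| ≤ ε) :
    |scoreIncrement ρ x₀ h θ e δ z - scoreIncrement ρ x₀ h θ e' δ z| ≤ δ * (2 * D * ε) := by
  simp only [scoreIncrement]
  set r := residual x₀ h θ z
  set a := polyVal e (rescale x₀ h z.1)
  set a' := polyVal e' (rescale x₀ h z.1)
  have h1 := hρ.abs_score_sub_le (r - δ * a') (r - δ * a)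
  have h2 := hρ.abs_score_sub_le r (r - δ * a')
  have e1 : r - δ * a' - (r - δ * a) = δ * (a - a') := by ring
  rw [e1, abs_mul, abs_of_nonneg hδ] at h1
  rw [sub_sub_cancel, abs_mul, abs_of_nonneg hδ] at h2
  have e2 : (deriv ρ r - deriv ρ (r - δ * a)) * a - (deriv ρ r - deriv ρ (r - δ * a')) * a' =
      (deriv ρ (r - δ * a') - deriv ρ (r - δ * a)) * a +
        (deriv ρ r - deriv ρ (r - δ * a')) * (a - a') := by ring
  have hD : 0 ≤ D := (abs_nonneg _).trans he
  have hε : 0 ≤ ε := (abs_nonneg _).trans hee'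
  rw [e2]
  refine (abs_add_le _ _).trans ?_
  rw [abs_mul, abs_mul]
  calc _ ≤ (δ * ε) * D + (δ * D) * ε := by
        refine add_le_add (mul_le_mul (h1.trans ?_) he (abs_nonneg _) (by positivity))
          (mul_le_mul (h2.trans ?_) hee' (abs_nonneg _) (by positivity))
        · gcongr
        · gcongr
    _ = _ := by ring

end Score

/-! ### The first order condition -/

theorem IsContrast.gradient_le {ρ : ℝ → ℝ} {g : ℕ → ℝ → ℝ} (hρ : IsContrast ρ g) (x y : ℝ) :
    ρ x + deriv ρ x * (y - x) ≤ ρ y := by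
  rcases lt_trichotomy x y with hxy | rfl | hxy
  · have := hρ.convex.deriv_le_slope (mem_univ x) (mem_univ y) hxy (hρ.differentiable x)
    rw [slope_def_field, le_div_iff₀ (sub_pos.2 hxy)] at this
    linarith
  · simp
  · have := hρ.convex.slope_le_deriv (mem_univ y) (mem_univ x) hxy (hρ.differentiable x)
    rw [slope_def_field, div_le_iff₀ (sub_pos.2 hxy)] at this
    linarith

/-- A nonzero kernel weight forces the design point into the neighbourhood, so the indicator in
`localPoly` plays no role. -/
theorem mul_kernel_localPoly {d b : ℕ} {K : (Fin d → ℝ) → ℝ} (hK : IsKernel K) (ρ : ℝ → ℝ)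
    {x₀ : Fin d → ℝ} {h : ℝ} (hh : 0 < h) (t : multiIndices d b → ℝ) {z : (Fin d → ℝ) × ℝ}
    (hz : z.1 ∈ cube d) :
    ρ (z.2 - localPoly x₀ h t z.1) * K (fun j => (z.1 j - x₀ j) / h) =
      ρ (residual x₀ h t z) * K (rescale x₀ h z.1) := by
  change _ * K (rescale x₀ h z.1) = _
  rcases eq_or_ne (K (rescale x₀ h z.1)) 0 with h0 | h0
  · simp [h0]
  · have hmem : z.1 ∈ nbhd x₀ h := by
      have hj : ∀ j, |z.1 j - x₀ j| ≤ h / 2 := fun j => by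
        have := hK.abs_le_half h0 j
        rw [rescale, abs_div, abs_of_pos hh, div_le_iff₀ hh] at this
        linarith
      exact ⟨⟨fun j => by linarith [(abs_le.1 (hj j)).1], fun j => by
        linarith [(abs_le.1 (hj j)).2]⟩, hz⟩
    rw [localPoly, indicator_of_mem hmem]
    rfl

/-- If a minimiser of the criterion is at distance more than `δ` from an admissible `θ`, the score
increments in some direction are dominated by the gradient at `θ`. -/
theorem exists_direction {d b n : ℕ} {M : ℝ} {ρ : ℝ → ℝ} {g : ℕ → ℝ → ℝ} (hρ : IsContrast ρ g)
    {K : (Fin d → ℝ) → ℝ} (hK : IsKernel K) {x₀ : Fin d → ℝ} {h : ℝ} (hh : 0 < h) (hn : 0 < n)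
    {z : Sample d n} (hz : ∀ i, (z i).1 ∈ cube d) {θ θ' : multiIndices d b → ℝ}
    (hθ : θ ∈ coeffBall d b M) (hθ' : θ' ∈ coeffBall d b M)
    (hmin : ∀ t ∈ coeffBall d b M, criterion ρ K x₀ h z θ' ≤ criterion ρ K x₀ h z t)
    {δ : ℝ} (hδ0 : 0 ≤ δ) (hδ : δ < ‖θ' - θ‖) :
    ∃ e : multiIndices d b → ℝ, ‖e‖ = 1 ∧
      ∑ i, K (rescale x₀ h (z i).1) * scoreIncrement ρ x₀ h θ e δ (z i) ≤
        ∑ i, K (rescale x₀ h (z i).1) *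
          (deriv ρ (residual x₀ h θ (z i)) * polyVal e (rescale x₀ h (z i).1)) := by
  set T := ‖θ' - θ‖ with hT
  have hT0 : 0 < T := hδ0.trans_lt hδ
  set e := T⁻¹ • (θ' - θ) with he
  have hTe : θ' = θ + T • e := by
    rw [he, smul_inv_smul₀ hT0.ne', add_sub_cancel]
  have he1 : ‖e‖ = 1 := by
    rw [he, norm_smul, norm_inv, Real.norm_of_nonneg hT0.le, ← hT, inv_mul_cancel₀ hT0.ne']
  refine ⟨e, he1, ?_⟩
  -- The intermediate point is a convex combination of `θ` and `θ'`, hence a legitimate competitor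
  -- of the minimiser.
  have hball : θ + δ • e ∈ coeffBall d b M := by
    have h1 : θ + δ • e = (1 - δ / T) • θ + (δ / T) • θ' := by
      rw [he, smul_smul, ← div_eq_mul_inv]
      module
    have h2 : 0 ≤ δ / T := by positivity
    have h3 : δ / T ≤ 1 := (div_le_one hT0).2 hδ.le
    rw [h1]
    change ∑ p, |(1 - δ / T) * θ p + (δ / T) * θ' p| ≤ M
    calc ∑ p, |(1 - δ / T) * θ p + (δ / T) * θ' p|
        ≤ ∑ p, ((1 - δ / T) * |θ p| + (δ / T) * |θ' p|) := by
          refine Finset.sum_le_sum fun p _ => (abs_add_le _ _).trans_eq ?_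
          rw [abs_mul, abs_mul, abs_of_nonneg h2, abs_of_nonneg (sub_nonneg.2 h3)]
      _ = (1 - δ / T) * ∑ p, |θ p| + (δ / T) * ∑ p, |θ' p| := by
          rw [Finset.sum_add_distrib, Finset.mul_sum, Finset.mul_sum]
      _ ≤ (1 - δ / T) * M + (δ / T) * M := by
          have : ∑ p, |θ p| ≤ M := hθ
          have : ∑ p, |θ' p| ≤ M := hθ'
          have := sub_nonneg.2 h3
          gcongr
      _ = M := by ring
  have hcrit := hmin _ hball
  simp only [criterion] at hcrit
  have hpos : (0 : ℝ) < 1 / (n * h ^ d) := by positivity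
  have hsum := le_of_mul_le_mul_left hcrit hpos
  simp only [mul_kernel_localPoly hK ρ hh _ (hz _)] at hsum
  have hres : ∀ (s : ℝ) i, residual x₀ h (θ + s • e) (z i) =
      residual x₀ h θ (z i) - s * polyVal e (rescale x₀ h (z i).1) := fun s i => by
    simp only [residual, polyVal_add, polyVal_smul]; ring
  rw [hTe] at hsum
  simp only [hres] at hsum
  -- The tangent inequality for `ρ` is taken at distance `δ` and evaluated at distance `T`. Since
  -- the criterion is no larger at `T`, its derivative along `e` at `δ` is nonpositive; the residual
  -- decreases along `e`, whence the sign.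
  have hgrad : 0 ≤ ∑ i, K (rescale x₀ h (z i).1) *
      (deriv ρ (residual x₀ h θ (z i) - δ * polyVal e (rescale x₀ h (z i).1)) *
        polyVal e (rescale x₀ h (z i).1)) := by
    refine le_of_mul_le_mul_left ?_ (sub_pos.2 hδ)
    rw [mul_zero, Finset.mul_sum]
    have := Finset.sum_le_sum fun i (_ : i ∈ Finset.univ) => mul_le_mul_of_nonneg_right
      (hρ.gradient_le (residual x₀ h θ (z i) - δ * polyVal e (rescale x₀ h (z i).1))
        (residual x₀ h θ (z i) - T * polyVal e (rescale x₀ h (z i).1)))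
      (hK.nonneg (rescale x₀ h (z i).1))
    have h2 := this.trans hsum
    rw [← sub_nonneg, ← Finset.sum_sub_distrib] at h2
    refine h2.trans_eq (Finset.sum_congr rfl fun i _ => ?_)
    ring
  rw [← sub_nonneg, ← Finset.sum_sub_distrib]
  refine hgrad.trans_eq (Finset.sum_congr rfl fun i _ => ?_)
  simp only [scoreIncrement]
  ring

/-! ### The deviation inequality for the estimator -/

/-- The rescaled Taylor coefficients of `f` at `x₀`. -/
def taylorCoeff {d : ℕ} (b : ℕ) (f : (Fin d → ℝ) → ℝ) (x₀ : Fin d → ℝ) (h : ℝ)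
    (p : multiIndices d b) : ℝ :=
  iterPartial p.1 f x₀ * ∏ j, h ^ p.1 j / (p.1 j).factorial

theorem polyVal_taylorCoeff {d : ℕ} (b : ℕ) (f : (Fin d → ℝ) → ℝ) (x₀ x : Fin d → ℝ) {h : ℝ}
    (hh : h ≠ 0) : polyVal (taylorCoeff b f x₀ h) (rescale x₀ h x) =
      ∑ p ∈ multiIndices d b, iterPartial p f x₀ * taylorMonomial p (x - x₀) := by
  rw [← Finset.sum_coe_sort]
  refine Finset.sum_congr rfl fun p _ => ?_
  rw [taylorCoeff, mul_assoc, ← Finset.prod_mul_distrib]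
  congr 1
  refine Finset.prod_congr rfl fun j _ => ?_
  simp only [rescale, Pi.sub_apply, div_pow]
  have := pow_ne_zero (p.1 j) hh
  field_simp

/-- Powers of `h ≤ 1` and inverse factorials only shrink the derivatives at `x₀`, whose sum is at
most `M`. -/
theorem IsHolder.taylorCoeff_mem {d : ℕ} {β L M : ℝ} (hM : 0 ≤ M) {f : (Fin d → ℝ) → ℝ}
    (hf : IsHolder d β L M f) {x₀ : Fin d → ℝ} (hx₀ : x₀ ∈ cube d) {h : ℝ} (hh0 : 0 ≤ h)
    (hh1 : h ≤ 1) : taylorCoeff (strictFloor β) f x₀ h ∈ coeffBall d (strictFloor β) M := by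
  refine le_trans ?_ (hf.sum_abs_le hM hx₀)
  rw [← Finset.sum_coe_sort (multiIndices d (strictFloor β))]
  refine Finset.sum_le_sum fun p _ => ?_
  rw [taylorCoeff, abs_mul]
  refine mul_le_of_le_one_right (abs_nonneg _) ?_
  rw [abs_of_nonneg (Finset.prod_nonneg fun j _ => by positivity)]
  refine Finset.prod_le_one (fun j _ => by positivity) fun j _ => ?_
  have : (1 : ℝ) ≤ (p.1 j).factorial := by exact_mod_cast Nat.factorial_pos _
  exact div_le_one_of_le₀ ((pow_le_one₀ hh0 hh1).trans this) (by positivity)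

theorem taylorCoeff_zeroIndex {d : ℕ} (b : ℕ) (f : (Fin d → ℝ) → ℝ) (x₀ : Fin d → ℝ) (h : ℝ) :
    taylorCoeff b f x₀ h (zeroIndex d b) = f x₀ := by
  simp [taylorCoeff, zeroIndex, iterPartial_zero]

theorem IsHolder.abs_bias_le {d : ℕ} {β L M : ℝ} (hβ : 0 < β) (hL : 0 ≤ L)
    {f : (Fin d → ℝ) → ℝ} (hf : IsHolder d β L M f) {x x₀ : Fin d → ℝ} (hx : x ∈ cube d)
    (hx₀ : x₀ ∈ cube d) {K : (Fin d → ℝ) → ℝ} (hK : IsKernel K) {h : ℝ} (hh : 0 < h)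
    (hKx : K (rescale x₀ h x) ≠ 0) :
    |f x - polyVal (taylorCoeff (strictFloor β) f x₀ h) (rescale x₀ h x)| ≤
      d * ((multiIndices d (strictFloor β)).card * L) * h ^ β := by
  rw [polyVal_taylorCoeff _ _ _ _ hh.ne']
  refine (hf.abs_sub_taylor_le hβ hL hx hx₀ (Δ := h) fun j => ?_).trans_eq (by ring)
  have := hK.abs_le_half hKx j
  rw [rescale, abs_div, abs_of_pos hh, div_le_iff₀ hh] at this
  linarith

theorem IsHolder.abs_le {d : ℕ} {β L M : ℝ} (hM : 0 ≤ M) {f : (Fin d → ℝ) → ℝ}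
    (hf : IsHolder d β L M f) {x : Fin d → ℝ} (hx : x ∈ cube d) : |f x| ≤ M := by
  have h := Finset.single_le_sum (f := fun p => |iterPartial p f x|) (fun _ _ => abs_nonneg _)
    (zeroIndex d (strictFloor β)).2
  refine le_trans ?_ (h.trans (hf.sum_abs_le hM hx))
  simp [zeroIndex, iterPartial_zero]

theorem IsLPAEstimator.abs_le {d n b : ℕ} {M : ℝ} {ρ : ℝ → ℝ} {K : (Fin d → ℝ) → ℝ}
    {x₀ : Fin d → ℝ} {h : ℝ} {fhat : Sample d n → ℝ} (hfh : IsLPAEstimator b M ρ K x₀ h fhat)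
    (z : Sample d n) : |fhat z| ≤ M := by
  obtain ⟨θ, hθ, _, hz⟩ := hfh.2 z
  rw [hz]
  exact (Finset.single_le_sum (f := fun p => |θ p|) (fun _ _ => abs_nonneg _)
    (Finset.mem_univ _)).trans hθ

/-- The Chernoff bound in the scaling used below: mean of order `δ * H`, first absolute moment of
order `H`, with `H = h ^ d`. -/
theorem measureReal_sum_nonpos_le_exp_sq {E : Type*} [MeasurableSpace E] {n : ℕ}
    (μ : Fin n → Measure E) [∀ i, IsProbabilityMeasure (μ i)] {Z : E → ℝ} (hZ : Measurable Z)
    {B S m H δ : ℝ} (hB1 : 1 ≤ B) (hS1 : 1 ≤ S) (hm0 : 0 < m) (hm1 : m ≤ 1)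
    (hδ0 : 0 ≤ δ) (hδ1 : δ ≤ 1) (hB : ∀ z, |Z z| ≤ B) (hS : ∀ i, ∫ z, |Z z| ∂μ i ≤ S * H)
    (hm : ∀ i, m * δ * H ≤ ∫ z, Z z ∂μ i) :
    (Measure.pi μ).real {z | ∑ i, Z (z i) ≤ 0} ≤
      Real.exp (-(m ^ 2 / (4 * B * S) * (n * H) * δ ^ 2)) := by
  have hB0 : 0 < B := by linarith
  have hS0 : 0 < S := by linarith
  -- This is the maximiser in `l` of `l * (m * δ * H) - l ^ 2 * (B * (S * H))`. The normalisations
  -- of `m`, `δ` and `S` ensure `l * B ≤ 1`.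
  have hl0 : 0 ≤ m / (2 * B * S) * δ := by positivity
  have hlB : m / (2 * B * S) * δ * B ≤ 1 := by
    have : m / (2 * B * S) * δ * B = m * δ / (2 * S) := by field_simp
    rw [this, div_le_one (by positivity)]
    nlinarith
  refine (measureReal_sum_nonpos_le μ hZ hB hS hm hB0.le hl0 hlB).trans_eq ?_
  congr 1
  field_simp
  ring

theorem polyVal_eq_sum {d b : ℕ} (e : multiIndices d b → ℝ) (u : Fin d → ℝ) :
    polyVal e u = ∑ p, e p * polyVal (Pi.single p 1) u := by
  refine Finset.sum_congr rfl fun p _ => ?_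
  simp [polyVal, Pi.single_apply]

/-- The signed unit vectors of the coefficient space. -/
def signedUnit {d b : ℕ} (s : multiIndices d b × Bool) : multiIndices d b → ℝ :=
  (if s.2 then (1 : ℝ) else -1) • Pi.single s.1 1

theorem abs_polyVal_signedUnit_le {d b : ℕ} (s : multiIndices d b × Bool) {u : Fin d → ℝ}
    (hu : ∀ j, |u j| ≤ 1) : |polyVal (signedUnit s) u| ≤ 1 := by
  rw [signedUnit, polyVal_smul, abs_mul]
  have h1 : |if s.2 then (1 : ℝ) else -1| = 1 := by split_ifs <;> simp
  rw [h1, one_mul]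
  have : polyVal (Pi.single s.1 1) u = ∏ j, u j ^ s.1.1 j := by
    simp [polyVal, Pi.single_apply]
  rw [this]
  exact abs_monomial_le _ hu

/-! ### The exceptional events and their probabilities -/

section Events

variable {d b : ℕ} (ρ : ℝ → ℝ) (K : (Fin d → ℝ) → ℝ) (x₀ : Fin d → ℝ) (h : ℝ)

/-- The summand controlling the curvature of the criterion in the direction `e`. -/
def curvatureTerm (θ e : multiIndices d b → ℝ) (δ η ζ : ℝ) (z : (Fin d → ℝ) × ℝ) : ℝ :=
  K (rescale x₀ h z.1) * (scoreIncrement ρ x₀ h θ e δ z - δ * η) - ζ * δ * h ^ d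

/-- The summand controlling the gradient of the criterion in the direction `e`. -/
def gradientTerm (θ e : multiIndices d b → ℝ) (δ κ : ℝ) (z : (Fin d → ℝ) × ℝ) : ℝ :=
  κ * δ * h ^ d -
    K (rescale x₀ h z.1) * (deriv ρ (residual x₀ h θ z) * polyVal e (rescale x₀ h z.1))

variable {ρ K x₀ h}
variable {g : ℕ → ℝ → ℝ}

/-- The mean of a summand is at least `(c / 2 * q - η - ζ) * δ * h ^ d`. Here `δ * η` is reserved
for passing from the net to all directions, and `ζ` is the level to be compared with the gradient.
-/
theorem tail_curvatureTerm (hρ : IsContrast ρ g) (hg : ∀ i, IsNoiseDensity (g i)) {n : ℕ}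
    {f : (Fin d → ℝ) → ℝ} (hf : ContinuousOn f (cube d)) (hK : IsKernel K) (hh : 0 < h)
    (hh1 : h ≤ 1) {BK : ℝ} (hBK : ∀ u, K u ≤ BK) (θ : multiIndices d b → ℝ)
    {v₁ c q δ η ζ B S m : ℝ} (hδ : 0 < δ) (hδ1 : δ ≤ 1) (hc : 0 ≤ c) (hη0 : 0 ≤ η) (hζ0 : 0 ≤ ζ)
    (hm : ∀ i, ∀ v w : ℝ, |v| ≤ v₁ → |w| ≤ v₁ →
      c / 2 * (w - v) ^ 2 ≤ (meanScore ρ (g i) w - meanScore ρ (g i) v) * (w - v))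
    (hbias : ∀ x ∈ cube d, K (rescale x₀ h x) ≠ 0 →
      |f x - polyVal θ (rescale x₀ h x)| ≤ v₁ / 2)
    (hsub : ∀ x, rescale x₀ h x ∈ inwardDirections x₀ →
      (∀ j, |rescale x₀ h x j| ≤ 1 / 2) → x ∈ cube d)
    (e : multiIndices d b → ℝ) (he : ‖e‖ = 1) (hδv : δ * (multiIndices d b).card ≤ v₁ / 2)
    (hq : q ≤ ∫ z in inwardDirections x₀, K z * polyVal e z ^ 2)
    (hB : BK * ((multiIndices d b).card ^ 2 + η) + ζ ≤ B) (hB1 : 1 ≤ B)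
    (hS : (multiIndices d b).card ^ 2 + η + ζ ≤ S) (hS1 : 1 ≤ S)
    (hm0 : 0 < m) (hm1 : m ≤ 1) (hmq : m ≤ c / 2 * q - η - ζ) :
    (sampleLaw d n g f).real {z | ∑ i, curvatureTerm ρ K x₀ h θ e δ η ζ (z i) ≤ 0} ≤
      Real.exp (-(m ^ 2 / (4 * B * S) * (n * h ^ d) * δ ^ 2)) := by
  have hprob := fun i => isProbabilityMeasure_obsLaw hf (hg i)
  have hH0 : 0 ≤ h ^ d := by positivity
  have hH1 : h ^ d ≤ 1 := pow_le_one₀ hh.le hh1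
  have hδH : δ * h ^ d ≤ 1 := mul_le_one₀ hδ1 hH0 hH1
  have hBK0 : 0 ≤ BK := (hK.nonneg 0).trans (hBK 0)
  set D : ℝ := ((multiIndices d b).card : ℝ) with hD
  have hmeasF : Measurable fun z : (Fin d → ℝ) × ℝ => scoreIncrement ρ x₀ h θ e δ z - δ * η :=
    (measurable_scoreIncrement hρ θ e δ).sub_const _
  have hF : ∀ z : (Fin d → ℝ) × ℝ, K (rescale x₀ h z.1) ≠ 0 →
      |scoreIncrement ρ x₀ h θ e δ z| ≤ δ * D ^ 2 := fun z h0 => by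
    have h1 := abs_polyVal_le e fun j => (hK.abs_le_half h0 j).trans (by norm_num)
    rw [he, mul_one] at h1
    refine (abs_scoreIncrement_le hρ θ e hδ.le z).trans ?_
    rw [← sq_abs (polyVal e _)]
    gcongr
  have hF' : ∀ z : (Fin d → ℝ) × ℝ, K (rescale x₀ h z.1) ≠ 0 →
      |scoreIncrement ρ x₀ h θ e δ z - δ * η| ≤ D ^ 2 + η := fun z h0 => by
    refine (abs_sub _ _).trans ?_
    rw [abs_of_nonneg (by positivity : 0 ≤ δ * η)]
    have := hF z h0
    nlinarith [sq_nonneg D]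
  have hKF : ∀ z : (Fin d → ℝ) × ℝ,
      |K (rescale x₀ h z.1) * (scoreIncrement ρ x₀ h θ e δ z - δ * η)| ≤ BK * (D ^ 2 + η) :=
    fun z => abs_kernel_mul_le hK hBK (by positivity) (hF' z)
  have hmeasKF : Measurable fun z : (Fin d → ℝ) × ℝ =>
      K (rescale x₀ h z.1) * (scoreIncrement ρ x₀ h θ e δ z - δ * η) :=
    (measurable_kernel_fst hK).mul hmeasF
  have hiKF : ∀ i, Integrable (fun z : (Fin d → ℝ) × ℝ =>
      K (rescale x₀ h z.1) * (scoreIncrement ρ x₀ h θ e δ z - δ * η)) (obsLaw f (g i)) :=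
    fun i => Integrable.of_bound hmeasKF.aestronglyMeasurable _ (ae_of_all _ hKF)
  have hζδ : |ζ * δ * h ^ d| = ζ * δ * h ^ d := abs_of_nonneg (by positivity)
  rw [sampleLaw_eq_pi]
  refine measureReal_sum_nonpos_le_exp_sq _ (hmeasKF.sub_const _) hB1 hS1 hm0 hm1 hδ.le hδ1
    (fun z => ?_) (fun i => ?_) (fun i => ?_)
  · refine (abs_sub _ _).trans ((add_le_add (hKF z) ?_).trans hB)
    rw [hζδ, mul_assoc]
    exact mul_le_of_le_one_right hζ0 hδH
  · have h1 : ∫ z, |curvatureTerm ρ K x₀ h θ e δ η ζ z| ∂obsLaw f (g i) ≤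
        ∫ z, (|K (rescale x₀ h z.1) * (scoreIncrement ρ x₀ h θ e δ z - δ * η)| + ζ * δ * h ^ d)
          ∂obsLaw f (g i) := by
      refine integral_mono ((hiKF i).sub (integrable_const _)).abs
        ((hiKF i).abs.add (integrable_const _)) fun z => ?_
      refine (abs_sub _ _).trans_eq ?_
      rw [hζδ]
    refine h1.trans ?_
    rw [integral_add (hiKF i).abs (integrable_const _), integral_const]
    simp only [probReal_univ, one_smul]
    have h2 := integral_abs_kernel_mul_le hf (hg i) hK hh hmeasF hF' (by positivity)
    have h3 : ζ * δ * h ^ d ≤ ζ * h ^ d := by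
      rw [mul_assoc]
      exact mul_le_mul_of_nonneg_left (mul_le_of_le_one_left hH0 hδ1) hζ0
    nlinarith
  · have h1 := le_integral_scoreIncrement hρ (hg i) hf hK hh θ hδ hc (hm i) hbias hsub e he hδv hq
    have h2 := integral_abs_kernel_mul_le (x₀ := x₀) (F := fun _ => δ * η) (A := δ * η) hf (hg i)
      hK hh measurable_const (fun z _ => by rw [abs_of_nonneg (by positivity)]) (by positivity)
    have hi1 : Integrable (fun z : (Fin d → ℝ) × ℝ =>
        K (rescale x₀ h z.1) * scoreIncrement ρ x₀ h θ e δ z) (obsLaw f (g i)) :=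
      Integrable.of_bound ((measurable_kernel_fst hK).mul
        (measurable_scoreIncrement hρ θ e δ)).aestronglyMeasurable (BK * (δ * D ^ 2))
        (ae_of_all _ fun z => abs_kernel_mul_le hK hBK (by positivity) (hF z))
    have hi2 : Integrable (fun z : (Fin d → ℝ) × ℝ => K (rescale x₀ h z.1) * (δ * η))
        (obsLaw f (g i)) :=
      Integrable.of_bound ((measurable_kernel_fst hK).mul_const _).aestronglyMeasurable
        (BK * (δ * η)) (ae_of_all _ fun z => abs_kernel_mul_le hK hBK (by positivity) fun _ => by
          rw [abs_of_nonneg (by positivity)])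
    have h3 : ∫ z, curvatureTerm ρ K x₀ h θ e δ η ζ z ∂obsLaw f (g i) =
        ∫ z, K (rescale x₀ h z.1) * scoreIncrement ρ x₀ h θ e δ z ∂obsLaw f (g i) -
          ∫ z, K (rescale x₀ h z.1) * (δ * η) ∂obsLaw f (g i) - ζ * δ * h ^ d := by
      simp only [curvatureTerm]
      rw [integral_sub (hiKF i) (integrable_const _)]
      simp only [mul_sub]
      rw [integral_sub hi1 hi2]
      simp
    have h4 : ∫ z, K (rescale x₀ h z.1) * (δ * η) ∂obsLaw f (g i) ≤ δ * η * h ^ d :=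
      (integral_mono hi2 hi2.abs fun z => le_abs_self _).trans h2
    change _ ≤ ∫ z, curvatureTerm ρ K x₀ h θ e δ η ζ z ∂obsLaw f (g i)
    rw [h3]
    have h5 : m * (δ * h ^ d) ≤ (c / 2 * q - η - ζ) * (δ * h ^ d) :=
      mul_le_mul_of_nonneg_right hmq (by positivity)
    linarith

/-- The mean of a summand is at least `(κ * δ - η) * h ^ d`, where `η` bounds the bias. Condition
`hmη` says that the threshold exceeds the bias by a margin proportional to `δ`. -/
theorem tail_gradientTerm (hρ : IsContrast ρ g) (hg : ∀ i, IsNoiseDensity (g i)) {n : ℕ}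
    {f : (Fin d → ℝ) → ℝ} (hf : ContinuousOn f (cube d)) (hK : IsKernel K) (hh : 0 < h)
    (hh1 : h ≤ 1) {BK Bρ : ℝ} (hBK : ∀ u, K u ≤ BK) (hBρ : ∀ z, |deriv ρ z| ≤ Bρ)
    (θ : multiIndices d b → ℝ)
    {δ η κ B S m : ℝ} (hδ : 0 < δ) (hδ1 : δ ≤ 1) (hη0 : 0 ≤ η) (hκ0 : 0 ≤ κ)
    (hbias : ∀ x ∈ cube d, K (rescale x₀ h x) ≠ 0 →
      |f x - polyVal θ (rescale x₀ h x)| ≤ η)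
    (e : multiIndices d b → ℝ) (he : ∀ u : Fin d → ℝ, (∀ j, |u j| ≤ 1) → |polyVal e u| ≤ 1)
    (hB : BK * Bρ + κ ≤ B) (hB1 : 1 ≤ B) (hS : Bρ + κ ≤ S) (hS1 : 1 ≤ S)
    (hm0 : 0 < m) (hm1 : m ≤ 1) (hmη : m * δ ≤ κ * δ - η) :
    (sampleLaw d n g f).real {z | ∑ i, gradientTerm ρ K x₀ h θ e δ κ (z i) ≤ 0} ≤
      Real.exp (-(m ^ 2 / (4 * B * S) * (n * h ^ d) * δ ^ 2)) := by
  have hprob := fun i => isProbabilityMeasure_obsLaw hf (hg i)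
  have hH0 : 0 ≤ h ^ d := by positivity
  have hH1 : h ^ d ≤ 1 := pow_le_one₀ hh.le hh1
  have hδH : δ * h ^ d ≤ 1 := mul_le_one₀ hδ1 hH0 hH1
  have hBρ0 : 0 ≤ Bρ := (abs_nonneg _).trans (hBρ 0)
  have hmeasF : Measurable fun z : (Fin d → ℝ) × ℝ =>
      deriv ρ (residual x₀ h θ z) * polyVal e (rescale x₀ h z.1) :=
    (hρ.measurable_score.comp (measurable_residual θ)).mul (measurable_polyVal_fst e)
  have hF : ∀ z : (Fin d → ℝ) × ℝ, K (rescale x₀ h z.1) ≠ 0 →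
      |deriv ρ (residual x₀ h θ z) * polyVal e (rescale x₀ h z.1)| ≤ Bρ := fun z h0 => by
    rw [abs_mul]
    exact (mul_le_mul (hBρ _) (he _ fun j => (hK.abs_le_half h0 j).trans (by norm_num))
      (abs_nonneg _) hBρ0).trans_eq (mul_one _)
  have hKF : ∀ z : (Fin d → ℝ) × ℝ, |K (rescale x₀ h z.1) *
      (deriv ρ (residual x₀ h θ z) * polyVal e (rescale x₀ h z.1))| ≤ BK * Bρ :=
    fun z => abs_kernel_mul_le hK hBK hBρ0 (hF z)
  have hmeasKF : Measurable fun z : (Fin d → ℝ) × ℝ => K (rescale x₀ h z.1) *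
      (deriv ρ (residual x₀ h θ z) * polyVal e (rescale x₀ h z.1)) :=
    (measurable_kernel_fst hK).mul hmeasF
  have hiKF : ∀ i, Integrable (fun z : (Fin d → ℝ) × ℝ => K (rescale x₀ h z.1) *
      (deriv ρ (residual x₀ h θ z) * polyVal e (rescale x₀ h z.1))) (obsLaw f (g i)) :=
    fun i => Integrable.of_bound hmeasKF.aestronglyMeasurable _ (ae_of_all _ hKF)
  have hκδ : |κ * δ * h ^ d| = κ * δ * h ^ d := abs_of_nonneg (by positivity)
  have hκδ1 : κ * δ * h ^ d ≤ κ * h ^ d := by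
    rw [mul_assoc]
    exact mul_le_mul_of_nonneg_left (mul_le_of_le_one_left hH0 hδ1) hκ0
  rw [sampleLaw_eq_pi]
  refine measureReal_sum_nonpos_le_exp_sq _ (hmeasKF.const_sub _) hB1 hS1 hm0 hm1 hδ.le hδ1
    (fun z => ?_) (fun i => ?_) (fun i => ?_)
  · refine (abs_sub _ _).trans (le_trans ?_ hB)
    rw [hκδ, add_comm]
    refine add_le_add (hKF z) (hκδ1.trans ?_)
    exact mul_le_of_le_one_right hκ0 hH1
  · have h1 : ∫ z, |gradientTerm ρ K x₀ h θ e δ κ z| ∂obsLaw f (g i) ≤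
        ∫ z, (κ * δ * h ^ d + |K (rescale x₀ h z.1) *
          (deriv ρ (residual x₀ h θ z) * polyVal e (rescale x₀ h z.1))|) ∂obsLaw f (g i) := by
      refine integral_mono ((integrable_const _).sub (hiKF i)).abs
        ((integrable_const _).add (hiKF i).abs) fun z => ?_
      refine (abs_sub _ _).trans_eq ?_
      rw [hκδ]
    refine h1.trans ?_
    rw [integral_add (integrable_const _) (hiKF i).abs, integral_const]
    simp only [probReal_univ, one_smul]
    have h2 := integral_abs_kernel_mul_le hf (hg i) hK hh hmeasF hF hBρ0
    nlinarith
  · have h1 := (abs_le.1 (abs_integral_gradient_le hρ (hg i) hf hK hh θ hη0 hbias e he)).2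
    change _ ≤ ∫ z, gradientTerm ρ K x₀ h θ e δ κ z ∂obsLaw f (g i)
    simp only [gradientTerm]
    rw [integral_sub (integrable_const _) (hiKF i), integral_const]
    simp only [probReal_univ, one_smul]
    have h5 := mul_le_mul_of_nonneg_right hmη hH0
    linarith

/-- If all curvature and gradient sums are positive, the minimiser is `δ`-close to `θ`. -/
theorem norm_sub_le_of_sums_pos (hρ : IsContrast ρ g) (hK : IsKernel K) (hh : 0 < h) {n : ℕ}
    (hn : 0 < n) {M : ℝ} {z : Sample d n} (hz : ∀ i, (z i).1 ∈ cube d)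
    {θ θ' : multiIndices d b → ℝ} (hθ : θ ∈ coeffBall d b M) (hθ' : θ' ∈ coeffBall d b M)
    (hmin : ∀ t ∈ coeffBall d b M, criterion ρ K x₀ h z θ' ≤ criterion ρ K x₀ h z t)
    {δ ε η ζ κ : ℝ} (hδ : 0 < δ) {t : Set (multiIndices d b → ℝ)} (ht : t ⊆ Metric.sphere 0 1)
    (hcover : Metric.sphere 0 1 ⊆ ⋃ e ∈ t, Metric.ball e ε)
    (hη : 2 * (multiIndices d b).card * ((multiIndices d b).card * ε) ≤ η)
    (hκ : (multiIndices d b).card * κ ≤ ζ)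
    (hcurv : ∀ e ∈ t, 0 < ∑ i, curvatureTerm ρ K x₀ h θ e δ η ζ (z i))
    (hgrad : ∀ s, 0 < ∑ i, gradientTerm ρ K x₀ h θ (signedUnit s) δ κ (z i)) :
    ‖θ' - θ‖ ≤ δ := by
  by_contra! hlt
  obtain ⟨e, he, hle⟩ := exists_direction hρ hK hh hn hz hθ hθ' hmin hδ.le hlt
  -- The direction `e` depends on the sample, so the curvature bound is transferred from a net point
  -- at the cost of `δ * η` per unit of kernel weight.
  obtain ⟨e', he't, hee'⟩ := mem_iUnion₂.1 (hcover (by simpa using he : e ∈ Metric.sphere 0 1))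
  have he' : ‖e'‖ = 1 := by simpa using ht he't
  have hdist : ‖e - e'‖ ≤ ε := by
    rw [Metric.mem_ball, dist_eq_norm] at hee'
    exact hee'.le
  set D : ℝ := ((multiIndices d b).card : ℝ) with hD
  have hδH : 0 ≤ δ * h ^ d := by positivity
  have hlow : n * (ζ * δ * h ^ d) <
      ∑ i, K (rescale x₀ h (z i).1) * scoreIncrement ρ x₀ h θ e δ (z i) := by
    have h1 := hcurv e' he't
    simp only [curvatureTerm] at h1
    rw [Finset.sum_sub_distrib, sub_pos] at h1
    simp only [Finset.sum_const, Finset.card_univ, Fintype.card_fin, nsmul_eq_mul] at h1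
    refine h1.trans_le (Finset.sum_le_sum fun i _ => ?_)
    rcases eq_or_ne (K (rescale x₀ h (z i).1)) 0 with h0 | h0
    · simp [h0]
    refine mul_le_mul_of_nonneg_left ?_ (hK.nonneg _)
    have hu : ∀ j, |rescale x₀ h (z i).1 j| ≤ 1 := fun j =>
      (hK.abs_le_half h0 j).trans (by norm_num)
    have h2 := abs_polyVal_le e hu
    have h3 := abs_polyVal_le e' hu
    have h4 := abs_polyVal_le (e - e') hu
    rw [he, mul_one] at h2
    rw [he', mul_one] at h3
    rw [polyVal_sub] at h4
    have h5 := abs_scoreIncrement_sub_le hρ θ e e' hδ.le (z i) h2 h3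
      (h4.trans (mul_le_mul_of_nonneg_left hdist (Nat.cast_nonneg _)))
    have h6 := mul_le_mul_of_nonneg_left hη hδ.le
    linarith [(abs_le.1 h5).1]
  have hup : ∑ i, K (rescale x₀ h (z i).1) *
      (deriv ρ (residual x₀ h θ (z i)) * polyVal e (rescale x₀ h (z i).1)) ≤
        n * (ζ * δ * h ^ d) := by
    -- The gradient is linear in `e`: control in the coordinate directions, with both signs,
    -- suffices, and summing over coordinates costs the factor `D` absorbed in `hκ`.
    set G : multiIndices d b → ℝ := fun p => ∑ i, K (rescale x₀ h (z i).1) *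
      (deriv ρ (residual x₀ h θ (z i)) * polyVal (Pi.single p 1) (rescale x₀ h (z i).1)) with hG
    have hGabs : ∀ p, |G p| ≤ n * (κ * δ * h ^ d) := fun p => by
      have h1 := hgrad (p, true)
      have h2 := hgrad (p, false)
      simp only [gradientTerm, signedUnit, polyVal_smul, Finset.sum_sub_distrib, Finset.sum_const,
        Finset.card_univ, Fintype.card_fin, nsmul_eq_mul, if_true, one_mul, Bool.false_eq_true,
        if_false, neg_mul, mul_neg, Finset.sum_neg_distrib] at h1 h2
      exact abs_le.2 ⟨by linarith, by linarith⟩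
    have hsum : ∑ i, K (rescale x₀ h (z i).1) *
        (deriv ρ (residual x₀ h θ (z i)) * polyVal e (rescale x₀ h (z i).1)) =
          ∑ p, e p * G p := by
      simp only [hG, Finset.mul_sum]
      rw [Finset.sum_comm]
      refine Finset.sum_congr rfl fun i _ => ?_
      rw [polyVal_eq_sum e, Finset.mul_sum, Finset.mul_sum]
      refine Finset.sum_congr rfl fun p _ => ?_
      ring
    rw [hsum]
    calc ∑ p, e p * G p ≤ ∑ _p : multiIndices d b, n * (κ * δ * h ^ d) := by
          refine Finset.sum_le_sum fun p _ => ?_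
          have h1 : |e p| ≤ 1 := he ▸ norm_le_pi_norm e p
          calc e p * G p ≤ |e p| * |G p| := (le_abs_self _).trans (abs_mul _ _).le
            _ ≤ 1 * (n * (κ * δ * h ^ d)) :=
              mul_le_mul h1 (hGabs p) (abs_nonneg _) zero_le_one
            _ = _ := one_mul _
      _ = D * κ * (n * (δ * h ^ d)) := by
          simp only [Finset.sum_const, Finset.card_univ, Fintype.card_coe, nsmul_eq_mul]
          ring
      _ ≤ ζ * (n * (δ * h ^ d)) := mul_le_mul_of_nonneg_right hκ (by positivity)
      _ = _ := by ring
  linarith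

end Events

/-- A union bound with an almost sure inclusion, since the design points lie in the cube only almost
surely. -/
theorem measureReal_le_of_ae_exists {E ι ι' : Type*} [MeasurableSpace E] {μ : Measure E}
    [IsFiniteMeasure μ] (s : Finset ι) (t : Finset ι') {P : ι → Set E} {Q : ι' → Set E} {A : Set E}
    {r : ℝ} (hA : ∀ᵐ z ∂μ, z ∈ A → (∃ i ∈ s, z ∈ P i) ∨ ∃ j ∈ t, z ∈ Q j)
    (hP : ∀ i ∈ s, μ.real (P i) ≤ r) (hQ : ∀ j ∈ t, μ.real (Q j) ≤ r) :
    μ.real A ≤ (s.card + t.card) * r := by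
  have hincl : A ≤ᵐ[μ] ((⋃ i ∈ s, P i) ∪ ⋃ j ∈ t, Q j : Set E) := by
    filter_upwards [hA] with z hz hzA
    rcases hz hzA with ⟨i, hi, h⟩ | ⟨j, hj, h⟩
    · exact Or.inl (mem_biUnion (t := P) hi h)
    · exact Or.inr (mem_biUnion (t := Q) hj h)
  have hmono := ENNReal.toReal_mono (measure_ne_top _ _) (measure_mono_ae hincl)
  refine (hmono.trans (measureReal_union_le _ _)).trans ?_
  rw [add_mul, ← nsmul_eq_mul, ← nsmul_eq_mul]
  exact add_le_add ((measureReal_biUnion_finset_le s P).trans (Finset.sum_le_card_nsmul _ _ _ hP))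
    ((measureReal_biUnion_finset_le t Q).trans (Finset.sum_le_card_nsmul _ _ _ hQ))

/-- Deviation inequality for the `ρ`-LPA estimator. -/
theorem exists_deviation_bound {d : ℕ} {β L M c : ℝ} (hβ : 0 < β) (hL : 0 ≤ L) (hM : 0 ≤ M)
    (hc : 0 < c) {x₀ : Fin d → ℝ} (hx₀ : x₀ ∈ cube d) {K : (Fin d → ℝ) → ℝ} (hK : IsKernel K)
    (hKx₀ : 0 < ∫ z in inwardDirections x₀, K z) {ρ : ℝ → ℝ} {g : ℕ → ℝ → ℝ}
    (hρ : IsContrast ρ g) (hg : g ∈ densityClass ρ c) :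
    ∃ C a A δ₀ h₀ : ℝ, 0 < C ∧ 0 < a ∧ 0 < A ∧ 0 < δ₀ ∧ 0 < h₀ ∧
      ∀ h, 0 < h → h ≤ h₀ → ∀ n : ℕ, 0 < n → ∀ fhat : Sample d n → ℝ,
        IsLPAEstimator (strictFloor β) M ρ K x₀ h fhat → ∀ f, IsHolder d β L M f →
          ∀ δ, A * h ^ β ≤ δ → δ ≤ δ₀ →
            (sampleLaw d n g f).real {z | δ < |fhat z - f x₀|} ≤
              C * Real.exp (-(a * (n * h ^ d) * δ ^ 2)) := by
  set b := strictFloor β with hb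
  obtain ⟨q, hq0, hq⟩ := exists_design_lower_bound b hK hKx₀
  obtain ⟨v₁, hv₁, hm⟩ := hρ.exists_meanScore_growth hc hg
  obtain ⟨h₀, hh₀, hh₀1, hsub⟩ := exists_inward_subset hx₀
  obtain ⟨BK, hBK⟩ := hK.bounded
  obtain ⟨Bρ, hBρ⟩ := hρ.bounded_deriv
  have hBK0 : 0 ≤ BK := (hK.nonneg 0).trans (hBK 0)
  have hBρ0 : 0 ≤ Bρ := (abs_nonneg _).trans (hBρ 0)
  set D : ℝ := ((multiIndices d b).card : ℝ) with hD
  have hD0 : 0 < D := by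
    have : (multiIndices d b).Nonempty := ⟨_, (zeroIndex d b).2⟩
    rw [hD]
    exact_mod_cast this.card_pos
  -- The mean curvature coefficient is `c * q / 2`. One share `c * q / 8` pays for the net (hence
  -- `ε`), another is the level facing the gradient (hence `κ`, divided among `D` coordinates), and
  -- `c * q / 4` remains as the margin of the Chernoff bound.
  set η := c * q / 8 with hη
  set ε := c * q / (16 * D ^ 2) with hε
  set κ := c * q / (8 * D) with hκ
  have hη0 : 0 < η := by positivity
  have hε0 : 0 < ε := by positivity
  have hκ0 : 0 < κ := by positivity
  set Cb := (d : ℝ) * (D * L) with hCb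
  have hCb0 : 0 ≤ Cb := by positivity
  set B := BK * (D ^ 2 + η) + η + (BK * Bρ + κ) + 1 with hB
  set S := D ^ 2 + η + η + (Bρ + κ) + 1 with hS
  have e1 : 0 ≤ BK * (D ^ 2 + η) := by positivity
  have e2 : 0 ≤ BK * Bρ := by positivity
  have e3 : 0 ≤ D ^ 2 := by positivity
  have hB1 : 1 ≤ B := by linarith
  have hS1 : 1 ≤ S := by linarith
  set m := min 1 (min (c * q / 4) (κ / 2)) with hmdef
  have hm0 : 0 < m := by positivity
  have hm1 : m ≤ 1 := min_le_left _ _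
  have hmq : m ≤ c * q / 4 := (min_le_right _ _).trans (min_le_left _ _)
  have hmκ : m ≤ κ / 2 := (min_le_right _ _).trans (min_le_right _ _)
  obtain ⟨t, htsub, htfin, htcov⟩ :=
    (isCompact_sphere (0 : multiIndices d b → ℝ) 1).finite_cover_balls hε0
  -- The bias is at most `κ * δ / 2`, so these bounds keep both the bias and the shift `δ * D` below
  -- `v₁ / 2`.
  set δ₀ := min 1 (min (v₁ / κ) (v₁ / (2 * D))) with hδ₀
  refine ⟨htfin.toFinset.card + Fintype.card (multiIndices d b × Bool) + 1,
    m ^ 2 / (4 * B * S), 2 * Cb / κ + 1, δ₀, h₀, by positivity, by positivity, by positivity,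
    by positivity, hh₀, ?_⟩
  intro h hh hhh₀ n hn fhat hfhat f hf δ hδA hδδ₀
  have hh1 : h ≤ 1 := hhh₀.trans hh₀1
  have hδ0 : 0 < δ := lt_of_lt_of_le (by positivity) hδA
  have hδ1 : δ ≤ 1 := hδδ₀.trans (min_le_left _ _)
  have hδκ : δ * κ ≤ v₁ :=
    (le_div_iff₀ hκ0).1 (hδδ₀.trans ((min_le_right _ _).trans (min_le_left _ _)))
  have hδD : δ * (2 * D) ≤ v₁ :=
    (le_div_iff₀ (by positivity)).1 (hδδ₀.trans ((min_le_right _ _).trans (min_le_right _ _)))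
  have hβh : 0 ≤ h ^ β := by positivity
  -- The constant `2 * Cb / κ + 1` in the lower bound for `δ` makes the bias at most half of the
  -- gradient threshold; the added `1` keeps that constant positive when `Cb = 0`.
  have hbiasδ : Cb * h ^ β ≤ κ * δ / 2 := by
    have h1 := mul_le_mul_of_nonneg_left hδA hκ0.le
    have h2 : κ * ((2 * Cb / κ + 1) * h ^ β) = 2 * (Cb * h ^ β) + κ * h ^ β := by
      field_simp
    have h3 : 0 ≤ κ * h ^ β := by positivity
    linarith
  have hcont := hf.continuousOn hβ hL
  set θ := taylorCoeff b f x₀ h with hθ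
  have hbias : ∀ x ∈ cube d, K (rescale x₀ h x) ≠ 0 →
      |f x - polyVal θ (rescale x₀ h x)| ≤ Cb * h ^ β :=
    fun x hx hKx => hf.abs_bias_le hβ hL hx hx₀ hK hh hKx
  have hprob := fun i => isProbabilityMeasure_obsLaw hcont (hg.1 i)
  have hθmem : θ ∈ coeffBall d b M := hf.taylorCoeff_mem hM hx₀ hh.le hh1
  have hprob' : IsProbabilityMeasure (sampleLaw d n g f) := by
    rw [sampleLaw_eq_pi]; infer_instance
  have hcube : ∀ᵐ z ∂sampleLaw d n g f, ∀ i, (z i).1 ∈ cube d := by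
    rw [sampleLaw_eq_pi]
    exact eventually_all.2 fun i =>
      (Measure.tendsto_eval_ae_ae (μ := fun i : Fin n => obsLaw f (g i))).eventually
        (ae_obsLaw_mem_cube hcont (hg.1 i))
  have hη' : 2 * D * (D * ε) ≤ η := le_of_eq (by rw [hη, hε]; field_simp; norm_num)
  have hκ' : D * κ ≤ η := le_of_eq (by rw [hη, hκ]; field_simp)
  have hunion := measureReal_le_of_ae_exists (μ := sampleLaw d n g f)
    (A := {z | δ < |fhat z - f x₀|})
    (r := Real.exp (-(m ^ 2 / (4 * B * S) * (n * h ^ d) * δ ^ 2))) htfin.toFinset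
    (Finset.univ : Finset (multiIndices d b × Bool))
    (P := fun e => {z | ∑ i, curvatureTerm ρ K x₀ h θ e δ η η (z i) ≤ 0})
    (Q := fun s => {z | ∑ i, gradientTerm ρ K x₀ h θ (signedUnit s) δ κ (z i) ≤ 0}) ?_ ?_ ?_
  · rw [Finset.card_univ] at hunion
    refine hunion.trans (mul_le_mul_of_nonneg_right ?_ (Real.exp_pos _).le)
    linarith
  · filter_upwards [hcube] with z hz (hzδ : δ < |fhat z - f x₀|)
    by_contra! hcon
    obtain ⟨θ', hθ', hmin, hval⟩ := hfhat.2 z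
    have hle := norm_sub_le_of_sums_pos hρ hK hh hn hz hθmem hθ' hmin hδ0 htsub htcov hη' hκ'
      (fun e he => hcon.1 e (htfin.mem_toFinset.2 he))
      fun s => hcon.2 s (Finset.mem_univ s)
    have h1 := norm_le_pi_norm (θ' - θ) (zeroIndex d b)
    rw [Pi.sub_apply, hθ, taylorCoeff_zeroIndex, ← hval, Real.norm_eq_abs] at h1
    linarith
  · intro e he
    have he1 : ‖e‖ = 1 := by simpa using htsub (htfin.mem_toFinset.1 he)
    refine tail_curvatureTerm hρ hg.1 hcont hK hh hh1 hBK θ hδ0 hδ1 hc.le hη0.le hη0.le hm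
      (fun x hx hKx => (hbias x hx hKx).trans (by linarith)) (hsub h hh hhh₀) e he1
      (by linarith) (hq e he1) (by linarith) hB1 (by linarith) hS1 hm0 hm1 ?_
    rw [hη]
    linarith
  · intro s _
    have h1 : 0 ≤ Cb * h ^ β := mul_nonneg hCb0 hβh
    have h2 : BK * Bρ + κ ≤ B := by linarith
    have h3 : Bρ + κ ≤ S := by linarith
    have h4 : m * δ ≤ κ * δ - Cb * h ^ β := by
      linarith [mul_le_mul_of_nonneg_right hmκ hδ0.le]
    exact tail_gradientTerm hρ hg.1 hcont hK hh hh1 hBK hBρ θ hδ0 hδ1 h1 hκ0.le hbias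
      (signedUnit s) (fun u hu => abs_polyVal_signedUnit_le s hu) h2 hB1 h3 hS1 hm0 hm1 h4

/-! ### The upper bound on the risk -/

theorem summable_rpow_mul_exp (r : ℝ) {a : ℝ} (ha : 0 < a) (C : ℝ) :
    Summable fun k : ℕ => ((k : ℝ) + 2) ^ r * (C * Real.exp (-(a * ((k : ℝ) + 1)))) := by
  have h1 := Real.summable_pow_mul_exp_neg_nat_mul ⌈r⌉₊ ha
  have h2 := ((summable_nat_add_iff 2).2 h1).mul_left (Real.exp a)
  have h3 : Summable fun k : ℕ => ((k : ℝ) + 2) ^ r * Real.exp (-(a * ((k : ℝ) + 1))) := by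
    refine h2.of_nonneg_of_le (fun k => by positivity) fun k => ?_
    have hexp : Real.exp (-(a * ((k : ℝ) + 1))) =
        Real.exp a * Real.exp (-a * ((k + 2 : ℕ) : ℝ)) := by
      rw [← Real.exp_add]
      congr 1
      push_cast
      ring
    rw [hexp, mul_left_comm]
    push_cast
    gcongr
    rw [← Real.rpow_natCast]
    exact Real.rpow_le_rpow_of_exponent_le (by linarith [k.cast_nonneg (α := ℝ)]) (Nat.le_ceil r)
  refine (h3.mul_left C).congr fun k => by ring

/-- A moment bound from exponential tails. -/
theorem lintegral_rpow_le_of_exp_tail {Ω : Type*} [MeasurableSpace Ω] {μ : Measure Ω}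
    [IsProbabilityMeasure μ] {T : Ω → ℝ} (hT : Measurable T) (hT0 : ∀ ω, 0 ≤ T ω) {φ r C a : ℝ}
    (hφ : 0 < φ) (hr : 0 ≤ r)
    (htail : ∀ k : ℕ, μ.real {ω | ((k : ℝ) + 1) * φ < T ω} ≤ C * Real.exp (-(a * ((k : ℝ) + 1)))) :
    ∫⁻ ω, ENNReal.ofReal (T ω ^ r) ∂μ ≤ ENNReal.ofReal (φ ^ r) *
      (1 + ∑' k : ℕ, ENNReal.ofReal (((k : ℝ) + 2) ^ r *
        (C * Real.exp (-(a * ((k : ℝ) + 1)))))) := by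
  set E : ℕ → Set Ω := fun k => {ω | ((k : ℝ) + 1) * φ < T ω} with hE
  have hEm : ∀ k, MeasurableSet (E k) := fun k => measurableSet_lt measurable_const hT
  have hpt : ∀ ω, ENNReal.ofReal (T ω ^ r) ≤ ENNReal.ofReal (φ ^ r) *
      (1 + ∑' k : ℕ, (E k).indicator (fun _ => ENNReal.ofReal (((k : ℝ) + 2) ^ r)) ω) := by
    intro ω
    rcases le_or_gt (T ω) φ with h | h
    · calc ENNReal.ofReal (T ω ^ r) ≤ ENNReal.ofReal (φ ^ r) * 1 := by
            rw [mul_one]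
            exact ENNReal.ofReal_le_ofReal (Real.rpow_le_rpow (hT0 ω) h hr)
        _ ≤ _ := by gcongr; exact le_self_add
    -- The shift by two gives `(k + 1) * φ < T ω ≤ (k + 2) * φ`: the lower end places `ω` in the
    -- `k`-th tail event, the upper end bounds the moment there.
    · obtain ⟨k, hk⟩ : ∃ k : ℕ, ⌈T ω / φ⌉₊ = k + 2 := by
        have : 1 < ⌈T ω / φ⌉₊ := Nat.lt_ceil.2 (by rw [Nat.cast_one, lt_div_iff₀ hφ]; linarith)
        exact ⟨⌈T ω / φ⌉₊ - 2, by omega⟩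
      have hk1 : T ω ≤ φ * ((k : ℝ) + 2) := by
        have := Nat.le_ceil (T ω / φ)
        rw [hk, div_le_iff₀ hφ] at this
        push_cast at this
        linarith
      have hk2 : ω ∈ E k := by
        have : k + 1 < ⌈T ω / φ⌉₊ := by omega
        have := Nat.lt_ceil.1 this
        rw [lt_div_iff₀ hφ] at this
        push_cast at this
        exact this
      calc ENNReal.ofReal (T ω ^ r) ≤ ENNReal.ofReal (φ ^ r * ((k : ℝ) + 2) ^ r) := by
            refine ENNReal.ofReal_le_ofReal ?_
            rw [← Real.mul_rpow hφ.le (by positivity)]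
            exact Real.rpow_le_rpow (hT0 ω) hk1 hr
        _ = ENNReal.ofReal (φ ^ r) *
            (E k).indicator (fun _ => ENNReal.ofReal (((k : ℝ) + 2) ^ r)) ω := by
            rw [ENNReal.ofReal_mul (by positivity), indicator_of_mem hk2]
        _ ≤ _ := by
            gcongr
            exact (ENNReal.le_tsum (f := fun k : ℕ =>
              (E k).indicator (fun _ => ENNReal.ofReal (((k : ℝ) + 2) ^ r)) ω) k).trans le_add_self
  have hmeas : ∀ k, Measurable ((E k).indicator fun _ : Ω => ENNReal.ofReal (((k : ℝ) + 2) ^ r)) :=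
    fun k => measurable_const.indicator (hEm k)
  refine (lintegral_mono hpt).trans ?_
  have hsum : Measurable fun ω => 1 + ∑' k : ℕ,
      (E k).indicator (fun _ => ENNReal.ofReal (((k : ℝ) + 2) ^ r)) ω :=
    measurable_const.add (Measurable.tsum hmeas)
  rw [lintegral_const_mul _ hsum,
    lintegral_add_left measurable_const, lintegral_tsum fun k => (hmeas k).aemeasurable,
    lintegral_const, measure_univ, mul_one]
  gcongr with k
  rw [lintegral_indicator_const (hEm k), ENNReal.ofReal_mul (by positivity)]
  gcongr
  rw [← ofReal_measureReal]
  exact ENNReal.ofReal_le_ofReal (htail k)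

/-! ### Bandwidth, rate and effective sample size -/

section Rates

variable {d : ℕ} {β L : ℝ}

theorem bandwidth_pos (hL : 0 < L) {n : ℕ} (hn : 0 < n) : 0 < bandwidth d β L n := by
  unfold bandwidth
  positivity

theorem rate_pos {n : ℕ} (hn : 0 < n) : 0 < rate d β n := by
  unfold rate
  positivity

theorem bandwidth_rpow (hL : 0 < L) (n : ℕ) :
    bandwidth d β L n ^ β = (L ^ 2) ^ (-(β / (2 * β + d))) * rate d β n := by
  rw [bandwidth, rate, ← Real.rpow_mul (by positivity), ← Real.mul_rpow (by positivity)
    (by positivity)]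
  congr 1
  ring

/-- The balance that determines the rate: at deviation `δ = φ` the exponent `n * h ^ d * δ ^ 2` does
not depend on `n`. -/
theorem effective_sample_size (hβ : 0 < β) (hL : 0 < L) {n : ℕ} (hn : 0 < n) :
    n * bandwidth d β L n ^ d * rate d β n ^ 2 = (L ^ 2) ^ (-(d / (2 * β + d))) := by
  have hs : 2 * β + (d : ℝ) ≠ 0 := by positivity
  have hn0 : (0 : ℝ) < n := by exact_mod_cast hn
  have h1 : bandwidth d β L n ^ d =
      (L ^ 2) ^ (-(d / (2 * β + d))) * (n : ℝ) ^ (-(d / (2 * β + d))) := by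
    rw [bandwidth, ← Real.rpow_natCast, ← Real.rpow_mul (by positivity),
      ← Real.mul_rpow (by positivity) (by positivity)]
    congr 1
    ring
  have h2 : rate d β n ^ 2 = (n : ℝ) ^ (-(2 * β / (2 * β + d))) := by
    rw [rate, ← Real.rpow_natCast, ← Real.rpow_mul hn0.le]
    congr 1
    push_cast
    ring
  rw [h1, h2]
  have h3 : (n : ℝ) * (n : ℝ) ^ (-(d / (2 * β + d))) * (n : ℝ) ^ (-(2 * β / (2 * β + d))) = 1 := by
    nth_rewrite 1 [← Real.rpow_one (n : ℝ)]
    have h4 : 1 + -(d / (2 * β + d)) + -(2 * β / (2 * β + d)) = 0 := by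
      field_simp
      ring
    rw [← Real.rpow_add hn0, ← Real.rpow_add hn0, h4, Real.rpow_zero]
  calc _ = (L ^ 2) ^ (-(d / (2 * β + d))) * ((n : ℝ) * (n : ℝ) ^ (-(d / (2 * β + d))) *
        (n : ℝ) ^ (-(2 * β / (2 * β + d)))) := by ring
    _ = _ := by rw [h3, mul_one]

theorem tendsto_natCast_rpow_neg {s : ℝ} (hs : 0 < s) :
    Tendsto (fun n : ℕ => (n : ℝ) ^ (-s)) atTop (𝓝 0) :=
  (tendsto_rpow_neg_atTop hs).comp tendsto_natCast_atTop_atTop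

theorem tendsto_rate (hβ : 0 < β) : Tendsto (rate d β) atTop (𝓝 0) :=
  tendsto_natCast_rpow_neg (by positivity)

theorem tendsto_bandwidth (hβ : 0 < β) (hL : 0 < L) :
    Tendsto (bandwidth d β L) atTop (𝓝 0) := by
  have h : bandwidth d β L = fun n : ℕ =>
      (L ^ 2) ^ (-(1 / (2 * β + d))) * (n : ℝ) ^ (-(1 / (2 * β + d))) :=
    funext fun n => Real.mul_rpow (by positivity) (by positivity)
  rw [h, ← mul_zero ((L ^ 2) ^ (-(1 / (2 * β + d))))]
  exact (tendsto_natCast_rpow_neg (by positivity)).const_mul _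

end Rates

/-- Exponential tails of the normalised estimation error, uniformly over the Hölder class. -/
theorem exists_exp_tail {d : ℕ} {β L M c : ℝ} (hβ : 0 < β) (hL : 0 < L) (hM : 0 < M)
    (hc : 0 < c) {x₀ : Fin d → ℝ} (hx₀ : x₀ ∈ cube d) {K : (Fin d → ℝ) → ℝ} (hK : IsKernel K)
    (hKx₀ : 0 < ∫ z in inwardDirections x₀, K z) {ρ : ℝ → ℝ} {g : ℕ → ℝ → ℝ}
    (hρ : IsContrast ρ g) (hg : g ∈ densityClass ρ c) {fhat : ∀ n, Sample d n → ℝ}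
    (hfhat : ∀ n, IsLPAEstimator (strictFloor β) M ρ K x₀ (bandwidth d β L n) (fhat n)) :
    ∃ C a : ℝ, 0 < a ∧ ∀ᶠ n in atTop, ∀ f, IsHolder d β L M f → ∀ k : ℕ,
      (sampleLaw d n g f).real {z | ((k : ℝ) + 1) * rate d β n < |fhat n z - f x₀|} ≤
        C * Real.exp (-(a * ((k : ℝ) + 1))) := by
  obtain ⟨C, a, A, δ₀, h₀, hC, ha, hA, hδ₀, hh₀, hdev⟩ :=
    exists_deviation_bound hβ hL.le hM.le hc hx₀ hK hKx₀ hρ hg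
  set c₁ := (L ^ 2) ^ (-(β / (2 * β + d))) with hc₁
  set c₂ := (L ^ 2) ^ (-(d / (2 * β + d))) with hc₂
  have hc₁0 : 0 < c₁ := by positivity
  have hc₂0 : 0 < c₂ := by positivity
  -- The deviation inequality is valid only up to `δ₀`, while errors can reach `2 * M`. Truncating
  -- the deviation at `δ₀` loses at most the factor `s` on that range.
  set s := min 1 (δ₀ / (2 * M)) with hs
  have hs0 : 0 < s := by positivity
  have hsM : s * (2 * M) ≤ δ₀ := (le_div_iff₀ (by positivity)).1 (min_le_right _ _)
  set a' := a * c₂ * s ^ 2 with ha'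
  have ha'0 : 0 < a' := by positivity
  refine ⟨C + Real.exp (a' * (A * c₁)), a', ha'0, ?_⟩
  have hev1 : ∀ᶠ n in atTop, bandwidth d β L n ≤ h₀ :=
    (tendsto_bandwidth hβ hL).eventually_le_const hh₀
  have hev2 : ∀ᶠ n in atTop, A * c₁ * rate d β n ≤ δ₀ := by
    have := (tendsto_rate (d := d) hβ).const_mul (A * c₁)
    rw [mul_zero] at this
    exact this.eventually_le_const hδ₀
  filter_upwards [hev1, hev2, eventually_gt_atTop 0] with n hn1 hn2 hn f hf k
  have hcont := hf.continuousOn hβ hL.le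
  have hprob := fun i => isProbabilityMeasure_obsLaw hcont (hg.1 i)
  have hprob' : IsProbabilityMeasure (sampleLaw d n g f) := by
    rw [sampleLaw_eq_pi]; infer_instance
  set φ := rate d β n with hφ
  have hφ0 : 0 < φ := rate_pos hn
  set κ := (k : ℝ) + 1 with hκ
  have hκ1 : 1 ≤ κ := by linarith [k.cast_nonneg (α := ℝ)]
  have hκ0 : 0 < κ := by linarith
  -- Estimator and target are both bounded by `M`, so deviations beyond `2 * M` are impossible.
  rcases le_or_gt (2 * M) (κ * φ) with h2M | h2M
  · have hempty : {z | κ * φ < |fhat n z - f x₀|} = ∅ := by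
      refine eq_empty_of_forall_notMem fun z (hz : κ * φ < |fhat n z - f x₀|) => ?_
      have := (abs_sub (fhat n z) (f x₀)).trans
        (add_le_add ((hfhat n).abs_le z) (hf.abs_le hM.le hx₀))
      linarith
    rw [hempty, measureReal_empty]
    positivity
  -- Below the bias level the deviation inequality says nothing; the term `exp (a' * (A * c₁))` in
  -- the constant makes the claimed bound exceed one.
  rcases le_or_gt κ (A * c₁) with hsmall | hlarge
  · refine measureReal_le_one.trans ?_
    have h1 : (1 : ℝ) ≤ Real.exp (a' * (A * c₁)) * Real.exp (-(a' * κ)) := by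
      rw [← Real.exp_add]
      exact Real.one_le_exp (by nlinarith)
    have h2 : 0 ≤ C * Real.exp (-(a' * κ)) := by positivity
    linarith [add_mul C (Real.exp (a' * (A * c₁))) (Real.exp (-(a' * κ)))]
  · set δ := min (κ * φ) δ₀ with hδ
    have hδs : s * (κ * φ) ≤ δ := by
      refine le_min ?_ ?_
      · exact mul_le_of_le_one_left (by positivity) (min_le_left _ _)
      · exact (mul_le_mul_of_nonneg_left h2M.le hs0.le).trans hsM
    have hAδ : A * bandwidth d β L n ^ β ≤ δ := by
      rw [bandwidth_rpow hL, ← mul_assoc]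
      refine le_min ?_ hn2
      exact mul_le_mul_of_nonneg_right hlarge.le hφ0.le
    have h1 := hdev _ (bandwidth_pos hL hn) hn1 n hn (fhat n) (hfhat n) f hf δ hAδ (min_le_right _ _)
    have h2 : (sampleLaw d n g f).real {z | κ * φ < |fhat n z - f x₀|} ≤
        (sampleLaw d n g f).real {z | δ < |fhat n z - f x₀|} :=
      measureReal_mono fun z (hz : κ * φ < |fhat n z - f x₀|) =>
        show δ < |fhat n z - f x₀| from (min_le_left _ _).trans_lt hz
    have h3 : a' * κ ≤ a * (n * bandwidth d β L n ^ d) * δ ^ 2 := by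
      have hN : 0 ≤ n * bandwidth d β L n ^ d := by
        have := (bandwidth_pos (d := d) (β := β) hL hn).le
        positivity
      calc a' * κ ≤ a' * κ ^ 2 := by
            have : κ ≤ κ ^ 2 := by nlinarith
            gcongr
        _ = a * (n * bandwidth d β L n ^ d) * (s * (κ * φ)) ^ 2 := by
            rw [ha', hc₂, ← effective_sample_size hβ hL hn]
            ring
        _ ≤ _ := by gcongr
    calc _ ≤ C * Real.exp (-(a * (n * bandwidth d β L n ^ d) * δ ^ 2)) := h2.trans h1
      _ ≤ (C + Real.exp (a' * (A * c₁))) * Real.exp (-(a' * κ)) := by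
          gcongr
          linarith [Real.exp_pos (a' * (A * c₁))]

theorem upperBound_lpa {d : ℕ} {β L M c : ℝ} (hβ : 0 < β) (hL : 0 < L) (hM : 0 < M)
    (hc : 0 < c) {x₀ : Fin d → ℝ} (hx₀ : x₀ ∈ cube d) {K : (Fin d → ℝ) → ℝ} (hK : IsKernel K)
    (hKx₀ : 0 < ∫ z in inwardDirections x₀, K z) {ρ : ℝ → ℝ} {g : ℕ → ℝ → ℝ}
    (hρ : IsContrast ρ g) (hg : g ∈ densityClass ρ c) {fhat : ∀ n, Sample d n → ℝ}
    (hfhat : ∀ n, IsLPAEstimator (strictFloor β) M ρ K x₀ (bandwidth d β L n) (fhat n))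
    {r : ℝ} (hr : 0 ≤ r) : UpperBound β L M g x₀ r (rate d β) fhat := by
  obtain ⟨C, a, ha, hev⟩ := exists_exp_tail hβ hL hM hc hx₀ hK hKx₀ hρ hg hfhat
  set S : ℝ≥0∞ := 1 + ∑' k : ℕ, ENNReal.ofReal (((k : ℝ) + 2) ^ r *
        (C * Real.exp (-(a * ((k : ℝ) + 1))))) with hS
  have hSfin : S < ∞ :=
    ENNReal.add_lt_top.2 ⟨ENNReal.one_lt_top, (summable_rpow_mul_exp r ha C).tsum_ofReal_lt_top⟩
  refine lt_of_le_of_lt (limsup_le_of_le (h := ?_)) hSfin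
  filter_upwards [hev, eventually_gt_atTop 0] with n hn hn0
  have hφ : 0 < rate d β n := rate_pos hn0
  have hrisk : maxRisk β L M g x₀ r (fhat n) ≤ ENNReal.ofReal (rate d β n ^ r) * S := by
    refine iSup₂_le fun f hf => ?_
    have hprob := fun i => isProbabilityMeasure_obsLaw (hf.continuousOn hβ hL.le) (hg.1 i)
    have hprob' : IsProbabilityMeasure (sampleLaw d n g f) := by
      rw [sampleLaw_eq_pi]; infer_instance
    exact lintegral_rpow_le_of_exp_tail ((hfhat n).1.sub_const _).abs (fun z => abs_nonneg _) hφ hr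
      (hn f hf)
  calc _ ≤ ENNReal.ofReal (rate d β n ^ (-r)) * (ENNReal.ofReal (rate d β n ^ r) * S) := by gcongr
    _ = S := by
        rw [← mul_assoc, ← ENNReal.ofReal_mul (by positivity), ← Real.rpow_add hφ, neg_add_cancel,
          Real.rpow_zero, ENNReal.ofReal_one, one_mul]

/-! ### Smooth bumps in the Hölder class -/

section Bump

variable {d : ℕ} {x₀ : Fin d → ℝ} {h : ℝ}

/-- A multiple of the product of functions of the rescaled coordinates. -/
def scaledProd (x₀ : Fin d → ℝ) (h C : ℝ) (G : Fin d → ℝ → ℝ) (x : Fin d → ℝ) : ℝ :=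
  C * ∏ i, G i (rescale x₀ h x i)

theorem hasDerivAt_scaledProd (C : ℝ) {G : Fin d → ℝ → ℝ} (j : Fin d)
    (hG : Differentiable ℝ (G j)) (x : Fin d → ℝ) (t : ℝ) :
    HasDerivAt (fun t => scaledProd x₀ h C G (Function.update x j t))
      (scaledProd x₀ h (C / h) (Function.update G j (deriv (G j))) (Function.update x j t)) t := by
  have hsplit : ∀ (c : ℝ) (F : ℝ → ℝ) (s : ℝ),
      scaledProd x₀ h c (Function.update G j F) (Function.update x j s) =
        c * (F ((s - x₀ j) / h) * ∏ i ∈ Finset.univ.erase j, G i (rescale x₀ h x i)) := by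
    intro c F s
    rw [scaledProd, ← Finset.mul_prod_erase _ _ (Finset.mem_univ j)]
    simp only [Function.update_self, rescale]
    congr 2
    refine Finset.prod_congr rfl fun i hi => ?_
    rw [Function.update_of_ne (Finset.ne_of_mem_erase hi),
      Function.update_of_ne (Finset.ne_of_mem_erase hi)]
  have h1 := hsplit C (G j)
  simp only [Function.update_eq_self] at h1
  simp only [h1, hsplit]
  have h2 : HasDerivAt (fun s : ℝ => (s - x₀ j) / h) (1 / h) t :=
    ((hasDerivAt_id t).sub_const _).div_const h
  have h3 := ((hG ((t - x₀ j) / h)).hasDerivAt.comp t h2).mul_const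
    (∏ i ∈ Finset.univ.erase j, G i (rescale x₀ h x i))
  refine (h3.const_mul C).congr_deriv ?_
  ring

/-- Agreement on the cube suffices and is all that propagates, because `partialDeriv` is taken
within the unit interval. -/
theorem partialDeriv_eqOn_scaledProd {C : ℝ} {G : Fin d → ℝ → ℝ} {f : (Fin d → ℝ) → ℝ}
    (hf : EqOn f (scaledProd x₀ h C G) (cube d)) (j : Fin d) (hG : Differentiable ℝ (G j)) :
    EqOn (partialDeriv j f)
      (scaledProd x₀ h (C / h) (Function.update G j (deriv (G j)))) (cube d) := by
  intro x hx
  have hxj : x j ∈ Icc (0 : ℝ) 1 := ⟨hx.1 j, hx.2 j⟩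
  have h1 := (hasDerivAt_scaledProd (x₀ := x₀) (h := h) C j hG x (x j)).hasDerivWithinAt
    (s := Icc 0 1)
  rw [Function.update_eq_self] at h1
  rw [partialDeriv]
  refine HasDerivWithinAt.derivWithin (h1.congr_of_mem ?_ hxj)
    (uniqueDiffOn_Icc_zero_one _ hxj)
  exact fun t ht => hf (update_mem_cube hx j ht)

theorem differentiable_iterate_deriv {η : ℝ → ℝ} (hη : ContDiff ℝ (⊤ : ℕ∞) η) (k : ℕ) :
    Differentiable ℝ (deriv^[k] η) :=
  (hη.iterate_deriv k).differentiable (by simp)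

theorem iterate_partialDeriv_eqOn {C : ℝ} {G : Fin d → ℝ → ℝ} {f : (Fin d → ℝ) → ℝ}
    (hf : EqOn f (scaledProd x₀ h C G) (cube d)) (j : Fin d) (hG : ContDiff ℝ (⊤ : ℕ∞) (G j)) :
    ∀ k : ℕ, EqOn ((partialDeriv j)^[k] f)
      (scaledProd x₀ h (C / h ^ k) (Function.update G j (deriv^[k] (G j)))) (cube d)
  | 0 => by simpa using hf
  | k + 1 => by
    have ih := iterate_partialDeriv_eqOn hf j hG k
    have h1 := partialDeriv_eqOn_scaledProd ih j
      (by simpa using differentiable_iterate_deriv hG k)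
    simp only [Function.update_idem, Function.update_self] at h1
    rw [Function.iterate_succ_apply', Function.iterate_succ_apply', pow_succ, ← div_div]
    exact h1

theorem iterPartial_eqOn_scaledProd {C : ℝ} {η : ℝ → ℝ} (hη : ContDiff ℝ (⊤ : ℕ∞) η)
    {f : (Fin d → ℝ) → ℝ} (hf : EqOn f (scaledProd x₀ h C fun _ => η) (cube d)) (p : Fin d → ℕ) :
    EqOn (iterPartial p f) (scaledProd x₀ h (C / h ^ ∑ j, p j) fun j => deriv^[p j] η)
      (cube d) := by
  have key : ∀ l : List (Fin d), l.Nodup →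
      EqOn (l.foldr (fun j g => (partialDeriv j)^[p j] g) f)
        (scaledProd x₀ h (C / h ^ (l.map p).sum) fun j => if j ∈ l then deriv^[p j] η else η)
        (cube d) := by
    intro l
    induction l with
    | nil => intro _; simpa using hf
    | cons a l ih =>
      intro hl
      rw [List.nodup_cons] at hl
      have h1 := iterate_partialDeriv_eqOn (ih hl.2) a (by simpa [hl.1] using hη) (p a)
      rw [List.foldr_cons]
      convert h1 using 1
      have h2 : (fun j => if j ∈ a :: l then deriv^[p j] η else η) =
          Function.update (fun j => if j ∈ l then deriv^[p j] η else η) a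
            (deriv^[p a] (if a ∈ l then deriv^[p a] η else η)) := by
        ext1 j
        rcases eq_or_ne j a with rfl | hja
        · simp [hl.1]
        · simp [hja]
      rw [h2, List.map_cons, List.sum_cons, add_comm, pow_add, div_div]
  have h1 := key _ (List.nodup_finRange d)
  simpa [iterPartial, List.sum_ofFn, ← List.ofFn_eq_map] using h1

theorem hasCompactSupport_prod {G : Fin d → ℝ → ℝ} (hG : ∀ i, HasCompactSupport (G i)) :
    HasCompactSupport fun u : Fin d → ℝ => ∏ i, G i (u i) := by
  refine HasCompactSupport.intro (isCompact_univ_pi fun i => hG i) fun u hu => ?_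
  simp only [mem_univ_pi, not_forall] at hu
  obtain ⟨i, hi⟩ := hu
  exact Finset.prod_eq_zero (Finset.mem_univ i) (image_eq_zero_of_notMem_tsupport hi)

/-- Products of derivatives of a smooth bump are bounded and Lipschitz. -/
theorem exists_bound_prod_deriv {η : ℝ → ℝ} (hη : ContDiff ℝ (⊤ : ℕ∞) η)
    (hηc : HasCompactSupport η) (p : Fin d → ℕ) :
    ∃ B : ℝ, 0 ≤ B ∧ (∀ u : Fin d → ℝ, |∏ i, (deriv^[p i] η) (u i)| ≤ B) ∧
      ∀ u v : Fin d → ℝ, |∏ i, (deriv^[p i] η) (u i) - ∏ i, (deriv^[p i] η) (v i)| ≤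
        B * ∑ i, |u i - v i| := by
  have hsupp : ∀ k, HasCompactSupport (deriv^[k] η) := fun k => by
    induction k with
    | zero => exact hηc
    | succ k ih => rw [Function.iterate_succ_apply']; exact ih.deriv
  have hsm : ContDiff ℝ (⊤ : ℕ∞) fun u : Fin d → ℝ => ∏ i, (deriv^[p i] η) (u i) :=
    contDiff_prod fun i _ => (hη.iterate_deriv (p i)).comp (contDiff_apply ℝ ℝ i)
  have hcs : HasCompactSupport fun u : Fin d → ℝ => ∏ i, (deriv^[p i] η) (u i) :=
    hasCompactSupport_prod fun i => hsupp (p i)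
  obtain ⟨B₁, hB₁⟩ := hcs.exists_bound_of_continuous hsm.continuous
  obtain ⟨B₂, hB₂⟩ := hsm.lipschitzWith_of_hasCompactSupport hcs (by simp)
  have hB₁0 : 0 ≤ B₁ := (norm_nonneg _).trans (hB₁ 0)
  refine ⟨B₁ + B₂, by positivity, fun u => (hB₁ u).trans (by simp), fun u v => ?_⟩
  have h1 := hB₂.dist_le_mul u v
  rw [Real.dist_eq, dist_eq_norm] at h1
  have h2 : ‖u - v‖ ≤ ∑ i, |u i - v i| :=
    (pi_norm_le_iff_of_nonneg (Finset.sum_nonneg fun _ _ => abs_nonneg _)).2 fun i =>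
      Finset.single_le_sum (f := fun i => |u i - v i|) (fun _ _ => abs_nonneg _)
        (Finset.mem_univ i)
  refine h1.trans (mul_le_mul ?_ h2 (norm_nonneg _) (by positivity))
  linarith

/-- Interpolation: a bounded Lipschitz function is Hölder of every exponent in `[0, 1]`. The
Lipschitz bound is used for `s ≤ 1`, the uniform one for `s ≥ 1`. -/
theorem le_mul_rpow_of_le_of_le_mul {y B s γ : ℝ} (hB : 0 ≤ B) (hs : 0 ≤ s) (hγ0 : 0 ≤ γ)
    (hγ1 : γ ≤ 1) (h1 : y ≤ B) (h2 : y ≤ B * s) : y ≤ B * s ^ γ := by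
  rcases le_total s 1 with hs1 | hs1
  · refine h2.trans (mul_le_mul_of_nonneg_left ?_ hB)
    simpa using Real.rpow_le_rpow_of_exponent_ge_of_imp hs hs1 hγ1 (by simp)
  · exact h1.trans (le_mul_of_one_le_right hB (Real.one_le_rpow hs1 hγ0))

/-- Small multiples of rescaled smooth bumps belong to the Hölder class. -/
theorem exists_isHolder_bump {β L M : ℝ} (hβ : 0 < β) (hL : 0 < L) (hM : 0 < M) {η : ℝ → ℝ}
    (hη : ContDiff ℝ (⊤ : ℕ∞) η) (hηc : HasCompactSupport η) (d : ℕ) :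
    ∃ a₀ : ℝ, 0 < a₀ ∧ ∀ x₀ : Fin d → ℝ, ∀ h, 0 < h → h ≤ 1 → ∀ a, 0 ≤ a → a ≤ a₀ →
      IsHolder d β L M (scaledProd x₀ h (a * h ^ β) fun _ => η) := by
  set b := strictFloor β with hb
  obtain ⟨hb1, hb2⟩ := strictFloor_add_le hβ
  choose B hB0 hB1 hB2 using fun p : Fin d → ℕ => exists_bound_prod_deriv hη hηc p
  set A := ∑ p ∈ multiIndices d b, B p with hA
  have hA0 : 0 ≤ A := Finset.sum_nonneg fun p _ => hB0 p
  have hBA : ∀ p : Fin d → ℕ, ∑ j, p j ≤ b → B p ≤ A := fun p hp =>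
    Finset.single_le_sum (fun p _ => hB0 p) (mem_multiIndices.2 hp)
  refine ⟨min (L / (2 * A + 1)) (M / (A + 1)), by positivity,
    fun x₀ h hh hh1 a ha haa => ?_⟩
  have haL : a * (2 * A + 1) ≤ L := (le_div_iff₀ (by positivity)).1 (haa.trans (min_le_left _ _))
  have haM : a * (A + 1) ≤ M := (le_div_iff₀ (by positivity)).1 (haa.trans (min_le_right _ _))
  have heq := iterPartial_eqOn_scaledProd hη
    (fun _ _ => rfl : EqOn (scaledProd x₀ h (a * h ^ β) fun _ => η) _ (cube d))
  refine ⟨fun p _ j x hx => ?_, fun p hp x hx y hy => ?_, ?_⟩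
  · have hxj : x j ∈ Icc (0 : ℝ) 1 := ⟨hx.1 j, hx.2 j⟩
    exact DifferentiableWithinAt.congr
      (hasDerivAt_scaledProd (x₀ := x₀) (h := h) (a * h ^ β / h ^ ∑ j, p j)
        (G := fun j => deriv^[p j] η) j
        (differentiable_iterate_deriv hη (p j)) x (x j)).differentiableAt.differentiableWithinAt
      (fun t ht => heq p (update_mem_cube hx j ht)) (heq p (update_mem_cube hx j hxj))
  · rw [heq p hx, heq p hy, hp]
    -- This factor cancels exactly the `h ^ (-(β - b))` produced by rescaling the distance, so the
    -- Hölder constant does not depend on `h`.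
    have hsc : a * h ^ β / h ^ b = a * h ^ (β - b) := by
      rw [Real.rpow_sub hh, Real.rpow_natCast, mul_div_assoc]
    rw [scaledProd, scaledProd, ← mul_sub, abs_mul, hsc, abs_of_nonneg (by positivity)]
    set u := rescale x₀ h x
    set v := rescale x₀ h y
    have huv : ∑ i, |u i - v i| = (∑ i, |x i - y i|) / h := by
      rw [Finset.sum_div]
      refine Finset.sum_congr rfl fun i _ => ?_
      have : u i - v i = (x i - y i) / h := by
        simp only [u, v, rescale]
        ring
      rw [this, abs_div, abs_of_pos hh]
    have hs0 : 0 ≤ ∑ i, |x i - y i| := Finset.sum_nonneg fun _ _ => abs_nonneg _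
    have hBp := hBA p (by rw [hp])
    have hkey := le_mul_rpow_of_le_of_le_mul (B := 2 * A) (s := ∑ i, |u i - v i|) (γ := β - b)
      (by positivity) (Finset.sum_nonneg fun _ _ => abs_nonneg _) (by linarith) (by linarith)
      ((abs_sub _ _).trans (by linarith [hB1 p u, hB1 p v]))
      ((hB2 p u v).trans (mul_le_mul_of_nonneg_right (by linarith)
        (Finset.sum_nonneg fun _ _ => abs_nonneg _)))
    calc _ ≤ a * h ^ (β - b) * (2 * A * (∑ i, |u i - v i|) ^ (β - b)) := by gcongr
      _ = a * (2 * A) * (∑ i, |x i - y i|) ^ (β - b) := by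
          rw [huv, Real.div_rpow hs0 hh.le]
          have : 0 < h ^ (β - b) := by positivity
          field_simp
      _ ≤ L * (∑ i, |x i - y i|) ^ (β - b) := by
          gcongr
          linarith
  · have hsup : ∀ p ∈ multiIndices d b, (⨆ x ∈ cube d, ENNReal.ofReal
        |iterPartial p (scaledProd x₀ h (a * h ^ β) fun _ => η) x|) ≤ ENNReal.ofReal (a * B p) := by
      intro p hp
      refine iSup₂_le fun x hx => ENNReal.ofReal_le_ofReal ?_
      rw [heq p hx, scaledProd, abs_mul]
      have hpb : ((∑ j, p j : ℕ) : ℝ) ≤ b := by exact_mod_cast mem_multiIndices.1 hp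
      have hsc : a * h ^ β / h ^ ∑ j, p j ≤ a := by
        rw [mul_div_assoc, ← Real.rpow_natCast, ← Real.rpow_sub hh]
        exact mul_le_of_le_one_right ha (Real.rpow_le_one hh.le hh1 (by linarith))
      rw [abs_of_nonneg (by positivity)]
      exact mul_le_mul hsc (hB1 p _) (abs_nonneg _) ha
    refine (Finset.sum_le_sum hsup).trans ?_
    rw [← ENNReal.ofReal_sum_of_nonneg fun p _ => mul_nonneg ha (hB0 p), ← Finset.mul_sum]
    exact ENNReal.ofReal_le_ofReal (by linarith)

end Bump

/-! ### Hellinger affinities -/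

/-- The left side is `(√x - 1) ^ 2`; the bound follows from `log √x ≥ 1 - 1 / √x`. It is the
pointwise form of squared Hellinger distance being at most Kullback divergence. -/
theorem sq_sqrt_sub_one_le_klFun {x : ℝ} (hx : 0 ≤ x) :
    x + 1 - 2 * √x ≤ InformationTheory.klFun x := by
  rw [InformationTheory.klFun]
  rcases hx.eq_or_lt with rfl | hx
  · simp
  have hs : 0 < √x := Real.sqrt_pos.2 hx
  have h1 := Real.one_sub_inv_le_log_of_pos hs
  rw [Real.log_sqrt hx.le] at h1
  have h2 : x * (1 - (√x)⁻¹) = x - √x := by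
    rw [mul_sub, mul_one, ← div_eq_mul_inv, Real.div_sqrt]
  nlinarith [mul_le_mul_of_nonneg_left h1 hx.le]

theorem integrable_sqrt_mul {E : Type*} [MeasurableSpace E] {m : Measure E} {p q : E → ℝ}
    (hp : Integrable p m) (hq : Integrable q m) (hp0 : ∀ z, 0 ≤ p z) (hq0 : ∀ z, 0 ≤ q z) :
    Integrable (fun z => √(p z * q z)) m := by
  refine (hp.add hq).mono' ?_ (ae_of_all _ fun z => ?_)
  · exact Real.continuous_sqrt.comp_aestronglyMeasurable (hp.1.mul hq.1)
  · rw [Real.norm_eq_abs, abs_of_nonneg (Real.sqrt_nonneg _)]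
    refine Real.sqrt_le_iff.2 ⟨add_nonneg (hp0 z) (hq0 z), ?_⟩
    rw [Pi.add_apply]
    nlinarith [hp0 z, hq0 z, mul_nonneg (hp0 z) (hq0 z)]

/-- The affinity between two probability measures is controlled by the Kullback divergence. -/
theorem one_sub_klDiv_le_integral_sqrt_rnDeriv {E : Type*} [MeasurableSpace E] {μ ν : Measure E}
    [IsProbabilityMeasure μ] [IsProbabilityMeasure ν] {κ : ℝ} (hκ : 0 ≤ κ)
    (hkl : InformationTheory.klDiv μ ν ≤ ENNReal.ofReal κ) :
    μ ≪ ν ∧ 1 - κ / 2 ≤ ∫ z, √(μ.rnDeriv ν z).toReal ∂ν := by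
  have hne : InformationTheory.klDiv μ ν ≠ ∞ := (hkl.trans_lt ENNReal.ofReal_lt_top).ne
  have hac := (InformationTheory.klDiv_ne_top_iff.1 hne).1
  refine ⟨hac, ?_⟩
  rw [InformationTheory.klDiv_eq_lintegral_klFun, if_pos hac] at hkl
  have hD : Integrable (fun z => (μ.rnDeriv ν z).toReal) ν := Measure.integrable_toReal_rnDeriv
  have hS : Integrable (fun z => √(μ.rnDeriv ν z).toReal) ν := by
    simpa using integrable_sqrt_mul hD (integrable_const (1 : ℝ))
      (fun z => ENNReal.toReal_nonneg) (fun _ => zero_le_one)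
  have hI : Integrable (fun z => (μ.rnDeriv ν z).toReal + 1 - 2 * √(μ.rnDeriv ν z).toReal) ν :=
    (hD.add (integrable_const 1)).sub (hS.const_mul 2)
  have h1 : ∫ z, ((μ.rnDeriv ν z).toReal + 1 - 2 * √(μ.rnDeriv ν z).toReal) ∂ν ≤ κ := by
    rw [← ENNReal.ofReal_le_ofReal_iff hκ, ofReal_integral_eq_lintegral_ofReal hI]
    · refine (lintegral_mono fun z => ENNReal.ofReal_le_ofReal ?_).trans hkl
      exact sq_sqrt_sub_one_le_klFun ENNReal.toReal_nonneg
    · refine ae_of_all _ fun z => ?_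
      have h := Real.sq_sqrt (ENNReal.toReal_nonneg (a := μ.rnDeriv ν z))
      simp only [Pi.zero_apply]
      nlinarith [sq_nonneg (√(μ.rnDeriv ν z).toReal - 1)]
  have hDI : Integrable (fun z => (μ.rnDeriv ν z).toReal + 1) ν := hD.add (integrable_const 1)
  rw [integral_sub hDI (hS.const_mul 2), integral_add hD (integrable_const 1),
    Measure.integral_toReal_rnDeriv hac, integral_const_mul] at h1
  simp at h1
  linarith

/-- Finite divergence gives absolute continuity, so `g u = g (u + v) * D u` a.e. with `D` the
Radon–Nikodym derivative. The affinity then becomes an integral against Lebesgue measure. -/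
theorem IsNoiseDensity.one_sub_le_integral_sqrt {g : ℝ → ℝ} (hg : IsNoiseDensity g) {v κ : ℝ}
    (hκ : 0 ≤ κ) (hkl : InformationTheory.klDiv (noiseLaw g) (noiseLaw fun u => g (u + v)) ≤
      ENNReal.ofReal κ) : 1 - κ / 2 ≤ ∫ u, √(g u * g (u + v)) := by
  have := hg.isProbabilityMeasure
  have hgm : Measurable fun u => g (u + v) := hg.measurable.comp (measurable_id.add_const v)
  have hν : IsProbabilityMeasure (noiseLaw fun u => g (u + v)) := ⟨by
    rw [noiseLaw, withDensity_apply _ MeasurableSet.univ, Measure.restrict_univ,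
      lintegral_add_right_eq_self (fun u => ENNReal.ofReal (g u)) v, hg.lintegral_eq_one]⟩
  set ν := noiseLaw fun u => g (u + v) with hνdef
  obtain ⟨hac, hle⟩ := one_sub_klDiv_le_integral_sqrt_rnDeriv hκ hkl
  refine hle.trans_eq ?_
  set D := (noiseLaw g).rnDeriv ν with hD
  have hDm : Measurable D := Measure.measurable_rnDeriv _ _
  have h1 : volume.withDensity (fun u => ENNReal.ofReal (g (u + v)) * D u) =
      volume.withDensity fun u => ENNReal.ofReal (g u) := by
    have h2 := Measure.withDensity_rnDeriv_eq (noiseLaw g) ν hac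
    rw [← hD] at h2
    rw [← noiseLaw, ← h2, hνdef, noiseLaw, ← withDensity_mul _ hgm.ennreal_ofReal hDm]
    rfl
  have h2 : (fun u => ENNReal.ofReal (g u)) =ᵐ[volume]
      fun u => ENNReal.ofReal (g (u + v)) * D u :=
    (withDensity_eq_iff hg.measurable.ennreal_ofReal.aemeasurable
      (hgm.ennreal_ofReal.mul hDm).aemeasurable
      (by rw [hg.lintegral_eq_one]; exact ENNReal.one_ne_top)).1 h1.symm
  rw [hνdef, noiseLaw, integral_withDensity_eq_integral_toReal_smul hgm.ennreal_ofReal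
    (ae_of_all _ fun _ => ENNReal.ofReal_lt_top)]
  refine integral_congr_ae ?_
  filter_upwards [h2] with u hu
  have h3 : g u = g (u + v) * (D u).toReal := by
    have := congrArg ENNReal.toReal hu
    rwa [ENNReal.toReal_mul, ENNReal.toReal_ofReal (hg.nonneg _),
      ENNReal.toReal_ofReal (hg.nonneg _)] at this
  rw [ENNReal.toReal_ofReal (hg.nonneg _), smul_eq_mul, h3, mul_right_comm,
    Real.sqrt_mul (mul_nonneg (hg.nonneg _) (hg.nonneg _)), Real.sqrt_mul_self (hg.nonneg _)]

/-! ### Densities of the sample -/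

/-- The reference measure for one observation. -/
def obsRef (d : ℕ) : Measure ((Fin d → ℝ) × ℝ) := (volume.restrict (cube d)).prod volume

instance sigmaFinite_obsRef (d : ℕ) : SigmaFinite (obsRef d) := by
  unfold obsRef
  infer_instance

/-- The density of one observation. -/
def obsDensity {d : ℕ} (f : (Fin d → ℝ) → ℝ) (g : ℝ → ℝ) (z : (Fin d → ℝ) × ℝ) : ℝ :=
  g (z.2 - f z.1)

theorem measurable_obsDensity {d : ℕ} {f : (Fin d → ℝ) → ℝ} (hf : Measurable f) {g : ℝ → ℝ}
    (hg : IsNoiseDensity g) : Measurable (obsDensity f g) :=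
  hg.measurable.comp (measurable_snd.sub (hf.comp measurable_fst))

theorem obsLaw_eq_withDensity {d : ℕ} {f : (Fin d → ℝ) → ℝ} (hf : Measurable f) {g : ℝ → ℝ}
    (hg : IsNoiseDensity g) :
    obsLaw f g = (obsRef d).withDensity fun z => ENNReal.ofReal (obsDensity f g z) := by
  have := hg.isProbabilityMeasure
  have hmap : Measurable fun w : (Fin d → ℝ) × ℝ => (w.1, f w.1 + w.2) :=
    measurable_fst.prodMk ((hf.comp measurable_fst).add measurable_snd)
  have hdens := (measurable_obsDensity hf hg).ennreal_ofReal
  ext s hs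
  rw [obsLaw, Measure.map_apply hmap hs, Measure.prod_apply (hmap hs),
    withDensity_apply _ hs, ← lintegral_indicator hs, obsRef,
    lintegral_prod _ (hdens.indicator hs).aemeasurable]
  refine lintegral_congr fun x => ?_
  have hsec : MeasurableSet (Prod.mk x ⁻¹' ((fun w : (Fin d → ℝ) × ℝ => (w.1, f w.1 + w.2)) ⁻¹' s)) :=
    measurable_prodMk_left (hmap hs)
  rw [noiseLaw, withDensity_apply _ hsec, ← lintegral_indicator hsec,
    ← lintegral_add_left_eq_self (fun y => s.indicator _ (x, y)) (f x)]
  refine lintegral_congr fun w => ?_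
  have hiff : w ∈ Prod.mk x ⁻¹' ((fun w : (Fin d → ℝ) × ℝ => (w.1, f w.1 + w.2)) ⁻¹' s) ↔
      (x, f x + w) ∈ s := Iff.rfl
  by_cases hw : (x, f x + w) ∈ s
  · rw [indicator_of_mem hw, indicator_of_mem (hiff.2 hw), obsDensity, add_sub_cancel_left]
  · rw [indicator_of_notMem hw, indicator_of_notMem fun h => hw (hiff.1 h)]

theorem integrable_obsDensity {d : ℕ} {f : (Fin d → ℝ) → ℝ} (hf : Continuous f) {g : ℝ → ℝ}
    (hg : IsNoiseDensity g) : Integrable (obsDensity f g) (obsRef d) := by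
  refine ⟨(measurable_obsDensity hf.measurable hg).aestronglyMeasurable, ?_⟩
  rw [hasFiniteIntegral_iff_ofReal (f := obsDensity f g) (ae_of_all _ fun z => hg.nonneg _)]
  have hprob := isProbabilityMeasure_obsLaw hf.continuousOn hg
  have h1 : obsLaw f g univ = 1 := measure_univ
  rw [obsLaw_eq_withDensity hf.measurable hg, withDensity_apply _ MeasurableSet.univ,
    Measure.restrict_univ] at h1
  rw [h1]
  exact ENNReal.one_lt_top

/-- A product of measures with densities has the product density. -/
theorem pi_withDensity_ofReal {E : Type*} [MeasurableSpace E] {n : ℕ} (m : Measure E)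
    [SigmaFinite m] {p : Fin n → E → ℝ} (hp0 : ∀ i z, 0 ≤ p i z) (hp : ∀ i, Integrable (p i) m) :
    Measure.pi (fun i => m.withDensity fun z => ENNReal.ofReal (p i z)) =
      (Measure.pi fun _ : Fin n => m).withDensity fun z => ENNReal.ofReal (∏ i, p i (z i)) := by
  have hσ : ∀ i, SigmaFinite (m.withDensity fun z => ENNReal.ofReal (p i z)) := fun i =>
    SigmaFinite.withDensity_ofReal _
  refine Measure.pi_eq fun s hs => ?_
  rw [withDensity_apply _ (MeasurableSet.univ_pi hs), Measure.restrict_pi_pi,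
    ← ofReal_integral_eq_lintegral_ofReal
      (Integrable.fintype_prod fun i => (hp i).integrableOn)
      (ae_of_all _ fun z => Finset.prod_nonneg fun i _ => hp0 i _),
    integral_fintype_prod_eq_prod,
    ENNReal.ofReal_prod_of_nonneg fun i _ => integral_nonneg (hp0 i)]
  refine Finset.prod_congr rfl fun i _ => ?_
  rw [withDensity_apply _ (hs i), ofReal_integral_eq_lintegral_ofReal (hp i).integrableOn
    (ae_of_all _ (hp0 i))]

theorem integral_sqrt_prod {E : Type*} [MeasurableSpace E] {n : ℕ} (m : Measure E)
    [SigmaFinite m] {p q : Fin n → E → ℝ} (hp0 : ∀ i z, 0 ≤ p i z) (hq0 : ∀ i z, 0 ≤ q i z) :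
    ∫ z : Fin n → E, √((∏ i, p i (z i)) * ∏ i, q i (z i)) ∂(Measure.pi fun _ => m) =
      ∏ i, ∫ z, √(p i z * q i z) ∂m := by
  rw [← integral_fintype_prod_eq_prod (fun i z => √(p i z * q i z))]
  refine integral_congr_ae (ae_of_all _ fun z => ?_)
  simp only
  rw [← Finset.prod_mul_distrib, Real.sqrt_prod _ fun i _ => mul_nonneg (hp0 i _) (hq0 i _)]

/-- Two-point testing bound in terms of the affinity. -/
theorem sq_affinity_le {E : Type*} [MeasurableSpace E] {m : Measure E} {p q : E → ℝ}
    (hp : Integrable p m) (hq : Integrable q m) (hp0 : ∀ z, 0 ≤ p z) (hq0 : ∀ z, 0 ≤ q z)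
    (hp1 : ∫ z, p z ∂m = 1) (hq1 : ∫ z, q z ∂m = 1) {α : ℝ} (hα : 0 < α)
    (haff : α ≤ ∫ z, √(p z * q z) ∂m) {A : Set E} (hA : MeasurableSet A) :
    α ^ 2 / 2 ≤ ∫ z in A, p z ∂m + ∫ z in Aᶜ, q z ∂m := by
  have hamgm : ∀ {t x y : ℝ}, 0 < t → 0 ≤ x → 0 ≤ y → √(x * y) ≤ t * x / 2 + y / (2 * t) := by
    intro t x y ht hx hy
    refine Real.sqrt_le_iff.2 ⟨by positivity, ?_⟩
    have : (t * x / 2 + y / (2 * t)) ^ 2 - x * y = (t * x / 2 - y / (2 * t)) ^ 2 := by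
      field_simp
      ring
    nlinarith [sq_nonneg (t * x / 2 - y / (2 * t))]
  have hs := integrable_sqrt_mul hp hq hp0 hq0
  -- With this weight in the arithmetic-geometric inequality, the two terms bounded only by total
  -- mass cost `α / 4` each, which leaves half of the affinity.
  set t := 2 / α with ht
  have ht0 : 0 < t := by positivity
  have h1 : ∫ z in A, √(p z * q z) ∂m ≤ t * (∫ z in A, p z ∂m) / 2 + (∫ z in A, q z ∂m) / (2 * t) := by
    rw [← integral_const_mul, ← integral_div, ← integral_div,
      ← integral_add ((hp.integrableOn.const_mul _).div_const _) (hq.integrableOn.div_const _)]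
    exact integral_mono hs.integrableOn
      (((hp.integrableOn.const_mul _).div_const _).add (hq.integrableOn.div_const _))
      fun z => hamgm ht0 (hp0 z) (hq0 z)
  have h2 : ∫ z in Aᶜ, √(p z * q z) ∂m ≤
      t * (∫ z in Aᶜ, q z ∂m) / 2 + (∫ z in Aᶜ, p z ∂m) / (2 * t) := by
    rw [← integral_const_mul, ← integral_div, ← integral_div,
      ← integral_add ((hq.integrableOn.const_mul _).div_const _) (hp.integrableOn.div_const _)]
    refine integral_mono hs.integrableOn
      (((hq.integrableOn.const_mul _).div_const _).add (hp.integrableOn.div_const _))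
      fun z => ?_
    simp only
    rw [mul_comm]
    exact hamgm ht0 (hq0 z) (hp0 z)
  have h3 := integral_add_compl hA hs
  have h4 : ∫ z in A, q z ∂m ≤ 1 :=
    hq1 ▸ setIntegral_le_integral hq (ae_of_all _ hq0)
  have h5 : ∫ z in Aᶜ, p z ∂m ≤ 1 :=
    hp1 ▸ setIntegral_le_integral hp (ae_of_all _ hp0)
  have h6 : (∫ z in A, q z ∂m) / (2 * t) ≤ α / 4 := by
    rw [div_le_iff₀ (by positivity), ht]
    have : α / 4 * (2 * (2 / α)) = 1 := by field_simp; norm_num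
    linarith
  have h7 : (∫ z in Aᶜ, p z ∂m) / (2 * t) ≤ α / 4 := by
    rw [div_le_iff₀ (by positivity), ht]
    have : α / 4 * (2 * (2 / α)) = 1 := by field_simp; norm_num
    linarith
  have h8 : α / 2 ≤ t / 2 * (∫ z in A, p z ∂m + ∫ z in Aᶜ, q z ∂m) := by linarith
  have h9 := mul_le_mul_of_nonneg_left h8 hα.le
  have h10 : α * (t / 2 * (∫ z in A, p z ∂m + ∫ z in Aᶜ, q z ∂m)) =
      ∫ z in A, p z ∂m + ∫ z in Aᶜ, q z ∂m := by
    rw [ht]; field_simp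
  rw [h10] at h9
  linarith

/-! ### The lower bound on the minimax risk -/

/-- Conditionally on the design point, the two hypotheses are noise laws shifted by `f x` relative
to each other. The noise affinity bound is integrated over the cube. -/
theorem one_sub_le_integral_sqrt_obs {d : ℕ} {f : (Fin d → ℝ) → ℝ} (hf : Continuous f) {g : ℝ → ℝ}
    (hg : IsNoiseDensity g) {κ v₀ : ℝ} (hκ : 0 ≤ κ)
    (hkl : ∀ v, |v| ≤ v₀ → InformationTheory.klDiv (noiseLaw g) (noiseLaw fun u => g (u + v)) ≤
      ENNReal.ofReal (κ * v ^ 2)) (hfv : ∀ x, |f x| ≤ v₀) :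
    1 - κ / 2 * ∫ x in cube d, f x ^ 2 ≤
      ∫ z, √(obsDensity (fun _ => 0) g z * obsDensity f g z) ∂obsRef d := by
  have hint := integrable_sqrt_mul (integrable_obsDensity (continuous_const (y := (0 : ℝ))) hg)
    (integrable_obsDensity hf hg) (fun z => hg.nonneg _) (fun z => hg.nonneg _)
  rw [obsRef] at hint ⊢
  rw [integral_prod _ hint]
  have hf2 : IntegrableOn (fun x => f x ^ 2) (cube d) :=
    (hf.pow 2).continuousOn.integrableOn_compact isCompact_Icc
  calc 1 - κ / 2 * ∫ x in cube d, f x ^ 2 = ∫ x in cube d, (1 - κ / 2 * f x ^ 2) := by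
        rw [integral_sub (integrable_const _) (hf2.const_mul _), integral_const_mul]
        simp
    _ ≤ _ := by
        refine integral_mono ((integrable_const _).sub (hf2.const_mul _))
          hint.integral_prod_left fun x => ?_
        have h1 := hg.one_sub_le_integral_sqrt (v := -f x) (κ := κ * (-f x) ^ 2)
          (by positivity) (hkl _ (by rw [abs_neg]; exact hfv x))
        simp only [obsDensity, sub_zero]
        simp only [← sub_eq_add_neg, neg_sq] at h1
        linarith

theorem measureReal_sampleLaw {d n : ℕ} {f : (Fin d → ℝ) → ℝ} (hf : Continuous f)
    {g : ℕ → ℝ → ℝ} (hg : ∀ i, IsNoiseDensity (g i)) {A : Set (Sample d n)}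
    (hA : MeasurableSet A) : (sampleLaw d n g f).real A =
      ∫ z in A, ∏ i : Fin n, obsDensity f (g i) (z i) ∂(Measure.pi fun _ => obsRef d) := by
  have hlaw : sampleLaw d n g f = (Measure.pi fun _ : Fin n => obsRef d).withDensity
      fun z => ENNReal.ofReal (∏ i : Fin n, obsDensity f (g i) (z i)) := by
    rw [sampleLaw_eq_pi, ← pi_withDensity_ofReal (obsRef d)
      (p := fun i : Fin n => obsDensity f (g i)) (fun i z => (hg i).nonneg _)
      fun i => integrable_obsDensity hf (hg i)]
    congr 1
    funext i
    exact obsLaw_eq_withDensity hf.measurable (hg i)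
  have hnn : ∀ z : Sample d n, 0 ≤ ∏ i : Fin n, obsDensity f (g i) (z i) := fun z =>
    Finset.prod_nonneg fun i _ => (hg i).nonneg _
  rw [Measure.real, hlaw, withDensity_apply _ hA, ← ofReal_integral_eq_lintegral_ofReal
    (Integrable.fintype_prod fun i : Fin n => integrable_obsDensity hf (hg i)).integrableOn
    (ae_of_all _ hnn), ENNReal.toReal_ofReal (integral_nonneg hnn)]

theorem ofReal_mul_le_risk {Ω : Type*} [MeasurableSpace Ω] {μ : Measure Ω} [IsFiniteMeasure μ]
    {A : Set Ω} (hA : MeasurableSet A) {T : Ω → ℝ} {s r y : ℝ} (hs : 0 ≤ s) (hr : 0 ≤ r)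
    (hT : ∀ z ∈ A, s ≤ T z) (hy : y ≤ μ.real A) :
    ENNReal.ofReal (s ^ r * y) ≤ ∫⁻ z, ENNReal.ofReal (T z ^ r) ∂μ := by
  calc ENNReal.ofReal (s ^ r * y) ≤ ENNReal.ofReal (s ^ r) * μ A := by
        rw [ENNReal.ofReal_mul (by positivity), ← ofReal_measureReal]
        gcongr
    _ = ∫⁻ z, A.indicator (fun _ => ENNReal.ofReal (s ^ r)) z ∂μ :=
        (lintegral_indicator_const hA _).symm
    _ ≤ _ := by
        refine lintegral_mono fun z => ?_
        by_cases h : z ∈ A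
        · rw [indicator_of_mem h]
          exact ENNReal.ofReal_le_ofReal (Real.rpow_le_rpow hs (hT z h) hr)
        · rw [indicator_of_notMem h]
          exact zero_le

/-- Le Cam's two-point bound for the maximal risk. -/
theorem le_maxRisk_of_affinity {d n : ℕ} {β L M : ℝ} {g : ℕ → ℝ → ℝ}
    (hg : ∀ i, IsNoiseDensity (g i)) {x₀ : Fin d → ℝ} {f : (Fin d → ℝ) → ℝ} (hf : Continuous f)
    (hf0 : IsHolder d β L M fun _ => 0) (hf1 : IsHolder d β L M f) {τ α s r : ℝ} (hτ : 0 ≤ τ)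
    (hα : 0 < α) (hατ : α ≤ τ ^ n)
    (haff : ∀ i, τ ≤ ∫ z, √(obsDensity (fun _ => 0) (g i) z * obsDensity f (g i) z) ∂obsRef d)
    (hs : 0 ≤ s) (hr : 0 ≤ r) (hsf : 2 * s ≤ f x₀) {fhat : Sample d n → ℝ}
    (hfhat : Measurable fhat) :
    ENNReal.ofReal (s ^ r * (α ^ 2 / 4)) ≤ maxRisk β L M g x₀ r fhat := by
  have hf0c : Continuous fun _ : Fin d → ℝ => (0 : ℝ) := continuous_const
  have hprob : ∀ f : (Fin d → ℝ) → ℝ, Continuous f → IsProbabilityMeasure (sampleLaw d n g f) := by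
    intro f hf
    have := fun i => isProbabilityMeasure_obsLaw hf.continuousOn (hg i)
    rw [sampleLaw_eq_pi]
    infer_instance
  have hP0 := hprob _ hf0c
  have hP1 := hprob _ hf
  have hnn : ∀ (f : (Fin d → ℝ) → ℝ) (z : Sample d n), 0 ≤ ∏ i : Fin n, obsDensity f (g i) (z i) :=
    fun f z => Finset.prod_nonneg fun i _ => (hg i).nonneg _
  have hone : ∀ f : (Fin d → ℝ) → ℝ, Continuous f →
      ∫ z, ∏ i : Fin n, obsDensity f (g i) (z i) ∂(Measure.pi fun _ => obsRef d) = 1 := by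
    intro f hf
    have := hprob f hf
    rw [← setIntegral_univ, ← measureReal_sampleLaw hf hg MeasurableSet.univ, probReal_univ]
  -- The estimator is turned into a test: on `A` it errs by at least `s` under `0`, and off `A` by
  -- at least `s` under `f`, since `f x₀ ≥ 2 * s`.
  set A : Set (Sample d n) := {z | s ≤ |fhat z|} with hAdef
  have hA : MeasurableSet A := measurableSet_le measurable_const hfhat.abs
  have haffn : α ≤ ∫ z : Sample d n, √((∏ i : Fin n, obsDensity (fun _ => 0) (g i) (z i)) *
      ∏ i : Fin n, obsDensity f (g i) (z i)) ∂(Measure.pi fun _ => obsRef d) := by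
    rw [integral_sqrt_prod (obsRef d) (p := fun i : Fin n => obsDensity (fun _ => 0) (g i))
      (q := fun i : Fin n => obsDensity f (g i)) (fun i z => (hg i).nonneg _)
      fun i z => (hg i).nonneg _]
    refine hατ.trans ?_
    calc τ ^ n = ∏ _i : Fin n, τ := by simp
      _ ≤ _ := Finset.prod_le_prod (fun _ _ => hτ) fun i _ => haff i
  have htest := sq_affinity_le
    (Integrable.fintype_prod fun i : Fin n => integrable_obsDensity hf0c (hg i))
    (Integrable.fintype_prod fun i : Fin n => integrable_obsDensity hf (hg i))
    (hnn _) (hnn _) (hone _ hf0c) (hone _ hf) hα haffn hA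
  rw [← measureReal_sampleLaw hf0c hg hA, ← measureReal_sampleLaw hf hg hA.compl] at htest
  have hcase : α ^ 2 / 4 ≤ (sampleLaw d n g fun _ => 0).real A ∨
      α ^ 2 / 4 ≤ (sampleLaw d n g f).real Aᶜ := by
    by_contra! h
    linarith
  rcases hcase with h | h
  · refine (ofReal_mul_le_risk hA hs hr (T := fun z => |fhat z - 0|) (fun z hz => ?_) h).trans
      (le_iSup₂_of_le _ hf0 le_rfl)
    rw [sub_zero]
    exact hz
  · refine (ofReal_mul_le_risk hA.compl hs hr (T := fun z => |fhat z - f x₀|)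
      (fun z hz => ?_) h).trans (le_iSup₂_of_le _ hf1 le_rfl)
    have hz' : |fhat z| < s := not_le.1 hz
    rw [abs_sub_comm]
    refine le_trans ?_ (le_abs_self _)
    linarith [le_abs_self (fhat z)]

/-- The lower bound on the normalised minimax risk. -/
theorem exists_minimaxRisk_lower_bound {d : ℕ} {β L M : ℝ} (hβ : 0 < β) (hL : 0 < L) (hM : 0 < M)
    (x₀ : Fin d → ℝ) {g : ℕ → ℝ → ℝ} (hg : ∀ i, IsNoiseDensity (g i)) (hkl : KullbackCondition g)
    {r : ℝ} (hr : 0 ≤ r) : ∃ C : ℝ≥0∞, 0 < C ∧ ∀ n : ℕ, 0 < n →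
      C ≤ ENNReal.ofReal (rate d β n ^ (-r)) * minimaxRisk n β L M g x₀ r := by
  obtain ⟨v₀, hv₀, κ', hkl⟩ := hkl
  obtain ⟨κ, hκκ', hκ0⟩ : ∃ κ, κ' ≤ κ ∧ 0 ≤ κ := ⟨max κ' 0, le_max_left _ _, le_max_right _ _⟩
  obtain ⟨η⟩ : Nonempty (ContDiffBump (0 : ℝ)) := inferInstance
  have hηs : ContDiff ℝ (⊤ : ℕ∞) η := η.contDiff
  have hη0 : η 0 = 1 := η.one_of_mem_closedBall (Metric.mem_closedBall_self η.rIn_pos.le)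
  obtain ⟨a₀, ha₀, hholder⟩ := exists_isHolder_bump hβ hL hM hηs η.hasCompactSupport d
  obtain ⟨Φ, hΦ⟩ : ∃ Φ : (Fin d → ℝ) → ℝ, Φ = fun u => ∏ i, η (u i) := ⟨_, rfl⟩
  have hΦc : Continuous Φ := hΦ ▸ continuous_finsetProd _ fun i _ =>
    η.continuous.comp (continuous_apply i)
  have hΦs : HasCompactSupport Φ := hΦ ▸ hasCompactSupport_prod fun _ => η.hasCompactSupport
  have hΦ1 : ∀ u, |Φ u| ≤ 1 := fun u => by
    rw [hΦ, Finset.abs_prod]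
    exact Finset.prod_le_one (fun _ _ => abs_nonneg _) fun i _ => by
      rw [abs_of_nonneg η.nonneg]; exact η.le_one
  have hΦ2s : HasCompactSupport fun u => Φ u ^ 2 :=
    hΦs.comp_left (g := fun t : ℝ => t ^ 2) (zero_pow two_ne_zero)
  have hΦi : Integrable fun u => Φ u ^ 2 :=
    Continuous.integrable_of_hasCompactSupport (hΦc.pow 2) hΦ2s
  obtain ⟨I, hI⟩ : ∃ I, I = ∫ u, Φ u ^ 2 := ⟨_, rfl⟩
  have hI0 : 0 ≤ I := hI ▸ integral_nonneg fun u => sq_nonneg _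
  -- The bounds serve, in turn, membership in the class, the range of the Kullback condition, and `κ
  -- * a ^ 2 * I ≤ 1`, for which the last two are combined.
  obtain ⟨a, ha0, haa₀, hav₀, ha1, haκ⟩ : ∃ a, 0 < a ∧ a ≤ a₀ ∧ a ≤ v₀ ∧ a ≤ 1 ∧
      a * (κ * I + 1) ≤ 1 :=
    ⟨min (min a₀ v₀) (min 1 (1 / (κ * I + 1))), by positivity,
      (min_le_left _ _).trans (min_le_left _ _), (min_le_left _ _).trans (min_le_right _ _),
      (min_le_right _ _).trans (min_le_left _ _),
      (le_div_iff₀ (by positivity)).1 ((min_le_right _ _).trans (min_le_right _ _))⟩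
  have haI : κ * (a ^ 2 * I) ≤ 1 := by
    have h1 : a ^ 2 * (κ * I) ≤ a * (κ * I) := by
      have : a ^ 2 ≤ a := by nlinarith
      gcongr
    nlinarith
  refine ⟨ENNReal.ofReal ((a / 2) ^ r * ((1 / 2) ^ 2 / 4)),
    ENNReal.ofReal_pos.2 (by positivity), fun n hn => ?_⟩
  have hn1 : (1 : ℝ) ≤ n := by exact_mod_cast hn
  -- The bump may use the bandwidth with `L = 1`, since the size of `L` is absorbed in `a₀`. Then `h
  -- ≤ 1`, `h ^ β` equals the rate, and `n * h ^ d * φ ^ 2 = 1`.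
  set h := bandwidth d β 1 n with hh
  have hh0 : 0 < h := bandwidth_pos one_pos hn
  have hh1 : h ≤ 1 := by
    rw [hh, bandwidth, one_pow, one_mul]
    exact Real.rpow_le_one_of_one_le_of_nonpos hn1 (neg_nonpos.2 (by positivity))
  have hhβ : h ^ β = rate d β n := by
    rw [hh, bandwidth_rpow one_pos, one_pow, Real.one_rpow, one_mul]
  have hsize : n * h ^ d * rate d β n ^ 2 = 1 := by
    rw [hh, effective_sample_size hβ one_pos hn, one_pow, Real.one_rpow]
  have hφ : 0 < rate d β n := rate_pos hn
  set f : (Fin d → ℝ) → ℝ := scaledProd x₀ h (a * h ^ β) fun _ => η with hf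
  have hfΦ : ∀ x, f x = a * h ^ β * Φ (rescale x₀ h x) := fun x => by rw [hΦ]; rfl
  have hfc : Continuous f := by
    rw [funext hfΦ]
    exact continuous_const.mul (hΦc.comp (continuous_rescale x₀ h))
  have hfx₀ : f x₀ = a * rate d β n := by
    have : rescale x₀ h x₀ = 0 := by ext j; simp [rescale]
    rw [hfΦ, this, hhβ]
    simp [hΦ, hη0]
  have hfv : ∀ x, |f x| ≤ v₀ := fun x => by
    rw [hfΦ, abs_mul, abs_of_nonneg (by positivity)]
    have h1 : h ^ β ≤ 1 := Real.rpow_le_one hh0.le hh1 hβ.le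
    calc a * h ^ β * |Φ (rescale x₀ h x)| ≤ a * 1 * 1 := by
          gcongr
          exact hΦ1 _
      _ ≤ v₀ := by linarith
  have hf2 : ∫ x in cube d, f x ^ 2 ≤ a ^ 2 * I / n := by
    have hi : Integrable fun x => f x ^ 2 := by
      simp only [hfΦ, mul_pow]
      exact (integrable_rescale x₀ hh0 hΦi).const_mul _
    calc ∫ x in cube d, f x ^ 2 ≤ ∫ x, f x ^ 2 :=
          setIntegral_le_integral hi (ae_of_all _ fun x => sq_nonneg _)
      _ = (a * h ^ β) ^ 2 * (h ^ d * I) := by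
          simp only [hfΦ, mul_pow]
          rw [integral_const_mul, integral_rescale x₀ hh0 fun u => Φ u ^ 2, ← hI]
      _ = a ^ 2 * I / n := by
          rw [hhβ, eq_div_iff (by positivity)]
          calc _ = a ^ 2 * I * (n * h ^ d * rate d β n ^ 2) := by ring
            _ = _ := by rw [hsize, mul_one]
  have hzero : IsHolder d β L M fun _ => 0 := by
    have h1 := hholder x₀ h hh0 hh1 0 le_rfl ha₀.le
    have h2 : scaledProd x₀ h (0 * h ^ β) (fun _ => η) = fun _ => 0 := by
      ext x; simp [scaledProd]
    rwa [h2] at h1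
  have hkl' : ∀ i v, |v| ≤ v₀ → InformationTheory.klDiv (noiseLaw (g i))
      (noiseLaw fun u => g i (u + v)) ≤ ENNReal.ofReal (κ * v ^ 2) := fun i v hv =>
    (hkl i v hv).trans (ENNReal.ofReal_le_ofReal
      (mul_le_mul_of_nonneg_right hκκ' (sq_nonneg v)))
  set τ : ℝ := 1 + -(1 / (2 * n)) with hτ
  have hinv : 1 / (2 * (n : ℝ)) ≤ 1 / 2 := by
    rw [div_le_div_iff₀ (by positivity) (by positivity)]
    linarith
  have hτ0 : 0 ≤ τ := by linarith
  -- Bernoulli's inequality: an affinity loss of `1 / (2 * n)` per observation costs at most `1 / 2`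
  -- over the sample.
  have hατ : 1 / 2 ≤ τ ^ n := by
    refine le_trans (le_of_eq ?_) (one_add_mul_le_pow (a := -(1 / (2 * (n : ℝ)))) (by linarith) n)
    field_simp
    norm_num
  have haff : ∀ i, τ ≤
      ∫ z, √(obsDensity (fun _ => 0) (g i) z * obsDensity f (g i) z) ∂obsRef d := fun i => by
    refine le_trans ?_ (one_sub_le_integral_sqrt_obs hfc (hg i) hκ0 (hkl' i) hfv)
    have h1 : κ / 2 * ∫ x in cube d, f x ^ 2 ≤ κ / 2 * (a ^ 2 * I / n) := by gcongr
    have h2 : κ / 2 * (a ^ 2 * I / n) = κ * (a ^ 2 * I) * (1 / (2 * n)) := by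
      field_simp
    have h3 : κ * (a ^ 2 * I) * (1 / (2 * n)) ≤ 1 * (1 / (2 * n)) := by gcongr
    linarith
  have hrisk : ENNReal.ofReal ((a / 2 * rate d β n) ^ r * ((1 / 2) ^ 2 / 4)) ≤
      minimaxRisk n β L M g x₀ r :=
    le_iInf₂ fun fhat hfhat => le_maxRisk_of_affinity hg hfc hzero
      (hholder x₀ h hh0 hh1 a ha0.le haa₀) hτ0 (by norm_num) hατ haff (by positivity) hr
      (by rw [hfx₀]; linarith) hfhat
  calc ENNReal.ofReal ((a / 2) ^ r * ((1 / 2) ^ 2 / 4))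
      = ENNReal.ofReal (rate d β n ^ (-r)) *
          ENNReal.ofReal ((a / 2 * rate d β n) ^ r * ((1 / 2) ^ 2 / 4)) := by
        rw [← ENNReal.ofReal_mul (by positivity), Real.mul_rpow (by positivity) hφ.le]
        congr 1
        have : rate d β n ^ (-r) * rate d β n ^ r = 1 := by
          rw [← Real.rpow_add hφ, neg_add_cancel, Real.rpow_zero]
        linear_combination (-(a / 2) ^ r * ((1 / 2) ^ 2 / 4)) * this
    _ ≤ _ := by gcongr

end RhoLPA

end

theorem theorem1 (d : ℕ) (hd : 0 < d) (β L M c : ℝ) (hβ : 0 < β) (hL : 0 < L) (hM : 0 < M)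
    (hc : 0 < c) (x₀ : Fin d → ℝ) (hx₀ : x₀ ∈ RhoLPA.cube d)
    (K : (Fin d → ℝ) → ℝ) (hK : RhoLPA.IsKernel K)
    (hKx₀ : 0 < ∫ z in RhoLPA.inwardDirections x₀, K z)
    (ρ : ℝ → ℝ) (g : ℕ → ℝ → ℝ) (hρ : RhoLPA.IsContrast ρ g) (hg : g ∈ RhoLPA.densityClass ρ c)
    (fhat : ∀ n, RhoLPA.Sample d n → ℝ)
    (hfhat : ∀ n, RhoLPA.IsLPAEstimator (RhoLPA.strictFloor β) M ρ K x₀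
      (RhoLPA.bandwidth d β L n) (fhat n)) :
    (∀ r : ℝ, 1 ≤ r → RhoLPA.UpperBound β L M g x₀ r (RhoLPA.rate d β) fhat) ∧
    (RhoLPA.KullbackCondition g →
      ∀ r : ℝ, 1 ≤ r → RhoLPA.IsMinimax β L M g x₀ r (RhoLPA.rate d β) fhat) := by
  have hupper : ∀ r : ℝ, 1 ≤ r → RhoLPA.UpperBound β L M g x₀ r (RhoLPA.rate d β) fhat :=
    fun r hr => RhoLPA.upperBound_lpa hβ hL hM hc hx₀ hK hKx₀ hρ hg hfhat (zero_le_one.trans hr)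
  refine ⟨hupper, fun hkl r hr => ?_⟩
  obtain ⟨C, hC, hle⟩ := RhoLPA.exists_minimaxRisk_lower_bound hβ hL hM x₀ hg.1 hkl
    (zero_le_one.trans hr)
  refine ⟨hC.trans_le (le_liminf_of_le (h := ?_)), hC.trans_le (le_liminf_of_le (h := ?_)),
    hupper r hr⟩
  · filter_upwards [eventually_gt_atTop 0] with n hn using hle n hn
  · filter_upwards [eventually_gt_atTop 0] with n hn
    refine (hle n hn).trans ?_
    gcongr
    exact iInf₂_le (fhat n) (hfhat n).1
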